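/- **Model.** A principal and an agent have safe payoffs $\theta<1$ and $\beta>0$; the risky action pays $\omega\in\{0,1\}$ to both, with common prior $\mu=\Pr(\omega=1)$, $\beta<\mu<\theta$. Both discount at rate $\rho>0$. Real news reveals $\omega$ and arrives at a random time, independent of $\omega$, with continuous positive density $g$ on $[0,\infty)$, $G(t)=\int_0^t g<1$ for all finite $t$, and strictly decreasing hazard rate $H_R=g/(1-G)$. With probability $\sigma\in(0,1)$ the agent is manipulative and can, at one time of his choice, generate fake type-1 news, indistinguishable from real news of $\omega=1$. Let $\phi_P=\frac{\rho\theta}{\mu(1-\theta)}$, $\phi_A=\frac{\rho\mu}{\beta(1-\mu)}$ and assume (A1) $H_R(0)>\phi_P>\lim_{t\to\infty}H_R(t)$ and (A2) $\phi_P>\phi_A$. For $t\in[0,\infty]$ (with $e^{-\rho\infty}=0$) let $$u_P^{FB}(t)=\int_0^t e^{-\rho s}g(s)(\mu+(1-\mu)\theta)\,ds+e^{-\rho t}(1-G(t))\theta,\qquad u_A^{FB}(t)=\int_0^t e^{-\rho s}g(s)(\mu+(1-\mu)\beta)\,ds+e^{-\rho t}(1-G(t))\mu,$$ let $\tau_P,\tau_A$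 maximize $u_P^{FB},u_A^{FB}$ over $[0,\infty]$, and let $$\bar\sigma=1-\exp\Big\{-\int_0^{\tau_P}\frac{\mu(1-\theta)H_R(s)-\rho\theta}{\theta-\mu}\,ds\Big\}.$$ A strategy profile consists of a (measurable) response $a(t)\in[0,1]$, the probability that the principal chooses risky after type-1 news at $t$, and of probability distributions $F_P$ (the principal's stopping time, at which she selects safe if no news has come) and $F_A$ (the manipulative agent's faking time) on $[0,\infty]$, each the sum of an absolutely continuous and a discrete part, with generalized density $f_P$, $f_A$ (density plus atoms, written as multiples of Dirac's $\delta$; integrals over $[0,t]$ include the atoms at both ends). After type-0 news the principal selects safe. Let $$b(s)=\frac{\mu g(s)(1-\sigma F_A(s))+\mu\sigma f_A(s)(1-G(s))}{\mu g(s)(1-\sigma F_A(s))+\sigma f_A(s)(1-G(s))}$$ ($b(s)=\mu$ at an atom of $F_A$) be the principal's belief that $\omega=1$ after type-1 news at $s$. If she waits until $t\in[0,\infty]$ her payoff is $$u_P(t)=\int_0^t e^{-\rho s}\Big\{(1-\mu)g(s)(1-\sigma F_A(s))\theta+\big[\mu g(s)(1-\sigma F_A(s))+\sigma f_A(s)(1-G(s))\big]\big[(1-a(s))\theta+a(s)b(s)\big]\Big\}ds+e^{-\rho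 t}(1-G(t))(1-\sigma F_A(t))\theta,$$ and if the agent waits until $t$ to fake, his payoff is $$u_A(t)=\int_0^t e^{-\rho s}\Big\{g(s)(1-F_P(s))\big[(1-\mu)\beta+\mu((1-a(s))\beta+a(s))\big]+f_P(s)(1-G(s))\beta\Big\}ds+e^{-\rho t}(1-G(t))(1-F_P(t))\big[(1-a(t))\beta+\mu a(t)\big].$$ The profile is an equilibrium if $f_A(t)>0$ implies $u_A(t)\ge u_A(t')$ for all $t'$; for all finite $t\ge0$, $a(t)=1$ if $b(t)>\theta$ and $a(t)=0$ if $b(t)<\theta$; and $f_P(t)>0$ implies $u_P(t)\ge u_P(t')$ for all $t'$. The principal's payoff in it is the expectation of $u_P$ under $F_P$; the equilibrium has beneficial search if this exceeds $\theta$. If authority over search and action is delegated to the agent, the principal's payoff is $$u_P^D=\int_0^{\tau_A}e^{-\rho s}g(s)(\mu+(1-\mu)\theta)\,ds+e^{-\rho\tau_A}(1-G(\tau_A))\mu .$$ The conflict of interest is mild if $u_P^D\ge\theta$. **Proposition (Delegating to the Agent).** Suppose the conflict of interest is mild. For every $\sigma\in(\bar\sigma,1)$, $u_P^D$ is at least the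 principal's payoff in any equilibrium. If moreover $u_P^D>\theta$, then: 1. (high prior) there is $\sigma_0\in(0,1)$ such that for all $\sigma\in(\sigma_0,1)$, $u_P^D$ is strictly higher than the principal's payoff in any equilibrium; 2. for every $\sigma\in(\bar\sigma,1)$, $u_P^D$ is strictly higher than the principal's payoff in any equilibrium; 3. there is $\widetilde\sigma_D$ with $0<\widetilde\sigma_D<\bar\sigma$ such that for every $\sigma\in(\widetilde\sigma_D,\bar\sigma)$ there is exactly one equilibrium with beneficial search (unique in $F_P$, in $F_A$ and in $a(t)$, $t\ge0$), and $u_P^D$ is strictly higher than the principal's payoff in it and in any other equilibrium. -/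

import Mathlib

open MeasureTheory Set Filter Topology
open scoped ENNReal

noncomputable section

namespace FakeNews

/-- The set of finite times `s ≥ 0` not exceeding `t ∈ [0, ∞]`: the interval `[0, t]` if `t` is
finite, and `[0, ∞)` if `t = ∞`. -/
def upTo (t : ℝ≥0∞) : Set ℝ := {s : ℝ | 0 ≤ s ∧ ENNReal.ofReal s ≤ t}

/-! ### Primitives -/

/-- The primitives of the model, apart from the prior probability `σ` of the manipulative type.
`θ`, `β` are the safe payoffs of principal and agent, `μ` is the common prior that the risky
payoff is `1`, `ρ` is the discount rate and `g` is the density (on `[0, ∞)`) of the arrival time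
of real news, whose hazard rate is decreasing.  The total mass of `g` is at most one, so a
positive probability that real news never arrives is allowed. -/
structure Environment where
  θ : ℝ
  β : ℝ
  μ : ℝ
  ρ : ℝ
  g : ℝ → ℝ
  θ_lt_one : θ < 1
  β_pos : 0 < β
  β_lt_μ : β < μ
  μ_lt_θ : μ < θ
  ρ_pos : 0 < ρ
  g_cont : ContinuousOn g (Ici 0)
  g_pos : ∀ t, 0 ≤ t → 0 < g t
  cdf_lt_one : ∀ t, 0 ≤ t → (∫ s in (0 : ℝ)..t, g s) < 1
  hazard_strictAnti : StrictAntiOn (fun t => g t / (1 - ∫ s in (0 : ℝ)..t, g s)) (Ici 0)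

/-- A probability measure over times in `[0, ∞]` that has an absolutely continuous component (with
density `density` on `[0, ∞)`) and a discrete component (with mass `atom t` at `t ∈ [0, ∞]`). -/
structure MixedTime where
  density : ℝ → ℝ
  atom : ℝ≥0∞ → ℝ
  density_meas : Measurable density
  density_nonneg : ∀ s, 0 ≤ density s
  density_integrable : IntegrableOn density (Ici 0)
  atom_nonneg : ∀ t, 0 ≤ atom t
  atom_summable : Summable atom
  total : (∫ s in Ici (0 : ℝ), density s) + (∑' t, atom t) = 1

namespace MixedTime

/-- The cumulative distribution function. -/
def cdf (F : MixedTime) (t : ℝ≥0∞) : ℝ :=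
  (∫ s in upTo t, F.density s) + (∑' m, (Iic t).indicator F.atom m)

/-- The generalized density (density plus atoms) is positive at `t`. -/
def Charges (F : MixedTime) (t : ℝ≥0∞) : Prop :=
  0 < F.atom t ∨ (t ≠ ∞ ∧ 0 < F.density t.toReal)

/-- The expectation of `u` when the time is drawn from `F`. -/
def expect (F : MixedTime) (u : ℝ≥0∞ → ℝ) : ℝ :=
  (∫ s in Ici (0 : ℝ), F.density s * u (ENNReal.ofReal s)) + (∑' t, F.atom t * u t)

end MixedTime

/-- A strategy profile: the probability `response t` with which the principal selects the risky
action after type-1 news at `t`, her mixed stopping time, and the mixed faking time of the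
manipulative agent. -/
structure Profile where
  response : ℝ → ℝ
  stopping : MixedTime
  faking : MixedTime
  response_meas : Measurable response
  response_nonneg : ∀ t, 0 ≤ response t
  response_le_one : ∀ t, response t ≤ 1

/-- Two profiles describe the same strategies: equal distribution functions of the stopping time
and of the faking time, and equal responses to news at all times `t ≥ 0`. -/
def Profile.Same (p q : Profile) : Prop :=
  p.stopping.cdf = q.stopping.cdf ∧ p.faking.cdf = q.faking.cdf ∧
    ∀ t, 0 ≤ t → p.response t = q.response t

namespace Environment

variable (E : Environment)

/-- The distribution function of the arrival time of real news, at finite times. -/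
def G (t : ℝ) : ℝ := ∫ s in (0 : ℝ)..t, E.g s

/-- The hazard rate of real news. -/
def hazard (t : ℝ) : ℝ := E.g t / (1 - E.G t)

def phiP : ℝ := E.ρ * E.θ / (E.μ * (1 - E.θ))

def phiA : ℝ := E.ρ * E.μ / (E.β * (1 - E.μ))

/-- `H(0) > φ_P > H(∞)`, where `H(∞)` is the limit of the hazard rate. -/
def A1 : Prop :=
  E.phiP < E.hazard 0 ∧ ∃ L, Tendsto E.hazard atTop (𝓝 L) ∧ L < E.phiP

/-- `φ_P > φ_A`. -/
def A2 : Prop := E.phiA < E.phiP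

/-- The discount factor `exp (-ρ t)`, equal to `0` at `t = ∞`. -/
def disc (t : ℝ≥0∞) : ℝ := if t = ∞ then 0 else Real.exp (-E.ρ * t.toReal)

/-! ### First-best benchmarks, the threshold for the prior, and delegation -/

/-- Expected payoff of a player whose safe payoff is `safe`, who waits for real news until `t`,
acts correctly on it, and obtains `default` if no news has come. -/
def search (safe default : ℝ) (t : ℝ≥0∞) : ℝ :=
  (∫ s in upTo t, Real.exp (-E.ρ * s) * E.g s * (E.μ + (1 - E.μ) * safe)) +
    E.disc t * (1 - E.G t.toReal) * default

/-- First-best payoff of the principal (default action: safe). -/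
def uFBP (t : ℝ≥0∞) : ℝ := E.search E.θ E.θ t

/-- First-best payoff of the agent (default action: risky). -/
def uFBA (t : ℝ≥0∞) : ℝ := E.search E.β E.μ t

/-- `τ` is an optimal first-best search duration of the principal. -/
def IsOptimalP (τ : ℝ≥0∞) : Prop := ∀ t, E.uFBP t ≤ E.uFBP τ

/-- `τ` is an optimal first-best search duration of the agent. -/
def IsOptimalA (τ : ℝ≥0∞) : Prop := ∀ t, E.uFBA t ≤ E.uFBA τ

/-- The threshold `σ̄`, as a function of the principal's first-best duration `τP`. -/
def sigmaBar (τP : ℝ≥0∞) : ℝ :=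
  1 - Real.exp (-(∫ s in upTo τP,
    (E.μ * (1 - E.θ) * E.hazard s - E.ρ * E.θ) / (E.θ - E.μ)))

/-- The principal's payoff of delegating search and action to the agent, who waits for news until
his first-best duration `τA` and then selects the risky action. -/
def uD (τA : ℝ≥0∞) : ℝ := E.search E.θ E.μ τA

/-- Mild conflict of interest: the principal would not rather terminate at once than delegate. -/
def MildConflict (τA : ℝ≥0∞) : Prop := E.θ ≤ E.uD τA

/-! ### The game -/

variable (σ : ℝ) (p : Profile)

/-- Probability that no fake news arrives at or before the finite time `s`. -/
def noFake (s : ℝ) : ℝ := 1 - σ * p.faking.cdf (ENNReal.ofReal s)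

/-- Probability that the principal's stopping time exceeds the finite time `s`. -/
def noStop (s : ℝ) : ℝ := 1 - p.stopping.cdf (ENNReal.ofReal s)

/-- Density of type-1 news at `s`, apart from atoms of the faking strategy. -/
def w1 (s : ℝ) : ℝ :=
  E.μ * E.g s * noFake σ p s + σ * p.faking.density s * (1 - E.G s)

/-- The principal's belief that the risky payoff is `1` after type-1 news at `s`.  At an atom of
the faking strategy real news has relative weight zero, and the belief is the prior. -/
def belief (s : ℝ) : ℝ :=
  open Classical in
  if 0 < p.faking.atom (ENNReal.ofReal s) then E.μ
  else (E.μ * E.g s * noFake σ p s + E.μ * σ * p.faking.density s * (1 - E.G s)) / E.w1 σ p s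

/-- The principal's expected payoff upon type-1 news at `s`. -/
def newsValue (s : ℝ) : ℝ :=
  (1 - p.response s) * E.θ + p.response s * E.belief σ p s

/-- The principal's expected payoff of waiting for news until `t` and then selecting safe: real
type-0 news and non-atomic type-1 news, atoms of fake news at or before `t`, and no news. -/
def uP (t : ℝ≥0∞) : ℝ :=
  (∫ s in upTo t, Real.exp (-E.ρ * s) *
      ((1 - E.μ) * E.g s * noFake σ p s * E.θ + E.w1 σ p s * E.newsValue σ p s)) +
    (∑' m, (Iic t).indicator (fun m => E.disc m *
      (σ * p.faking.atom m * (1 - E.G m.toReal)) * E.newsValue σ p m.toReal) m) +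
    E.disc t * ((1 - E.G t.toReal) * (1 - σ * p.faking.cdf t)) * E.θ

/-- The agent's expected payoff of waiting until `t` to generate a fake: real news and non-atomic
stopping by the principal, atoms of stopping at or before `t`, and the fake itself. -/
def uA (t : ℝ≥0∞) : ℝ :=
  (∫ s in upTo t, Real.exp (-E.ρ * s) *
      ((1 - E.μ) * E.g s * noStop p s * E.β +
        E.μ * E.g s * noStop p s * ((1 - p.response s) * E.β + p.response s) +
        p.stopping.density s * (1 - E.G s) * E.β)) +
    (∑' m, (Iic t).indicator (fun m => E.disc m *
      (p.stopping.atom m * (1 - E.G m.toReal)) * E.β) m) +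
    E.disc t * ((1 - E.G t.toReal) * (1 - p.stopping.cdf t)) *
      ((1 - p.response t.toReal) * E.β + E.μ * p.response t.toReal)

/-- Equilibrium: the agent's faking strategy charges only optimal times, the principal's response
to type-1 news is optimal at every time given her belief, and her stopping strategy charges only
optimal times. -/
structure IsEquilibrium : Prop where
  faking_opt : ∀ t t', p.faking.Charges t → E.uA p t' ≤ E.uA p t
  response_one : ∀ t, 0 ≤ t → E.θ < E.belief σ p t → p.response t = 1
  response_zero : ∀ t, 0 ≤ t → E.belief σ p t < E.θ → p.response t = 0
  stopping_opt : ∀ t t', p.stopping.Charges t → E.uP σ p t' ≤ E.uP σ p t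

/-- The principal's expected payoff in the profile. -/
def payoffP : ℝ := p.stopping.expect (E.uP σ p)

/-- The principal benefits from search: her payoff exceeds that of acting on the prior alone. -/
def Beneficial : Prop := E.θ < E.payoffP σ p

end Environment

end FakeNews

end

noncomputable section

namespace FakeNews

/-! Let D be the discounted survival function of real news, H its hazard rate, P the probability
that the principal has not stopped, N the probability that no fake has come, and T the time at which
H falls to φ_P. Since D' = -D(ρ + H), integration by parts turns the principal's payoff into θ plus
the integral of a marginal value, and the agent's into β plus such an integral plus the value of the
fake (`uP_eq`, `uA_eq`). The agent's incentives are carried by his rent R: his optimal value less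
what waiting has earned him, in units of μ - β. With a the response to news, R ≥ D P a everywhere,
with equality where he fakes.

The delegation payoff does not depend on σ, so everything rests on the shape of a beneficial
equilibrium. A response below one requires fakes and a belief of at most θ, and then waiting has
negative marginal value for the principal. So she does not stop while R < D P, and because H > φ_A
this gap cannot close before H falls below φ_P; from then on waiting loses anyway. She would thus
never stop later, which is absurd; hence R ≥ D P, and news is followed as long as search goes on
(`dsurv_mul_noStop_le`, `response_eq_one`). Once R = D P, equality persists until she has stopped
for sure (`rent_le_of_rent_le`): in a gap there would be no fakes, the principal would strictly
prefer to wait, and with P constant R would fall faster than D P.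

This leaves one family of profiles, indexed by a time t₀ > 0 (`IsEquilibrium.exists_isSearchFrom`).
Before t₀ neither player acts; from t₀ to T the agent's indifference forces the stopping hazard
`stopRate` and the principal's indifference the faking hazard `fakeRate`; at T she stops for sure.
All faking mass is spent by T, so 1 - σ = exp(-∫_{t₀}^T fakeRate). This determines t₀ and forces σ <
σ̄, and the payoff is θ + ∫_0^{t₀} marginal. Above σ̄ the principal therefore gets at most θ. As σ
increases to σ̄, t₀ tends to 0 and the payoff to θ, hence below any delegation payoff exceeding θ.
Conversely, the profile with this t₀ is verified to be an equilibrium. -/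

theorem upTo_eq (t : ℝ≥0∞) : upTo t = Ici 0 ∩ ENNReal.ofReal ⁻¹' Iic t := rfl

theorem measurableSet_upTo (t : ℝ≥0∞) : MeasurableSet (upTo t) :=
  measurableSet_Ici.inter (ENNReal.measurable_ofReal measurableSet_Iic)

theorem upTo_subset (t : ℝ≥0∞) : upTo t ⊆ Ici 0 := fun _ h => h.1

theorem upTo_top : upTo ∞ = Ici 0 := by ext; simp [upTo]

theorem upTo_ofReal {t : ℝ} (ht : 0 ≤ t) : upTo (ENNReal.ofReal t) = Icc 0 t := by
  ext s
  simp only [upTo, mem_ofPred_eq, mem_Icc]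
  exact and_congr_right fun _ => ENNReal.ofReal_le_ofReal_iff ht

theorem integral_upTo_ofReal (f : ℝ → ℝ) {t : ℝ} (ht : 0 ≤ t) :
    ∫ s in upTo (ENNReal.ofReal t), f s = ∫ s in (0 : ℝ)..t, f s := by
  rw [upTo_ofReal ht, integral_Icc_eq_integral_Ioc, intervalIntegral.integral_of_le ht]

/-! ### Random times as probability laws on [0, ∞] -/

namespace MixedTime

variable (F : MixedTime)

/-- The law of the random time as a measure on `[0, ∞]`. -/
def law : Measure ℝ≥0∞ :=
  ((volume.restrict (Ici 0)).withDensity fun s => ENNReal.ofReal (F.density s)).map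
    ENNReal.ofReal + Measure.sum fun t => ENNReal.ofReal (F.atom t) • Measure.dirac t

theorem lintegral_law {f : ℝ≥0∞ → ℝ≥0∞} (hf : Measurable f) :
    ∫⁻ t, f t ∂F.law = (∫⁻ s in Ici (0 : ℝ), ENNReal.ofReal (F.density s) * f (ENNReal.ofReal s)) +
      ∑' t, ENNReal.ofReal (F.atom t) * f t := by
  rw [law, lintegral_add_measure, lintegral_map hf ENNReal.measurable_ofReal,
    lintegral_sum_measure]
  congr 1
  · exact lintegral_withDensity_eq_lintegral_mul _ F.density_meas.ennreal_ofReal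
      (hf.comp ENNReal.measurable_ofReal)
  refine tsum_congr fun t => ?_
  rw [lintegral_smul_measure, lintegral_dirac' _ hf, smul_eq_mul]

theorem lintegral_law_ofReal {f : ℝ≥0∞ → ℝ} (hf : Measurable f) (h0 : ∀ t, 0 ≤ f t) {C : ℝ}
    (hC : ∀ t, f t ≤ C) :
    ∫⁻ t, ENNReal.ofReal (f t) ∂F.law =
      ENNReal.ofReal ((∫ s in Ici (0 : ℝ), F.density s * f (ENNReal.ofReal s)) +
        ∑' t, F.atom t * f t) := by
  have hC0 : 0 ≤ C := (h0 0).trans (hC 0)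
  have hsum : Summable fun t => F.atom t * f t :=
    Summable.of_nonneg_of_le (fun t => mul_nonneg (F.atom_nonneg t) (h0 t))
      (fun t => mul_le_mul_of_nonneg_left (hC t) (F.atom_nonneg t)) (F.atom_summable.mul_right C)
  have hint : IntegrableOn (fun s => F.density s * f (ENNReal.ofReal s)) (Ici 0) := by
    refine Integrable.mul_bdd (c := C) F.density_integrable
      (hf.comp ENNReal.measurable_ofReal).aestronglyMeasurable (Eventually.of_forall fun s => ?_)
    simpa [abs_of_nonneg (h0 _)] using hC _
  rw [F.lintegral_law hf.ennreal_ofReal, ENNReal.ofReal_add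
    (setIntegral_nonneg measurableSet_Ici fun s _ => mul_nonneg (F.density_nonneg s) (h0 _))
    (tsum_nonneg fun t => mul_nonneg (F.atom_nonneg t) (h0 t)),
    ofReal_integral_eq_lintegral_ofReal hint
      (Eventually.of_forall fun s => mul_nonneg (F.density_nonneg s) (h0 _)),
    ENNReal.ofReal_tsum_of_nonneg (fun t => mul_nonneg (F.atom_nonneg t) (h0 t)) hsum]
  simp only [ENNReal.ofReal_mul (F.density_nonneg _), ENNReal.ofReal_mul (F.atom_nonneg _)]

instance : IsProbabilityMeasure F.law := by
  constructor
  have := F.lintegral_law_ofReal (f := fun _ => 1) measurable_const (fun _ => zero_le_one)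
    (C := 1) (fun _ => le_rfl)
  simpa [F.total] using this

theorem integral_law {f : ℝ≥0∞ → ℝ} (hf : Measurable f) (h0 : ∀ t, 0 ≤ f t) {C : ℝ}
    (hC : ∀ t, f t ≤ C) :
    ∫ t, f t ∂F.law = (∫ s in Ici (0 : ℝ), F.density s * f (ENNReal.ofReal s)) +
        ∑' t, F.atom t * f t := by
  rw [integral_eq_lintegral_of_nonneg_ae (Eventually.of_forall h0) hf.aestronglyMeasurable,
    F.lintegral_law_ofReal hf h0 hC, ENNReal.toReal_ofReal]
  exact add_nonneg
    (setIntegral_nonneg measurableSet_Ici fun s _ => mul_nonneg (F.density_nonneg s) (h0 _))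
    (tsum_nonneg fun t => mul_nonneg (F.atom_nonneg t) (h0 t))

theorem setIntegral_law {f : ℝ≥0∞ → ℝ} (hf : Measurable f) (h0 : ∀ t, 0 ≤ f t) {C : ℝ}
    (hC : ∀ t, f t ≤ C) (t : ℝ≥0∞) :
    ∫ m in Iic t, f m ∂F.law = (∫ s in upTo t, F.density s * f (ENNReal.ofReal s)) +
        ∑' m, (Iic t).indicator (fun m => F.atom m * f m) m := by
  have hC0 : 0 ≤ C := (h0 0).trans (hC 0)
  rw [← integral_indicator measurableSet_Iic, F.integral_law (hf.indicator measurableSet_Iic)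
    (indicator_nonneg fun t _ => h0 t) (C := C) (fun m => ?_)]
  · congr 1
    · rw [upTo_eq, ← setIntegral_indicator (ENNReal.measurable_ofReal measurableSet_Iic)]
      refine setIntegral_congr_fun measurableSet_Ici fun s _ => ?_
      by_cases h : ENNReal.ofReal s ≤ t <;> simp [indicator, h]
    · refine tsum_congr fun m => ?_
      by_cases h : m ≤ t <;> simp [indicator, h]
  · by_cases h : m ≤ t <;> simp [indicator, h, hC, hC0]

theorem real_law_Iic (t : ℝ≥0∞) : F.law.real (Iic t) = F.cdf t := by
  have := F.setIntegral_law (f := fun _ => 1) measurable_const (fun _ => zero_le_one)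
    (C := 1) (fun _ => le_rfl) t
  simpa [cdf] using this

theorem cdf_nonneg (t : ℝ≥0∞) : 0 ≤ F.cdf t := F.real_law_Iic t ▸ measureReal_nonneg

theorem cdf_le_one (t : ℝ≥0∞) : F.cdf t ≤ 1 := F.real_law_Iic t ▸ measureReal_le_one

theorem cdf_top : F.cdf ∞ = 1 := by rw [← real_law_Iic]; simp

theorem cdf_mono : Monotone F.cdf := fun s t h => by
  rw [← real_law_Iic, ← real_law_Iic]
  exact measureReal_mono (Iic_subset_Iic.2 h)

/-- Links the pointwise notion `Charges`, in which the equilibrium conditions are phrased, to the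
law: both the atoms and the density vanish on such a set. -/
theorem law_eq_zero {B : Set ℝ≥0∞} (hB : MeasurableSet B) (h : ∀ t ∈ B, ¬ F.Charges t) :
    F.law B = 0 := by
  have hat : ∀ t ∈ B, F.atom t = 0 := fun t ht =>
    le_antisymm (not_lt.1 fun h' => h t ht (Or.inl h')) (F.atom_nonneg t)
  have hde : ∀ s, 0 ≤ s → ENNReal.ofReal s ∈ B → F.density s = 0 := fun s hs ht =>
    le_antisymm (not_lt.1 fun h' => h _ ht
      (Or.inr ⟨ENNReal.ofReal_ne_top, by rwa [ENNReal.toReal_ofReal hs]⟩)) (F.density_nonneg s)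
  rw [← lintegral_indicator_one hB, F.lintegral_law (measurable_one.indicator hB)]
  have h1 : ∀ t, ENNReal.ofReal (F.atom t) * B.indicator 1 t = 0 := fun t => by
    by_cases ht : t ∈ B <;> simp [ht, hat]
  simp only [h1, tsum_zero, add_zero]
  rw [setLIntegral_congr_fun (g := fun _ => 0) measurableSet_Ici fun s hs => ?_]
  · simp
  · by_cases ht : ENNReal.ofReal s ∈ B
    · simp [hde s hs ht]
    · simp [ht]

/-- The source of optimal times: any increase of the distribution function yields a charged time, to
which an equilibrium condition applies. -/
theorem exists_charges_of_cdf_lt {s t : ℝ≥0∞} (h : F.cdf s < F.cdf t) :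
    ∃ u, s < u ∧ u ≤ t ∧ F.Charges u := by
  by_contra! hc
  have h0 : F.law (Ioc s t) = 0 :=
    F.law_eq_zero measurableSet_Ioc fun u hu => hc u hu.1 hu.2
  have hst : s ≤ t := le_of_not_ge fun h' => (F.cdf_mono h').not_gt h
  rw [← real_law_Iic, ← real_law_Iic, ← Iic_union_Ioc_eq_Iic hst] at h
  have := measureReal_union_le (μ := F.law) (Iic s) (Ioc s t)
  rw [measureReal_def _ (Ioc s t), h0] at this
  simp only [ENNReal.toReal_zero, add_zero] at this
  exact this.not_gt h

theorem exists_charges_of_cdf_pos {t : ℝ≥0∞} (h : 0 < F.cdf t) : ∃ u, u ≤ t ∧ F.Charges u := by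
  by_contra! hc
  have h0 : F.law (Iic t) = 0 := F.law_eq_zero measurableSet_Iic hc
  rw [← real_law_Iic, measureReal_def, h0] at h
  simp at h

theorem exists_charges : ∃ u, F.Charges u := by
  obtain ⟨u, -, hu⟩ := F.exists_charges_of_cdf_pos (t := ∞) (by rw [cdf_top]; exact one_pos)
  exact ⟨u, hu⟩

theorem expect_eq {u : ℝ≥0∞ → ℝ} {M : ℝ} (h : ∀ t, F.Charges t → u t = M) : F.expect u = M := by
  have h1 : ∀ t, F.atom t * u t = F.atom t * M := fun t => by
    rcases (F.atom_nonneg t).eq_or_lt with h' | h'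
    · rw [← h']; simp
    · rw [h t (Or.inl h')]
  have h2 : ∫ s in Ici (0 : ℝ), F.density s * u (ENNReal.ofReal s) =
      ∫ s in Ici (0 : ℝ), F.density s * M := by
    refine setIntegral_congr_fun measurableSet_Ici fun s hs => ?_
    rcases (F.density_nonneg s).eq_or_lt with h' | h'
    · simp [← h']
    · rw [h _ (Or.inr ⟨ENNReal.ofReal_ne_top, by rwa [ENNReal.toReal_ofReal hs]⟩)]
  rw [expect, h2, tsum_congr h1, integral_mul_const, tsum_mul_right, ← add_mul, F.total, one_mul]

theorem cdf_eq_integral (t : ℝ≥0∞) : F.cdf t = ∫ m, (Iic t).indicator (fun _ => (1 : ℝ)) m ∂F.law := by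
  rw [integral_indicator measurableSet_Iic]
  simp [real_law_Iic]

/-- Dominated convergence for the indicators of `Iic`, which are eventually constant along the
filter for almost every `m`. -/
theorem tendsto_cdf {l : Filter ℝ} [l.IsCountablyGenerated] {t : ℝ≥0∞}
    (h : ∀ᵐ m ∂F.law, ∀ᶠ s in l, m ≤ ENNReal.ofReal s ↔ m ≤ t) :
    Tendsto (fun s => F.cdf (ENNReal.ofReal s)) l (𝓝 (F.cdf t)) := by
  simp only [cdf_eq_integral]
  refine tendsto_integral_filter_of_dominated_convergence (fun _ => 1)
    (Eventually.of_forall fun s =>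
      (measurable_const.indicator measurableSet_Iic).aestronglyMeasurable)
    (Eventually.of_forall fun s => Eventually.of_forall fun m => ?_) (integrable_const _) ?_
  · by_cases hm : m ≤ ENNReal.ofReal s <;> simp [indicator, hm]
  · filter_upwards [h] with m hm
    refine tendsto_const_nhds.congr' ?_
    filter_upwards [hm] with s hs
    simp only [indicator, mem_Iic, hs]

theorem tendsto_cdf_right (t : ℝ) :
    Tendsto (fun s => F.cdf (ENNReal.ofReal s)) (𝓝[≥] t) (𝓝 (F.cdf (ENNReal.ofReal t))) := by
  refine F.tendsto_cdf (Eventually.of_forall fun m => ?_)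
  rcases le_or_gt m (ENNReal.ofReal t) with hm | hm
  · filter_upwards [self_mem_nhdsWithin] with s hs
    exact ⟨fun _ => hm, fun _ => hm.trans (ENNReal.ofReal_le_ofReal hs)⟩
  · have : ∀ᶠ s in 𝓝 t, ENNReal.ofReal s < m :=
      ENNReal.continuous_ofReal.continuousAt.eventually_lt continuousAt_const hm
    filter_upwards [nhdsWithin_le_nhds this] with s hs
    exact ⟨fun h => absurd h hs.not_ge, fun h => absurd h hm.not_ge⟩

theorem tendsto_cdf_left {t : ℝ} (h : ¬ F.Charges (ENNReal.ofReal t)) :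
    Tendsto (fun s => F.cdf (ENNReal.ofReal s)) (𝓝[<] t) (𝓝 (F.cdf (ENNReal.ofReal t))) := by
  have h0 : ∀ᵐ m ∂F.law, m ≠ ENNReal.ofReal t := by
    refine compl_mem_ae_iff.2 (F.law_eq_zero (measurableSet_singleton _) fun u hu => ?_)
    rwa [mem_singleton_iff.1 hu]
  refine F.tendsto_cdf ?_
  filter_upwards [h0] with m hm0
  rcases lt_or_gt_of_ne hm0 with hm | hm
  · have : ∀ᶠ s in 𝓝 t, m < ENNReal.ofReal s :=
      continuousAt_const.eventually_lt ENNReal.continuous_ofReal.continuousAt hm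
    filter_upwards [nhdsWithin_le_nhds this] with s hs
    exact ⟨fun _ => hm.le, fun _ => hs.le⟩
  · filter_upwards [self_mem_nhdsWithin] with s hs
    exact ⟨fun h => absurd (h.trans (ENNReal.ofReal_le_ofReal (le_of_lt hs))) hm.not_ge,
      fun h => absurd h hm.not_ge⟩

theorem measurable_cdf : Measurable F.cdf := F.cdf_mono.measurable

/-- Integration by parts for a decreasing function with density `-d`, vanishing at `∞`. -/
theorem setIntegral_law_tail {d : ℝ → ℝ} (hd : IntegrableOn d (Ici 0)) {D : ℝ≥0∞ → ℝ}
    (hD : ∀ t, D t = (∫ s in Ici (0 : ℝ), d s) - ∫ s in upTo t, d s) (t : ℝ≥0∞) :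
    ∫ m in Iic t, D m ∂F.law =
      (∫ s in upTo t, d s * F.cdf (ENNReal.ofReal s)) + D t * F.cdf t := by
  -- `D m` is the integral of `d` over times from `m` on. Fubini then gives the integral over `s` of
  -- `d s` times the distribution function at `min t s`, which is split at `s = t`.
  have hDm : ∀ m, D m = ∫ s in Ici (0 : ℝ), (if m ≤ ENNReal.ofReal s then d s else 0) := by
    intro m
    have hsub : (∫ s in Ici (0 : ℝ), d s) - ∫ s in upTo m, d s = ∫ s in Ici 0 \ upTo m, d s := by
      rw [setIntegral_sdiff (measurableSet_upTo m) hd (upTo_subset m)]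
    rw [hD, hsub, ← integral_indicator (measurableSet_Ici.diff (measurableSet_upTo m)),
      ← integral_indicator measurableSet_Ici]
    refine integral_congr_ae ?_
    -- The null point `s = m` is discarded, so that `m ≤ s` becomes the negation of `s ≤ m`.
    filter_upwards [compl_mem_ae_iff.2 (measure_singleton (m.toReal))] with s hs
    by_cases hs0 : 0 ≤ s
    · have : m ≤ ENNReal.ofReal s ↔ ¬ ENNReal.ofReal s ≤ m := by
        refine ⟨fun h h' => hs ?_, fun h => (not_le.1 h).le⟩
        rw [mem_singleton_iff, le_antisymm h h', ENNReal.toReal_ofReal hs0]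
      by_cases hm : m ≤ ENNReal.ofReal s
      · simp [indicator, hs0, hm, upTo, this.1 hm]
      · simp [indicator, hs0, hm, upTo, not_not.1 (mt this.2 hm)]
    · simp [indicator, hs0]
  have hswap := integral_integral_swap (μ := F.law.restrict (Iic t)) (ν := volume.restrict (Ici 0))
    (f := fun (m : ℝ≥0∞) (s : ℝ) => if m ≤ ENNReal.ofReal s then d s else 0) (by
      have h2 : Integrable (fun z : ℝ≥0∞ × ℝ => d z.2)
          ((F.law.restrict (Iic t)).prod (volume.restrict (Ici 0))) := hd.comp_snd _
      have hms : MeasurableSet {z : ℝ≥0∞ × ℝ | z.1 ≤ ENNReal.ofReal z.2} :=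
        measurableSet_le measurable_fst (ENNReal.measurable_ofReal.comp measurable_snd)
      refine (h2.indicator hms).congr (Eventually.of_forall fun z => ?_)
      simp [indicator, Function.uncurry])
  have hin : ∀ s : ℝ, ∫ m in Iic t, (if m ≤ ENNReal.ofReal s then d s else 0) ∂F.law =
      d s * F.cdf (min t (ENNReal.ofReal s)) := by
    intro s
    have : (fun m => if m ≤ ENNReal.ofReal s then d s else 0) =
        (Iic (ENNReal.ofReal s)).indicator fun _ => d s := by
      ext m; simp [indicator]
    rw [this, setIntegral_indicator measurableSet_Iic, Iic_inter_Iic, setIntegral_const,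
      real_law_Iic, smul_eq_mul, mul_comm]
  have hdc : IntegrableOn (fun s => d s * F.cdf (min t (ENNReal.ofReal s))) (Ici 0) := by
    refine Integrable.mul_bdd (c := 1) hd
      (F.cdf_mono.measurable.comp
        (measurable_const.min ENNReal.measurable_ofReal)).aestronglyMeasurable
      (Eventually.of_forall fun s => ?_)
    simpa [abs_of_nonneg (F.cdf_nonneg _)] using F.cdf_le_one _
  simp only [hDm]
  rw [hswap]
  simp only [hin]
  have h1 := setIntegral_sdiff (measurableSet_upTo t) hdc (upTo_subset t)
  have h2 : ∫ s in upTo t, d s * F.cdf (min t (ENNReal.ofReal s)) =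
      ∫ s in upTo t, d s * F.cdf (ENNReal.ofReal s) :=
    setIntegral_congr_fun (measurableSet_upTo t) fun s hs => by
      simp only [min_eq_right hs.2]
  have h3 : ∫ s in Ici 0 \ upTo t, d s * F.cdf (min t (ENNReal.ofReal s)) =
      ∫ s in Ici 0 \ upTo t, d s * F.cdf t :=
    setIntegral_congr_fun (measurableSet_Ici.diff (measurableSet_upTo t)) fun s hs => by
      have : ¬ ENNReal.ofReal s ≤ t := fun h => hs.2 ⟨hs.1, h⟩
      simp only [min_eq_left (le_of_not_ge this)]
  rw [integral_mul_const, setIntegral_sdiff (measurableSet_upTo t) hd (upTo_subset t),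
    ← hD] at h3
  rw [← hDm t]
  linarith

end MixedTime

/-! ### Discounted survival and the first-best search problem -/

namespace Environment

variable (E : Environment)

theorem μ_pos : 0 < E.μ := E.β_pos.trans E.β_lt_μ
theorem θ_pos : 0 < E.θ := E.μ_pos.trans E.μ_lt_θ
theorem μ_lt_one : E.μ < 1 := E.μ_lt_θ.trans E.θ_lt_one

/-- The density of real news, extended continuously to negative times. -/
def gExt (t : ℝ) : ℝ := E.g (max t 0)

/-- The survival function of real news, extended to negative times. -/
def surv (t : ℝ) : ℝ := 1 - ∫ s in (0 : ℝ)..t, E.gExt s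

/-- The hazard rate, extended continuously to negative times. -/
def haz (t : ℝ) : ℝ := E.gExt t / E.surv t

/-- The discounted survival function. -/
def dsurv (t : ℝ) : ℝ := Real.exp (-E.ρ * t) * E.surv t

/-- The discounted survival function on `[0, ∞]`. -/
def dsurvTop (t : ℝ≥0∞) : ℝ := E.disc t * (1 - E.G t.toReal)

theorem continuous_gExt : Continuous E.gExt :=
  E.g_cont.comp_continuous (continuous_id.max continuous_const) fun x => mem_Ici.2 (le_max_right x 0)

theorem gExt_pos (t : ℝ) : 0 < E.gExt t := E.g_pos _ (le_max_right _ _)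

theorem gExt_eq {t : ℝ} (ht : 0 ≤ t) : E.gExt t = E.g t := by rw [gExt, max_eq_left ht]

theorem surv_eq {t : ℝ} (ht : 0 ≤ t) : E.surv t = 1 - E.G t := by
  rw [surv, G]
  congr 1
  refine intervalIntegral.integral_congr fun s hs => ?_
  rw [uIcc_of_le ht] at hs
  exact E.gExt_eq hs.1

theorem surv_pos (t : ℝ) : 0 < E.surv t := by
  rcases le_total 0 t with ht | ht
  · rw [E.surv_eq ht]; exact sub_pos.2 (E.cdf_lt_one t ht)
  · rw [surv, intervalIntegral.integral_symm, sub_neg_eq_add]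
    have : 0 ≤ ∫ s in t..0, E.gExt s :=
      intervalIntegral.integral_nonneg ht fun s _ => (E.gExt_pos s).le
    linarith

theorem surv_zero : E.surv 0 = 1 := by simp [surv]

theorem hasDerivAt_surv (t : ℝ) : HasDerivAt E.surv (-E.gExt t) t :=
  (E.continuous_gExt.integral_hasStrictDerivAt 0 t).hasDerivAt.const_sub 1

theorem continuous_surv : Continuous E.surv :=
  continuous_iff_continuousAt.2 fun t => (E.hasDerivAt_surv t).continuousAt

theorem continuous_haz : Continuous E.haz :=
  E.continuous_gExt.div E.continuous_surv fun t => (E.surv_pos t).ne'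

theorem haz_pos (t : ℝ) : 0 < E.haz t := div_pos (E.gExt_pos t) (E.surv_pos t)

theorem haz_eq {t : ℝ} (ht : 0 ≤ t) : E.haz t = E.hazard t := by
  rw [haz, hazard, E.gExt_eq ht, E.surv_eq ht]

theorem haz_lt_haz {s t : ℝ} (hs : 0 ≤ s) (hst : s < t) : E.haz t < E.haz s := by
  rw [E.haz_eq hs, E.haz_eq (hs.trans hst.le)]
  exact E.hazard_strictAnti hs (hs.trans hst.le : (0 : ℝ) ≤ t) hst

theorem haz_le_haz {s t : ℝ} (hs : 0 ≤ s) (hst : s ≤ t) : E.haz t ≤ E.haz s := by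
  rcases hst.eq_or_lt with rfl | h
  · exact le_rfl
  · exact (E.haz_lt_haz hs h).le

theorem haz_mul_surv (t : ℝ) : E.haz t * E.surv t = E.gExt t :=
  div_mul_cancel₀ _ (E.surv_pos t).ne'

theorem dsurv_pos (t : ℝ) : 0 < E.dsurv t := mul_pos (Real.exp_pos _) (E.surv_pos t)

theorem dsurv_zero : E.dsurv 0 = 1 := by simp [dsurv, surv_zero]

theorem hasDerivAt_dsurv (t : ℝ) :
    HasDerivAt E.dsurv (-(E.dsurv t * (E.ρ + E.haz t))) t := by
  have h1 : HasDerivAt (fun t => Real.exp (-E.ρ * t)) (Real.exp (-E.ρ * t) * (-E.ρ * 1)) t :=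
    ((hasDerivAt_id t).const_mul (-E.ρ)).exp
  convert! h1.mul (E.hasDerivAt_surv t) using 1
  rw [← E.haz_mul_surv, dsurv]
  ring

theorem continuous_dsurv : Continuous E.dsurv :=
  continuous_iff_continuousAt.2 fun t => (E.hasDerivAt_dsurv t).continuousAt

theorem dsurv_le_one {t : ℝ} (ht : 0 ≤ t) : E.dsurv t ≤ 1 := by
  have h1 : Real.exp (-E.ρ * t) ≤ 1 := Real.exp_le_one_iff.2 (by nlinarith [E.ρ_pos])
  have h2 : E.surv t ≤ 1 := by
    rw [surv]
    have : 0 ≤ ∫ s in (0 : ℝ)..t, E.gExt s :=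
      intervalIntegral.integral_nonneg ht fun s _ => (E.gExt_pos s).le
    linarith
  exact mul_le_one₀ h1 (E.surv_pos t).le h2

theorem tendsto_dsurv : Tendsto E.dsurv atTop (𝓝 0) := by
  have h1 : Tendsto (fun t => Real.exp (-E.ρ * t)) atTop (𝓝 0) :=
    Real.tendsto_exp_atBot.comp (tendsto_id.const_mul_atTop_of_neg (neg_lt_zero.2 E.ρ_pos))
  refine squeeze_zero' (Eventually.of_forall fun t => (E.dsurv_pos t).le) ?_ h1
  filter_upwards [eventually_ge_atTop 0] with t ht
  have h2 : E.surv t ≤ 1 := by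
    rw [surv]
    have : 0 ≤ ∫ s in (0 : ℝ)..t, E.gExt s :=
      intervalIntegral.integral_nonneg ht fun s _ => (E.gExt_pos s).le
    linarith
  exact mul_le_of_le_one_right (Real.exp_pos _).le h2

/-- This is minus the derivative of a decreasing function with a finite limit at infinity, hence
integrable. -/
theorem integrableOn_deriv_dsurv :
    IntegrableOn (fun t => E.dsurv t * (E.ρ + E.haz t)) (Ici 0) := by
  rw [integrableOn_Ici_iff_integrableOn_Ioi]
  have := integrableOn_Ioi_deriv_of_nonpos (a := 0) (g := E.dsurv)
    (g' := fun t => -(E.dsurv t * (E.ρ + E.haz t))) E.continuous_dsurv.continuousWithinAt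
    (fun t _ => E.hasDerivAt_dsurv t) (fun t _ => neg_nonpos.2 (mul_nonneg (E.dsurv_pos t).le
      (add_pos E.ρ_pos (E.haz_pos t)).le)) E.tendsto_dsurv
  simpa using this.neg

theorem integral_deriv_dsurv : ∫ t in Ici (0 : ℝ), E.dsurv t * (E.ρ + E.haz t) = 1 := by
  rw [integral_Ici_eq_integral_Ioi]
  have := integral_Ioi_of_hasDerivAt_of_nonpos (a := 0) (g := E.dsurv)
    (g' := fun t => -(E.dsurv t * (E.ρ + E.haz t))) E.continuous_dsurv.continuousWithinAt
    (fun t _ => E.hasDerivAt_dsurv t) (fun t _ => neg_nonpos.2 (mul_nonneg (E.dsurv_pos t).le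
      (add_pos E.ρ_pos (E.haz_pos t)).le)) E.tendsto_dsurv
  rw [integral_neg, dsurv_zero] at this
  linarith

theorem dsurvTop_top : E.dsurvTop ∞ = 0 := by simp [dsurvTop, disc]

theorem dsurvTop_eq {t : ℝ≥0∞} (ht : t ≠ ∞) : E.dsurvTop t = E.dsurv t.toReal := by
  rw [dsurvTop, disc, if_neg ht, dsurv, E.surv_eq ENNReal.toReal_nonneg]

theorem dsurvTop_ofReal {t : ℝ} (ht : 0 ≤ t) : E.dsurvTop (ENNReal.ofReal t) = E.dsurv t := by
  rw [E.dsurvTop_eq ENNReal.ofReal_ne_top, ENNReal.toReal_ofReal ht]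

theorem dsurvTop_nonneg (t : ℝ≥0∞) : 0 ≤ E.dsurvTop t := by
  by_cases ht : t = ∞
  · rw [ht, dsurvTop_top]
  · rw [E.dsurvTop_eq ht]; exact (E.dsurv_pos _).le

theorem dsurvTop_le_one (t : ℝ≥0∞) : E.dsurvTop t ≤ 1 := by
  by_cases ht : t = ∞
  · rw [ht, dsurvTop_top]; exact zero_le_one
  · rw [E.dsurvTop_eq ht]; exact E.dsurv_le_one ENNReal.toReal_nonneg

theorem measurable_dsurvTop : Measurable E.dsurvTop := by
  classical
  have : E.dsurvTop = fun t => if t = ∞ then 0 else E.dsurv t.toReal := by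
    ext t
    by_cases ht : t = ∞
    · simp [ht, dsurvTop_top]
    · simp [ht, dsurvTop_eq]
  rw [this]
  exact Measurable.ite (measurableSet_singleton _) measurable_const
    (E.continuous_dsurv.measurable.comp ENNReal.measurable_toReal)

theorem integral_deriv_dsurv_interval (s t : ℝ) :
    ∫ x in s..t, E.dsurv x * (E.ρ + E.haz x) = E.dsurv s - E.dsurv t := by
  have := intervalIntegral.integral_eq_sub_of_hasDerivAt (a := s) (b := t)
    (fun x _ => E.hasDerivAt_dsurv x)
    ((E.continuous_dsurv.mul (continuous_const.add E.continuous_haz)).neg.intervalIntegrable _ _)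
  rw [intervalIntegral.integral_neg] at this
  linarith

theorem dsurvTop_eq_one_sub (t : ℝ≥0∞) :
    E.dsurvTop t = 1 - ∫ x in upTo t, E.dsurv x * (E.ρ + E.haz x) := by
  by_cases ht : t = ∞
  · rw [ht, dsurvTop_top, upTo_top, integral_deriv_dsurv, sub_self]
  · rw [E.dsurvTop_eq ht]
    conv_rhs => rw [← ENNReal.ofReal_toReal ht]
    rw [integral_upTo_ofReal _ ENNReal.toReal_nonneg, integral_deriv_dsurv_interval, dsurv_zero]
    ring

theorem exp_mul_g {s : ℝ} (hs : 0 ≤ s) :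
    Real.exp (-E.ρ * s) * E.g s = E.dsurv s * E.haz s := by
  rw [← E.gExt_eq hs, ← haz_mul_surv, dsurv]; ring

theorem exp_mul_surv {s : ℝ} (hs : 0 ≤ s) :
    Real.exp (-E.ρ * s) * (1 - E.G s) = E.dsurv s := by
  rw [← E.surv_eq hs, dsurv]

theorem integrableOn_dsurv : IntegrableOn E.dsurv (Ici 0) := by
  have h := E.integrableOn_deriv_dsurv.const_mul E.ρ⁻¹
  refine Integrable.mono' h E.continuous_dsurv.aestronglyMeasurable (Eventually.of_forall fun s => ?_)
  rw [Real.norm_of_nonneg (E.dsurv_pos s).le]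
  have := mul_nonneg (mul_nonneg (inv_nonneg.2 E.ρ_pos.le) (E.dsurv_pos s).le) (E.haz_pos s).le
  have h2 : E.ρ⁻¹ * E.ρ = 1 := inv_mul_cancel₀ E.ρ_pos.ne'
  calc E.dsurv s = (E.ρ⁻¹ * E.ρ) * E.dsurv s := by rw [h2, one_mul]
    _ ≤ _ := by nlinarith

theorem integrableOn_dsurv_haz : IntegrableOn (fun s => E.dsurv s * E.haz s) (Ici 0) := by
  refine Integrable.mono' E.integrableOn_deriv_dsurv
    (E.continuous_dsurv.mul E.continuous_haz).aestronglyMeasurable (Eventually.of_forall fun s => ?_)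
  rw [Real.norm_of_nonneg (mul_pos (E.dsurv_pos s) (E.haz_pos s)).le]
  have := mul_pos (E.dsurv_pos s) E.ρ_pos
  linarith

theorem integrableOn_dsurv_density (F : MixedTime) :
    IntegrableOn (fun s => E.dsurv s * F.density s) (Ici 0) := by
  refine Integrable.bdd_mul (c := 1) F.density_integrable
    E.continuous_dsurv.aestronglyMeasurable ?_
  filter_upwards [ae_restrict_mem measurableSet_Ici] with s hs
  rw [Real.norm_of_nonneg (E.dsurv_pos s).le]
  exact E.dsurv_le_one hs

/-- The marginal value of first-best search to the principal. -/
def marginal (s : ℝ) : ℝ := E.dsurv s * (E.μ * (1 - E.θ) * E.haz s - E.ρ * E.θ)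

theorem continuous_marginal : Continuous E.marginal :=
  E.continuous_dsurv.mul ((continuous_const.mul E.continuous_haz).sub continuous_const)

theorem integrableOn_marginal : IntegrableOn E.marginal (Ici 0) := by
  refine ((E.integrableOn_dsurv_haz.const_mul (E.μ * (1 - E.θ))).sub
    (E.integrableOn_dsurv.const_mul (E.ρ * E.θ))).congr (Eventually.of_forall fun s => ?_)
  simp only [marginal, Pi.sub_apply]; ring

/-- The terminal term equals θ minus θ times the integral of D(ρ + H). Against news worth (μ + (1 -
μ)θ)H this leaves the integrand D(μ(1 - θ)H - ρθ). -/
theorem uFBP_eq (t : ℝ≥0∞) : E.uFBP t = E.θ + ∫ s in upTo t, E.marginal s := by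
  have h := E.dsurvTop_eq_one_sub t
  rw [dsurvTop] at h
  have h2 : ∫ s in upTo t, Real.exp (-E.ρ * s) * E.g s * (E.μ + (1 - E.μ) * E.θ) =
      (∫ s in upTo t, E.marginal s) + E.θ * ∫ s in upTo t, E.dsurv s * (E.ρ + E.haz s) := by
    rw [← integral_const_mul, ← integral_add (E.integrableOn_marginal.mono_set (upTo_subset t))
      ((E.integrableOn_deriv_dsurv.mono_set (upTo_subset t)).const_mul _)]
    refine setIntegral_congr_fun (measurableSet_upTo t) fun s hs => ?_
    simp only [marginal, E.exp_mul_g hs.1]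
    ring
  rw [uFBP, search, h, h2]
  ring

end Environment

/-! ### Payoffs in the game as integrals of marginal values -/

theorem integral_linear_combination {ν : Measure ℝ} {f₀ f₁ f₂ f₃ : ℝ → ℝ} (h₀ : Integrable f₀ ν)
    (h₁ : Integrable f₁ ν) (h₂ : Integrable f₂ ν) (h₃ : Integrable f₃ ν) (a b c : ℝ) :
    ∫ x, f₀ x + (a * f₁ x + (b * f₂ x - c * f₃ x)) ∂ν =
      (∫ x, f₀ x ∂ν) + (a * (∫ x, f₁ x ∂ν) + (b * (∫ x, f₂ x ∂ν) - c * ∫ x, f₃ x ∂ν)) := by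
  rw [← integral_const_mul, ← integral_const_mul, ← integral_const_mul,
    ← integral_sub (h₂.const_mul b) (h₃.const_mul c), ← integral_add (h₁.const_mul a),
    ← integral_add h₀]
  · exact (h₁.const_mul a).add ((h₂.const_mul b).sub (h₃.const_mul c))
  · exact (h₂.const_mul b).sub (h₃.const_mul c)

namespace MixedTime

variable (F : MixedTime)

/-- The support is countable, so every preimage is countable or has countable complement. -/
theorem measurable_atom : Measurable F.atom := by
  have hc : (Function.support F.atom).Countable := F.atom_summable.countable_support
  intro B hB
  by_cases h0 : (0 : ℝ) ∈ B
  · have hsub : (F.atom ⁻¹' B)ᶜ ⊆ Function.support F.atom := fun t ht h => by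
      apply ht
      rw [mem_preimage, h]
      exact h0
    rw [← compl_compl (F.atom ⁻¹' B)]
    exact (hc.mono hsub).measurableSet.compl
  · have hsub : F.atom ⁻¹' B ⊆ Function.support F.atom := fun t ht h => h0 (by
      rw [mem_preimage, h] at ht
      exact ht)
    exact (hc.mono hsub).measurableSet

end MixedTime

namespace Environment

variable (E : Environment) {σ : ℝ} {p : Profile}

theorem measurable_noFake : Measurable (noFake σ p) :=
  (measurable_const.mul (p.faking.measurable_cdf.comp ENNReal.measurable_ofReal)).const_sub 1

theorem measurable_noStop : Measurable (noStop p) :=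
  (p.stopping.measurable_cdf.comp ENNReal.measurable_ofReal).const_sub 1

theorem noFake_le_one (hσ : 0 ≤ σ) (s : ℝ) : noFake σ p s ≤ 1 := by
  have := mul_nonneg hσ (p.faking.cdf_nonneg (ENNReal.ofReal s))
  rw [noFake]; linarith

theorem noFake_pos (hσ : 0 ≤ σ) (hσ1 : σ < 1) (s : ℝ) : 0 < noFake σ p s := by
  have := mul_le_of_le_one_right hσ (p.faking.cdf_le_one (ENNReal.ofReal s))
  rw [noFake]; linarith

theorem noStop_le_one (s : ℝ) : noStop p s ≤ 1 := by
  have := p.stopping.cdf_nonneg (ENNReal.ofReal s)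
  rw [noStop]; linarith

theorem noStop_nonneg (s : ℝ) : 0 ≤ noStop p s := by
  have := p.stopping.cdf_le_one (ENNReal.ofReal s)
  rw [noStop]; linarith

theorem noStop_antitone : Antitone (noStop p) := fun s t h => by
  have := p.stopping.cdf_mono (ENNReal.ofReal_le_ofReal h)
  rw [noStop, noStop]; linarith

theorem w1_pos (hσ : 0 ≤ σ) (hσ1 : σ < 1) {s : ℝ} (hs : 0 ≤ s) : 0 < E.w1 σ p s := by
  have h1 := mul_pos (mul_pos E.μ_pos (E.g_pos s hs)) (noFake_pos (p := p) hσ hσ1 s)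
  have h2 := mul_nonneg (mul_nonneg hσ (p.faking.density_nonneg s))
    (E.surv_eq hs ▸ (E.surv_pos s).le)
  exact add_pos_of_pos_of_nonneg h1 h2

theorem exp_mul_w1 {s : ℝ} (hs : 0 ≤ s) : Real.exp (-E.ρ * s) * E.w1 σ p s =
    E.dsurv s * (E.μ * E.haz s * noFake σ p s + σ * p.faking.density s) := by
  rw [w1, mul_add, mul_add, show Real.exp (-E.ρ * s) * (E.μ * E.g s * noFake σ p s) =
    Real.exp (-E.ρ * s) * E.g s * (E.μ * noFake σ p s) by ring, E.exp_mul_g hs,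
    show Real.exp (-E.ρ * s) * (σ * p.faking.density s * (1 - E.G s)) =
    Real.exp (-E.ρ * s) * (1 - E.G s) * (σ * p.faking.density s) by ring, E.exp_mul_surv hs]
  ring

theorem belief_of_atom {s : ℝ} (h : 0 < p.faking.atom (ENNReal.ofReal s)) :
    E.belief σ p s = E.μ := by
  rw [belief, if_pos h]

theorem belief_mul_w1 (hσ : 0 ≤ σ) (hσ1 : σ < 1) {s : ℝ} (hs : 0 ≤ s)
    (h : ¬ 0 < p.faking.atom (ENNReal.ofReal s)) :
    E.belief σ p s * E.w1 σ p s =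
      E.μ * E.g s * noFake σ p s + E.μ * σ * p.faking.density s * (1 - E.G s) := by
  rw [belief, if_neg h, div_mul_cancel₀ _ (E.w1_pos hσ hσ1 hs).ne']

theorem belief_of_not_charges (hσ : 0 ≤ σ) (hσ1 : σ < 1) {s : ℝ} (hs : 0 ≤ s)
    (h : ¬ p.faking.Charges (ENNReal.ofReal s)) : E.belief σ p s = 1 := by
  have h1 : ¬ 0 < p.faking.atom (ENNReal.ofReal s) := fun h' => h (Or.inl h')
  have h2 : p.faking.density s = 0 := le_antisymm (not_lt.1 fun h' => h
    (Or.inr ⟨ENNReal.ofReal_ne_top, by rwa [ENNReal.toReal_ofReal hs]⟩)) (p.faking.density_nonneg s)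
  have h3 := E.belief_mul_w1 (p := p) hσ hσ1 hs h1
  have h4 := E.w1_pos (p := p) hσ hσ1 hs
  refine mul_right_cancel₀ h4.ne' ?_
  rw [h3, w1, h2]; ring

theorem belief_le_one (hσ : 0 ≤ σ) (hσ1 : σ < 1) {s : ℝ} (hs : 0 ≤ s) : E.belief σ p s ≤ 1 := by
  by_cases h : 0 < p.faking.atom (ENNReal.ofReal s)
  · rw [E.belief_of_atom h]; exact E.μ_lt_one.le
  · have h3 := E.belief_mul_w1 (p := p) hσ hσ1 hs h
    refine le_of_mul_le_mul_right ?_ (E.w1_pos (p := p) hσ hσ1 hs)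
    have h2 := mul_nonneg (mul_nonneg hσ (p.faking.density_nonneg s))
      (E.surv_eq hs ▸ (E.surv_pos s).le)
    rw [h3, w1]
    nlinarith [E.μ_lt_one]

/-- The response to type-1 news is optimal given the belief. -/
def OptimalResponse (σ : ℝ) (p : Profile) : Prop :=
  ∀ t, 0 ≤ t → (E.θ < E.belief σ p t → p.response t = 1) ∧
    (E.belief σ p t < E.θ → p.response t = 0)

variable {E}

theorem OptimalResponse.newsValue_eq (h : E.OptimalResponse σ p) {t : ℝ} (ht : 0 ≤ t) :
    E.newsValue σ p t = max E.θ (E.belief σ p t) := by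
  rw [newsValue]
  rcases lt_trichotomy (E.belief σ p t) E.θ with h' | h' | h'
  · rw [(h t ht).2 h', max_eq_left h'.le]; ring
  · rw [h', max_self]; ring
  · rw [(h t ht).1 h', max_eq_right h'.le]; ring

variable (E)

/-- The marginal value of waiting to the principal. -/
def marginalP (σ : ℝ) (p : Profile) (s : ℝ) : ℝ :=
  E.dsurv s * ((E.μ * E.haz s * noFake σ p s + σ * p.faking.density s) *
    (E.newsValue σ p s - E.θ) - E.ρ * E.θ * noFake σ p s)

/-- The marginal value of waiting to the agent, apart from the value of the fake itself. -/
def marginalA (p : Profile) (s : ℝ) : ℝ :=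
  E.dsurv s * noStop p s * (E.μ * (1 - E.β) * E.haz s * p.response s - E.ρ * E.β)

theorem aestronglyMeasurable_newsValue :
    AEStronglyMeasurable (E.newsValue σ p) (volume.restrict (Ici 0)) := by
  classical
  have hN := measurable_noFake (σ := σ) (p := p)
  have hg := E.continuous_gExt.measurable
  have hS := E.continuous_surv.measurable
  have hf := p.faking.density_meas
  have ha := p.response_meas
  have hb : Measurable fun s => if 0 < p.faking.atom (ENNReal.ofReal s) then E.μ else
      (E.μ * E.gExt s * noFake σ p s + E.μ * σ * p.faking.density s * E.surv s) /
      (E.μ * E.gExt s * noFake σ p s + σ * p.faking.density s * E.surv s) := by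
    refine Measurable.ite (measurableSet_lt measurable_const
      (p.faking.measurable_atom.comp ENNReal.measurable_ofReal)) measurable_const ?_
    fun_prop
  have hv : Measurable fun s => (1 - p.response s) * E.θ + p.response s *
      (if 0 < p.faking.atom (ENNReal.ofReal s) then E.μ else
      (E.μ * E.gExt s * noFake σ p s + E.μ * σ * p.faking.density s * E.surv s) /
      (E.μ * E.gExt s * noFake σ p s + σ * p.faking.density s * E.surv s)) := by
    fun_prop
  refine hv.aestronglyMeasurable.congr ?_
  filter_upwards [ae_restrict_mem measurableSet_Ici] with s hs
  rw [newsValue, belief, w1, E.gExt_eq hs, E.surv_eq hs]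

variable {E}

theorem OptimalResponse.newsValue_sub_nonneg (h : E.OptimalResponse σ p) {t : ℝ} (ht : 0 ≤ t) :
    0 ≤ E.newsValue σ p t - E.θ := by
  rw [h.newsValue_eq ht]; exact sub_nonneg.2 (le_max_left _ _)

theorem OptimalResponse.newsValue_le_one (h : E.OptimalResponse σ p) (hσ : 0 ≤ σ) (hσ1 : σ < 1)
    {t : ℝ} (ht : 0 ≤ t) : E.newsValue σ p t ≤ 1 := by
  rw [h.newsValue_eq ht]; exact max_le E.θ_lt_one.le (E.belief_le_one hσ hσ1 ht)

variable (E) in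
theorem integrableOn_mul_noFake (hσ : 0 ≤ σ) (hσ1 : σ < 1) {f : ℝ → ℝ}
    (hf : IntegrableOn f (Ici 0)) : IntegrableOn (fun s => f s * noFake σ p s) (Ici 0) := by
  refine Integrable.mul_bdd (c := 1) hf measurable_noFake.aestronglyMeasurable
    (Eventually.of_forall fun s => ?_)
  rw [Real.norm_of_nonneg (noFake_pos hσ hσ1 s).le]
  exact noFake_le_one hσ s

variable (E) in
theorem integrableOn_dsurv_weights (hσ : 0 ≤ σ) (hσ1 : σ < 1) :
    IntegrableOn (fun s => E.dsurv s * (E.μ * E.haz s * noFake σ p s + σ * p.faking.density s))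
      (Ici 0) := by
  refine (((integrableOn_mul_noFake (p := p) hσ hσ1 E.integrableOn_dsurv_haz).const_mul E.μ).add
    ((E.integrableOn_dsurv_density p.faking).const_mul σ)).congr (Eventually.of_forall fun s => ?_)
  simp only [Pi.add_apply]; ring

theorem OptimalResponse.integrableOn_marginalP (h : E.OptimalResponse σ p) (hσ : 0 ≤ σ)
    (hσ1 : σ < 1) : IntegrableOn (E.marginalP σ p) (Ici 0) := by
  have h1 : IntegrableOn (fun s => E.dsurv s * (E.μ * E.haz s * noFake σ p s +
      σ * p.faking.density s) * (E.newsValue σ p s - E.θ)) (Ici 0) := by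
    refine Integrable.mul_bdd (c := 1) (E.integrableOn_dsurv_weights hσ hσ1)
      (E.aestronglyMeasurable_newsValue.sub aestronglyMeasurable_const) ?_
    filter_upwards [ae_restrict_mem measurableSet_Ici] with s hs
    rw [Real.norm_of_nonneg (h.newsValue_sub_nonneg hs)]
    linarith [h.newsValue_le_one hσ hσ1 hs, E.θ_pos]
  refine (h1.sub ((integrableOn_mul_noFake (p := p) hσ hσ1 E.integrableOn_dsurv).const_mul
    (E.ρ * E.θ))).congr (Eventually.of_forall fun s => ?_)
  simp only [Pi.sub_apply, marginalP]; ring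

variable (E) in
-- Equates two evaluations of the integral of D against F over [0, t]: by components, and by parts.
theorem tsum_atom_eq (F : MixedTime) (t : ℝ≥0∞) :
    ∑' m, (Iic t).indicator (fun m => F.atom m * E.dsurvTop m) m =
      (∫ s in upTo t, E.dsurv s * (E.ρ + E.haz s) * F.cdf (ENNReal.ofReal s)) +
      E.dsurvTop t * F.cdf t - ∫ s in upTo t, E.dsurv s * F.density s := by
  have h1 := F.setIntegral_law E.measurable_dsurvTop E.dsurvTop_nonneg E.dsurvTop_le_one t
  have h2 := F.setIntegral_law_tail E.integrableOn_deriv_dsurv (D := E.dsurvTop)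
    (fun t => by rw [E.dsurvTop_eq_one_sub, integral_deriv_dsurv]) t
  have h3 : ∫ s in upTo t, F.density s * E.dsurvTop (ENNReal.ofReal s) =
      ∫ s in upTo t, E.dsurv s * F.density s :=
    setIntegral_congr_fun (measurableSet_upTo t) fun s hs => by
      simp only [E.dsurvTop_ofReal hs.1]; ring
  rw [h3] at h1
  linarith

variable (E) in
theorem integrableOn_deriv_dsurv_cdf (F : MixedTime) :
    IntegrableOn (fun s => E.dsurv s * (E.ρ + E.haz s) * F.cdf (ENNReal.ofReal s)) (Ici 0) := by
  refine Integrable.mul_bdd (c := 1) E.integrableOn_deriv_dsurv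
    (F.measurable_cdf.comp ENNReal.measurable_ofReal).aestronglyMeasurable
    (Eventually.of_forall fun s => ?_)
  rw [Real.norm_of_nonneg (F.cdf_nonneg _)]
  exact F.cdf_le_one _

/-- At an atom of faking the belief is μ < θ, so the news is worth exactly θ. Once the atoms are
integrated by parts, all terms in which θ is obtained sum to θ less the cost of delay. -/
theorem OptimalResponse.uP_eq (h : E.OptimalResponse σ p) (hσ : 0 ≤ σ) (hσ1 : σ < 1) (t : ℝ≥0∞) :
    E.uP σ p t = E.θ + ∫ s in upTo t, E.marginalP σ p s := by
  have hnv : ∀ m, (Iic t).indicator (fun m => E.disc m *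
      (σ * p.faking.atom m * (1 - E.G m.toReal)) * E.newsValue σ p m.toReal) m =
      σ * E.θ * (Iic t).indicator (fun m => p.faking.atom m * E.dsurvTop m) m := by
    intro m
    by_cases hm : m ≤ t
    · simp only [indicator, mem_Iic, hm, if_true, dsurvTop]
      rcases (p.faking.atom_nonneg m).eq_or_lt with h' | h'
      · rw [← h']; ring
      -- At `∞` the discount factor is zero, which makes the default `toReal` value harmless.
      · by_cases htop : m = ∞
        · simp [htop, disc]
        · have : E.belief σ p m.toReal = E.μ :=
            E.belief_of_atom (by rwa [ENNReal.ofReal_toReal htop])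
          rw [h.newsValue_eq ENNReal.toReal_nonneg, this, max_eq_left E.μ_lt_θ.le]
          ring
    · simp [indicator, hm]
  have hsub := upTo_subset t
  have i1 := (h.integrableOn_marginalP hσ hσ1).mono_set hsub
  have i2 := (E.integrableOn_deriv_dsurv_cdf p.faking).mono_set hsub
  have i3 := (E.integrableOn_dsurv_density p.faking).mono_set hsub
  have i4 := E.integrableOn_deriv_dsurv.mono_set hsub
  have hA : ∫ s in upTo t, Real.exp (-E.ρ * s) *
      ((1 - E.μ) * E.g s * noFake σ p s * E.θ + E.w1 σ p s * E.newsValue σ p s) =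
      (∫ s in upTo t, E.marginalP σ p s) + (E.θ * (∫ s in upTo t, E.dsurv s * (E.ρ + E.haz s)) +
      (σ * E.θ * (∫ s in upTo t, E.dsurv s * p.faking.density s) -
      σ * E.θ * ∫ s in upTo t, E.dsurv s * (E.ρ + E.haz s) *
        p.faking.cdf (ENNReal.ofReal s))) := by
    rw [← integral_linear_combination i1 i4 i3 i2]
    refine setIntegral_congr_fun (measurableSet_upTo t) fun s hs => ?_
    have e1 : Real.exp (-E.ρ * s) * ((1 - E.μ) * E.g s * noFake σ p s * E.θ +
        E.w1 σ p s * E.newsValue σ p s) = Real.exp (-E.ρ * s) * E.g s *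
        ((1 - E.μ) * noFake σ p s * E.θ) + Real.exp (-E.ρ * s) * E.w1 σ p s *
        E.newsValue σ p s := by ring
    simp only [e1]
    rw [E.exp_mul_w1 hs.1, E.exp_mul_g hs.1, marginalP, noFake]
    ring
  have hD : E.disc t * ((1 - E.G t.toReal) * (1 - σ * p.faking.cdf t)) * E.θ =
      E.dsurvTop t * (1 - σ * p.faking.cdf t) * E.θ := by rw [dsurvTop]; ring
  rw [uP, tsum_congr hnv, tsum_mul_left, E.tsum_atom_eq, hA, hD]
  linear_combination E.θ * E.dsurvTop_eq_one_sub t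

variable (E)

theorem integrableOn_mul_noStop {f : ℝ → ℝ} (hf : IntegrableOn f (Ici 0)) :
    IntegrableOn (fun s => f s * noStop p s) (Ici 0) := by
  refine Integrable.mul_bdd (c := 1) hf measurable_noStop.aestronglyMeasurable
    (Eventually.of_forall fun s => ?_)
  rw [Real.norm_of_nonneg (noStop_nonneg s)]
  exact noStop_le_one s

theorem integrableOn_marginalA : IntegrableOn (E.marginalA p) (Ici 0) := by
  have h1 : IntegrableOn (fun s => E.dsurv s * E.haz s * noStop p s * p.response s) (Ici 0) := by
    refine Integrable.mul_bdd (c := 1) (integrableOn_mul_noStop E.integrableOn_dsurv_haz)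
      p.response_meas.aestronglyMeasurable (Eventually.of_forall fun s => ?_)
    rw [Real.norm_of_nonneg (p.response_nonneg s)]
    exact p.response_le_one s
  refine ((h1.const_mul (E.μ * (1 - E.β))).sub ((integrableOn_mul_noStop (p := p)
    E.integrableOn_dsurv).const_mul (E.ρ * E.β))).congr (Eventually.of_forall fun s => ?_)
  simp only [Pi.sub_apply, marginalA]; ring

/-- Stopping by the principal always pays β, so its atoms are absorbed by parts as for the
principal. What remains is the gain from real news that is followed and the premium (μ - β)a of a
fake at `t`. -/
theorem uA_eq (t : ℝ≥0∞) :
    E.uA p t = E.β + (∫ s in upTo t, E.marginalA p s) +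
      E.dsurvTop t * (1 - p.stopping.cdf t) * ((E.μ - E.β) * p.response t.toReal) := by
  have hnv : ∀ m, (Iic t).indicator (fun m => E.disc m *
      (p.stopping.atom m * (1 - E.G m.toReal)) * E.β) m =
      E.β * (Iic t).indicator (fun m => p.stopping.atom m * E.dsurvTop m) m := by
    intro m
    by_cases hm : m ≤ t
    · simp only [indicator, mem_Iic, hm, if_true, dsurvTop]; ring
    · simp [indicator, hm]
  have hsub := upTo_subset t
  have i1 := (E.integrableOn_marginalA (p := p)).mono_set hsub
  have i2 := (E.integrableOn_deriv_dsurv_cdf p.stopping).mono_set hsub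
  have i3 := (E.integrableOn_dsurv_density p.stopping).mono_set hsub
  have i4 := E.integrableOn_deriv_dsurv.mono_set hsub
  have hA : ∫ s in upTo t, Real.exp (-E.ρ * s) *
      ((1 - E.μ) * E.g s * noStop p s * E.β +
        E.μ * E.g s * noStop p s * ((1 - p.response s) * E.β + p.response s) +
        p.stopping.density s * (1 - E.G s) * E.β) =
      (∫ s in upTo t, E.marginalA p s) + (E.β * (∫ s in upTo t, E.dsurv s * (E.ρ + E.haz s)) +
      (E.β * (∫ s in upTo t, E.dsurv s * p.stopping.density s) -
      E.β * ∫ s in upTo t, E.dsurv s * (E.ρ + E.haz s) *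
        p.stopping.cdf (ENNReal.ofReal s))) := by
    rw [← integral_linear_combination i1 i4 i3 i2]
    refine setIntegral_congr_fun (measurableSet_upTo t) fun s hs => ?_
    have e1 : Real.exp (-E.ρ * s) *
      ((1 - E.μ) * E.g s * noStop p s * E.β +
        E.μ * E.g s * noStop p s * ((1 - p.response s) * E.β + p.response s) +
        p.stopping.density s * (1 - E.G s) * E.β) = Real.exp (-E.ρ * s) * E.g s *
        (noStop p s * ((1 - E.μ) * E.β + E.μ * ((1 - p.response s) * E.β + p.response s))) +
        Real.exp (-E.ρ * s) * (1 - E.G s) * (p.stopping.density s * E.β) := by ring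
    simp only [e1]
    rw [E.exp_mul_surv hs.1, E.exp_mul_g hs.1, marginalA, noStop]
    ring
  have hD : E.disc t * ((1 - E.G t.toReal) * (1 - p.stopping.cdf t)) *
      ((1 - p.response t.toReal) * E.β + E.μ * p.response t.toReal) =
      E.dsurvTop t * (1 - p.stopping.cdf t) *
      ((1 - p.response t.toReal) * E.β + E.μ * p.response t.toReal) := by rw [dsurvTop]; ring
  rw [uA, tsum_congr hnv, tsum_mul_left, E.tsum_atom_eq, hA, hD]
  linear_combination E.β * E.dsurvTop_eq_one_sub t

end Environment

/-! ### Strict monotonicity of cumulative integrals, and a linear integral equation -/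

theorem integral_upTo_lt {j : ℝ → ℝ} (hj : IntegrableOn j (Ici 0)) {s t : ℝ≥0∞} (hst : s < t)
    (h : ∀ x, 0 ≤ x → s < ENNReal.ofReal x → ENNReal.ofReal x < t → j x < 0) :
    ∫ x in upTo t, j x < ∫ x in upTo s, j x := by
  have hsub : upTo s ⊆ upTo t := fun x hx => ⟨hx.1, hx.2.trans hst.le⟩
  have h1 := setIntegral_sdiff (measurableSet_upTo s) (hj.mono_set (upTo_subset t)) hsub
  have hm : MeasurableSet (upTo t \ upTo s) := (measurableSet_upTo t).diff (measurableSet_upTo s)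
  have hae : ∀ᵐ x ∂volume.restrict (upTo t \ upTo s), j x < 0 := by
    filter_upwards [ae_restrict_mem hm,
      ae_restrict_of_ae (compl_mem_ae_iff.2 (measure_singleton t.toReal))] with x hx hxt
    refine h x hx.1.1 (not_le.1 fun h' => hx.2 ⟨hx.1.1, h'⟩) (lt_of_le_of_ne hx.1.2 fun h' => hxt ?_)
    rw [mem_singleton_iff, ← h', ENNReal.toReal_ofReal hx.1.1]
  -- As `t` may be `∞`, a real `r` in between provides an interval of positive length on which the
  -- integrand is negative.
  obtain ⟨r, hr0, hsr, hrt⟩ := ENNReal.lt_iff_exists_real_btwn.1 hst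
  have hs : s ≠ ∞ := (hst.trans_le le_top).ne
  have hpos : 0 < volume (upTo t \ upTo s) := by
    have hsr' : s.toReal < r := by
      rwa [← ENNReal.ofReal_lt_ofReal_iff_of_nonneg ENNReal.toReal_nonneg,
        ENNReal.ofReal_toReal hs]
    have : Ioo s.toReal r ⊆ upTo t \ upTo s := fun x hx => by
      have hx0 : 0 ≤ x := ENNReal.toReal_nonneg.trans hx.1.le
      refine ⟨⟨hx0, (ENNReal.ofReal_le_ofReal hx.2.le).trans hrt.le⟩, fun h' => ?_⟩
      have := ENNReal.toReal_mono hs h'.2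
      rw [ENNReal.toReal_ofReal hx0] at this
      exact this.not_gt hx.1
    refine lt_of_lt_of_le ?_ (measure_mono this)
    rw [Real.volume_Ioo]
    exact ENNReal.ofReal_pos.2 (sub_pos.2 hsr')
  have hint : IntegrableOn (fun x => -j x) (upTo t \ upTo s) :=
    (hj.mono_set (sdiff_subset.trans (upTo_subset t))).neg
  have h2 : 0 < ∫ x in upTo t \ upTo s, -j x := by
    rw [setIntegral_pos_iff_support_of_nonneg_ae
      (hae.mono fun x hx => (neg_pos.2 hx).le) hint]
    rw [← Measure.restrict_apply₀' hm.nullMeasurableSet]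
    have h3 : (volume.restrict (upTo t \ upTo s)) (Function.support fun x => -j x)ᶜ = 0 :=
      hae.mono fun x hx => (neg_pos.2 hx).ne'
    rw [measure_of_measure_compl_eq_zero h3]
    simpa using hpos
  rw [integral_neg] at h2
  linarith

theorem integral_upTo_gt {j : ℝ → ℝ} (hj : IntegrableOn j (Ici 0)) {s t : ℝ≥0∞} (hst : s < t)
    (h : ∀ x, 0 ≤ x → s < ENNReal.ofReal x → ENNReal.ofReal x < t → 0 < j x) :
    ∫ x in upTo s, j x < ∫ x in upTo t, j x := by
  have := integral_upTo_lt (j := fun x => -j x) hj.neg hst fun x h0 h1 h2 =>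
    neg_lt_zero.2 (h x h0 h1 h2)
  rw [integral_neg, integral_neg] at this
  exact neg_lt_neg_iff.1 this

theorem intervalIntegrable_of_integrableOn_Ici {j : ℝ → ℝ} (hj : IntegrableOn j (Ici 0)) {a b : ℝ}
    (ha : 0 ≤ a) (hb : 0 ≤ b) : IntervalIntegrable j volume a b := by
  rw [intervalIntegrable_iff]
  exact hj.mono_set fun x hx => mem_Ici.2 ((le_min ha hb).trans hx.1.le)

theorem integral_upTo_sub {j : ℝ → ℝ} (hj : IntegrableOn j (Ici 0)) {a b : ℝ} (ha : 0 ≤ a)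
    (hb : 0 ≤ b) : (∫ x in upTo (ENNReal.ofReal b), j x) - ∫ x in upTo (ENNReal.ofReal a), j x =
      ∫ x in a..b, j x := by
  rw [integral_upTo_ofReal _ ha, integral_upTo_ofReal _ hb,
    intervalIntegral.integral_interval_sub_left (intervalIntegrable_of_integrableOn_Ici hj le_rfl hb)
      (intervalIntegrable_of_integrableOn_Ici hj le_rfl ha)]

theorem continuous_integral_upTo {j : ℝ → ℝ} (hj : IntegrableOn j (Ici 0)) :
    Continuous fun t : ℝ => ∫ x in upTo (ENNReal.ofReal t), j x := by
  have h1 : Integrable ((Ici (0 : ℝ)).indicator j) := hj.integrable_indicator measurableSet_Ici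
  have h2 := intervalIntegral.continuous_primitive (fun a b => h1.intervalIntegrable) (0 : ℝ)
  have h3 : (fun t : ℝ => ∫ x in upTo (ENNReal.ofReal t), j x) =
      fun t => ∫ x in (0 : ℝ)..max t 0, (Ici (0 : ℝ)).indicator j x := by
    ext t
    rw [show ENNReal.ofReal t = ENNReal.ofReal (max t 0) by
      rcases le_total t 0 with h | h
      · rw [max_eq_right h, ENNReal.ofReal_of_nonpos h, ENNReal.ofReal_zero]
      · rw [max_eq_left h], integral_upTo_ofReal _ (le_max_right t 0)]
    refine intervalIntegral.integral_congr fun x hx => ?_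
    rw [uIcc_of_le (le_max_right t 0)] at hx
    rw [indicator_of_mem (mem_Ici.2 hx.1)]
  rw [h3]
  exact h2.comp (continuous_id.max continuous_const)

/-- The linear integral equation `y t = y a - ∫ k y` is solved by the exponential. -/
theorem eq_mul_exp_of_integral_eq {k y : ℝ → ℝ} {a b : ℝ} (hk : Continuous k)
    (hy : ContinuousOn y (Icc a b))
    (h : ∀ t ∈ Icc a b, y t = y a - ∫ s in a..t, k s * y s) :
    ∀ t ∈ Icc a b, y t = y a * Real.exp (-∫ s in a..t, k s) := by
  have hky : ContinuousOn (fun s => k s * y s) (Icc a b) := hk.continuousOn.mul hy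
  have hE : ∀ x, HasDerivAt (fun t => Real.exp (∫ s in a..t, k s))
      (Real.exp (∫ s in a..x, k s) * k x) x := fun x =>
    (hk.integral_hasStrictDerivAt a x).hasDerivAt.exp
  -- Integrating factor: the product of `y` with the exponential of the integral of `k` has zero
  -- right derivative. One-sided derivatives suffice, so nothing is needed outside `Icc a b`.
  have hconst := constant_of_has_deriv_right_zero (f := fun t => y t * Real.exp (∫ s in a..t, k s))
    (a := a) (b := b) (hy.mul (fun x _ => (hE x).continuousAt.continuousWithinAt)) (fun x hx => by
      have hd : HasDerivWithinAt (fun u => ∫ s in a..u, k s * y s) (k x * y x) (Ici x) x := by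
        have hxb : Icc x b ∈ 𝓝[>] x := by
          refine mem_of_superset (Ioo_mem_nhdsGT hx.2) Ioo_subset_Icc_self
        have hc : ContinuousWithinAt (fun s => k s * y s) (Icc x b) x :=
          (hky x ⟨hx.1, hx.2.le⟩).mono (Icc_subset_Icc_left hx.1)
        refine intervalIntegral.integral_hasDerivWithinAt_right (t := Ioi x) ?_ ?_ ?_
        · exact (hky.mono (Icc_subset_Icc_right hx.2.le)).intervalIntegrable_of_Icc hx.1
        · exact ⟨Icc x b, hxb, (hky.mono (Icc_subset_Icc_left hx.1)).aestronglyMeasurable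
            measurableSet_Icc⟩
        · exact hc.mono_of_mem_nhdsWithin hxb
      have hd2 : HasDerivWithinAt y (-(k x * y x)) (Ici x) x := by
        have hIcc : Icc x b ∈ 𝓝[≥] x := Icc_mem_nhdsGE hx.2
        refine (hd.const_sub (y a)).congr_of_eventuallyEq ?_ (h x ⟨hx.1, hx.2.le⟩)
        filter_upwards [hIcc] with t ht using h t ⟨hx.1.trans ht.1, ht.2⟩
      convert! hd2.mul (hE x).hasDerivWithinAt using 1
      ring)
  intro t ht
  have := hconst t ht
  simp only [intervalIntegral.integral_same, Real.exp_zero, mul_one] at this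
  rw [← this, mul_assoc, ← Real.exp_add, add_neg_cancel, Real.exp_zero, mul_one]

/-! ### Signs of the principal's marginal value, and the agent's rent -/

namespace Environment

variable {E : Environment} {σ : ℝ} {p : Profile}

theorem phiP_lt_iff {x : ℝ} : E.phiP < x ↔ E.ρ * E.θ < E.μ * (1 - E.θ) * x := by
  rw [phiP, div_lt_iff₀' (mul_pos E.μ_pos (sub_pos.2 E.θ_lt_one))]

theorem lt_phiP_iff {x : ℝ} : x < E.phiP ↔ E.μ * (1 - E.θ) * x < E.ρ * E.θ := by
  rw [phiP, lt_div_iff₀' (mul_pos E.μ_pos (sub_pos.2 E.θ_lt_one))]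

theorem phiA_lt_iff {x : ℝ} : E.phiA < x ↔ E.ρ * E.μ < E.β * (1 - E.μ) * x := by
  rw [phiA, div_lt_iff₀' (mul_pos E.β_pos (sub_pos.2 E.μ_lt_one))]

theorem IsEquilibrium.optimalResponse (h : E.IsEquilibrium σ p) : E.OptimalResponse σ p :=
  fun t ht => ⟨h.response_one t ht, h.response_zero t ht⟩

/-- Where no fakes are charged, type-1 news is certainly real: the belief is 1 > θ and the news must
be followed. -/
theorem IsEquilibrium.faking_of_response_lt_one (h : E.IsEquilibrium σ p) (hσ : 0 ≤ σ)
    (hσ1 : σ < 1) {t : ℝ} (ht : 0 ≤ t) (ha : p.response t < 1) :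
    p.faking.Charges (ENNReal.ofReal t) ∧ E.belief σ p t ≤ E.θ := by
  have h1 : E.belief σ p t ≤ E.θ := not_lt.1 fun h' => ha.ne (h.response_one t ht h')
  refine ⟨?_, h1⟩
  by_contra h2
  rw [E.belief_of_not_charges hσ hσ1 ht h2] at h1
  exact h1.not_gt E.θ_lt_one

/-- Clears the denominator of the belief: following real news gains 1 - θ when ω = 1, following a
fake loses θ - μ on average. -/
theorem weight_mul_belief_sub (hσ : 0 ≤ σ) (hσ1 : σ < 1) {s : ℝ} (hs : 0 ≤ s)
    (hat : ¬ 0 < p.faking.atom (ENNReal.ofReal s)) :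
    (E.μ * E.haz s * noFake σ p s + σ * p.faking.density s) * (E.belief σ p s - E.θ) =
      E.μ * (1 - E.θ) * E.haz s * noFake σ p s - (E.θ - E.μ) * (σ * p.faking.density s) := by
  have h1 := E.belief_mul_w1 (p := p) hσ hσ1 hs hat
  have hS := E.surv_pos s
  refine mul_right_cancel₀ hS.ne' ?_
  rw [w1, ← E.gExt_eq hs, ← E.surv_eq hs, ← haz_mul_surv] at h1
  linear_combination h1

/-- Fakes cannot help the principal: following news loses through them, and ignoring it forgoes the
gain from real news. First-best search, conditional on no fake so far, is therefore an upper bound.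
-/
theorem OptimalResponse.marginalP_le (h : E.OptimalResponse σ p) (hσ : 0 ≤ σ) (hσ1 : σ < 1)
    {s : ℝ} (hs : 0 ≤ s) : E.marginalP σ p s ≤ noFake σ p s * E.marginal s := by
  have hN := noFake_pos (p := p) hσ hσ1 s
  have hH := E.haz_pos s
  have hf := mul_nonneg hσ (p.faking.density_nonneg s)
  have hkey : (E.μ * E.haz s * noFake σ p s + σ * p.faking.density s) *
      (E.newsValue σ p s - E.θ) ≤ E.μ * (1 - E.θ) * E.haz s * noFake σ p s := by
    have h0 : 0 ≤ E.μ * (1 - E.θ) * E.haz s * noFake σ p s :=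
      (mul_pos (mul_pos (mul_pos E.μ_pos (sub_pos.2 E.θ_lt_one)) hH) hN).le
    rw [h.newsValue_eq hs]
    rcases le_total (E.belief σ p s) E.θ with hb | hb
    · rw [max_eq_left hb, sub_self, mul_zero]; exact h0
    · rw [max_eq_right hb]
      have hat : ¬ 0 < p.faking.atom (ENNReal.ofReal s) := fun h' => by
        rw [E.belief_of_atom h'] at hb
        exact hb.not_gt E.μ_lt_θ
      rw [weight_mul_belief_sub hσ hσ1 hs hat]
      have := mul_nonneg (sub_pos.2 E.μ_lt_θ).le hf
      linarith
  rw [marginalP, marginal]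
  nlinarith [E.dsurv_pos s]

theorem OptimalResponse.marginalP_neg_of_belief_le (h : E.OptimalResponse σ p) (hσ : 0 ≤ σ)
    (hσ1 : σ < 1) {s : ℝ} (hs : 0 ≤ s) (hb : E.belief σ p s ≤ E.θ) : E.marginalP σ p s < 0 := by
  rw [marginalP, h.newsValue_eq hs, max_eq_left hb, sub_self, mul_zero, zero_sub]
  exact mul_neg_of_pos_of_neg (E.dsurv_pos s) (neg_lt_zero.2
    (mul_pos (mul_pos E.ρ_pos E.θ_pos) (noFake_pos hσ hσ1 s)))

theorem marginal_neg {s : ℝ} (hH : E.haz s < E.phiP) : E.marginal s < 0 :=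
  mul_neg_of_pos_of_neg (E.dsurv_pos s) (sub_neg.2 (lt_phiP_iff.1 hH))

theorem marginal_pos {s : ℝ} (hH : E.phiP < E.haz s) : 0 < E.marginal s :=
  mul_pos (E.dsurv_pos s) (sub_pos.2 (phiP_lt_iff.1 hH))

theorem OptimalResponse.marginalP_neg_of_haz_lt (h : E.OptimalResponse σ p) (hσ : 0 ≤ σ)
    (hσ1 : σ < 1) {s : ℝ} (hs : 0 ≤ s) (hH : E.haz s < E.phiP) : E.marginalP σ p s < 0 :=
  (h.marginalP_le hσ hσ1 hs).trans_lt
    (mul_neg_of_pos_of_neg (noFake_pos hσ hσ1 s) (marginal_neg hH))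

theorem OptimalResponse.marginalP_of_not_charges (h : E.OptimalResponse σ p) (hσ : 0 ≤ σ)
    (hσ1 : σ < 1) {s : ℝ} (hs : 0 ≤ s) (hc : ¬ p.faking.Charges (ENNReal.ofReal s)) :
    E.marginalP σ p s = noFake σ p s * E.marginal s := by
  have hf : p.faking.density s = 0 := le_antisymm (not_lt.1 fun h' => hc
    (Or.inr ⟨ENNReal.ofReal_ne_top, by rwa [ENNReal.toReal_ofReal hs]⟩)) (p.faking.density_nonneg s)
  rw [marginalP, h.newsValue_eq hs, E.belief_of_not_charges hσ hσ1 hs hc,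
    max_eq_right E.θ_lt_one.le, hf, marginal]
  ring

variable (E) in
/-- The principal's cumulative gain from search up to `t`. -/
def gainP (σ : ℝ) (p : Profile) (t : ℝ≥0∞) : ℝ := ∫ s in upTo t, E.marginalP σ p s

variable (E) in
/-- `R` is the agent's rent: the excess of his optimal value over the value of waiting. -/
structure IsRent (p : Profile) (R : ℝ≥0∞ → ℝ) : Prop where
  eq_sub : ∃ c, ∀ t, R t = c - (∫ s in upTo t, E.marginalA p s) / (E.μ - E.β)
  le : ∀ t, E.dsurvTop t * (1 - p.stopping.cdf t) * p.response t.toReal ≤ R t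
  eq_of_charges : ∀ t, p.faking.Charges t →
    E.dsurvTop t * (1 - p.stopping.cdf t) * p.response t.toReal = R t

/-- Some time is charged by the faking law, and the payoff there is the optimal value that fixes the
constant. -/
theorem IsEquilibrium.exists_isRent (h : E.IsEquilibrium σ p) : ∃ R, E.IsRent p R := by
  obtain ⟨u, hu⟩ := p.faking.exists_charges
  have hb : 0 < E.μ - E.β := sub_pos.2 E.β_lt_μ
  refine ⟨fun t => (E.uA p u - E.β) / (E.μ - E.β) -
    (∫ s in upTo t, E.marginalA p s) / (E.μ - E.β), ⟨_, fun t => rfl⟩, fun t => ?_, fun t ht => ?_⟩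
  · have := h.faking_opt u t hu
    rw [E.uA_eq t] at this
    rw [← sub_div, le_div_iff₀ hb]
    linarith
  · have h1 := h.faking_opt u t hu
    have h2 := h.faking_opt t u ht
    have := le_antisymm h1 h2
    rw [E.uA_eq t] at this
    rw [← sub_div, eq_div_iff hb.ne']
    linarith

theorem IsEquilibrium.gainP_le (h : E.IsEquilibrium σ p) (hσ : 0 ≤ σ) (hσ1 : σ < 1) {t : ℝ≥0∞}
    (ht : p.stopping.Charges t) (t' : ℝ≥0∞) : E.gainP σ p t' ≤ E.gainP σ p t := by
  have := h.stopping_opt t t' ht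
  rw [h.optimalResponse.uP_eq hσ hσ1, h.optimalResponse.uP_eq hσ hσ1] at this
  exact (add_le_add_iff_left _).1 this

theorem noStop_lt_iff {s t : ℝ} : noStop p t < noStop p s ↔
    p.stopping.cdf (ENNReal.ofReal s) < p.stopping.cdf (ENNReal.ofReal t) := by
  rw [noStop, noStop, sub_lt_sub_iff_left]

theorem IsRent.continuous {R : ℝ≥0∞ → ℝ} (hR : E.IsRent p R) :
    Continuous fun t : ℝ => R (ENNReal.ofReal t) := by
  obtain ⟨c, hc⟩ := hR.eq_sub
  simp only [hc]
  exact continuous_const.sub ((continuous_integral_upTo E.integrableOn_marginalA).div_const _)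

theorem IsRent.sub_eq {R : ℝ≥0∞ → ℝ} (hR : E.IsRent p R) {s t : ℝ} (hs : 0 ≤ s) (ht : 0 ≤ t) :
    R (ENNReal.ofReal s) - R (ENNReal.ofReal t) =
      (∫ x in s..t, E.marginalA p x) / (E.μ - E.β) := by
  obtain ⟨c, hc⟩ := hR.eq_sub
  rw [hc, hc, ← integral_upTo_sub E.integrableOn_marginalA hs ht]
  ring

theorem IsRent.le_real {R : ℝ≥0∞ → ℝ} (hR : E.IsRent p R) {t : ℝ} (ht : 0 ≤ t) :
    E.dsurv t * noStop p t * p.response t ≤ R (ENNReal.ofReal t) := by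
  have := hR.le (ENNReal.ofReal t)
  rwa [E.dsurvTop_ofReal ht, ENNReal.toReal_ofReal ht] at this

theorem IsRent.eq_real {R : ℝ≥0∞ → ℝ} (hR : E.IsRent p R) {t : ℝ} (ht : 0 ≤ t)
    (hc : p.faking.Charges (ENNReal.ofReal t)) :
    E.dsurv t * noStop p t * p.response t = R (ENNReal.ofReal t) := by
  have := hR.eq_of_charges (ENNReal.ofReal t) hc
  rwa [E.dsurvTop_ofReal ht, ENNReal.toReal_ofReal ht] at this

theorem continuousWithinAt_noStop (t : ℝ) : ContinuousWithinAt (noStop p) (Ici t) t :=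
  (p.stopping.tendsto_cdf_right t).const_sub 1

end Environment

/-! ### News is followed as long as search goes on -/

namespace Environment

variable {E : Environment} {σ : ℝ} {p : Profile} {R : ℝ≥0∞ → ℝ}

theorem IsEquilibrium.marginalP_neg (h : E.IsEquilibrium σ p) (hσ : 0 ≤ σ)
    (hσ1 : σ < 1) {s : ℝ} (hs : 0 ≤ s) (ha : p.response s < 1) : E.marginalP σ p s < 0 :=
  h.optimalResponse.marginalP_neg_of_belief_le hσ hσ1 hs
    (h.faking_of_response_lt_one hσ hσ1 hs ha).2

theorem IsRent.response_lt_one (hR : E.IsRent p R) {t : ℝ} (ht : 0 ≤ t)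
    (h : R (ENNReal.ofReal t) < E.dsurv t * noStop p t) : p.response t < 1 := by
  refine lt_of_le_of_ne (p.response_le_one t) fun h1 => ?_
  have := hR.le_real ht
  rw [h1, mul_one] at this
  exact this.not_gt h

theorem IsRent.nonneg (hR : E.IsRent p R) (t : ℝ≥0∞) : 0 ≤ R t :=
  (mul_nonneg (mul_nonneg (E.dsurvTop_nonneg t) (sub_nonneg.2 (p.stopping.cdf_le_one t)))
    (p.response_nonneg _)).trans (hR.le t)

/-- If the principal's waiting value decreases after `s`, then she does not stop after `s`. -/
theorem IsEquilibrium.not_charges_of_marginalP_neg (h : E.IsEquilibrium σ p) (hσ : 0 ≤ σ)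
    (hσ1 : σ < 1) {s u : ℝ≥0∞} (hsu : s < u) (hneg : ∀ x, 0 ≤ x → s < ENNReal.ofReal x →
      ENNReal.ofReal x < u → E.marginalP σ p x < 0) : ¬ p.stopping.Charges u := fun hu =>
  (h.gainP_le hσ hσ1 hu s).not_gt
    (integral_upTo_lt (h.optimalResponse.integrableOn_marginalP hσ hσ1) hsu hneg)

theorem IsEquilibrium.not_charges_of_marginalP_pos (h : E.IsEquilibrium σ p) (hσ : 0 ≤ σ)
    (hσ1 : σ < 1) {s u : ℝ≥0∞} (hsu : s < u) (hpos : ∀ x, 0 ≤ x → s < ENNReal.ofReal x →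
      ENNReal.ofReal x < u → 0 < E.marginalP σ p x) : ¬ p.stopping.Charges s := fun hu =>
  (h.gainP_le hσ hσ1 hu u).not_gt
    (integral_upTo_gt (h.optimalResponse.integrableOn_marginalP hσ hσ1) hsu hpos)

variable (E) in
/-- The stopping hazard that keeps the agent indifferent about the time of faking. -/
def stopRate (s : ℝ) : ℝ := (E.haz s * E.β * (1 - E.μ) - E.ρ * E.μ) / (E.μ - E.β)

theorem continuous_stopRate : Continuous E.stopRate :=
  (((E.continuous_haz.mul continuous_const).mul continuous_const).sub continuous_const).div_const _

theorem stopRate_pos {s : ℝ} (h : E.phiA < E.haz s) : 0 < E.stopRate s := by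
  rw [phiA_lt_iff] at h
  exact div_pos (by linarith) (sub_pos.2 E.β_lt_μ)

/-- When news is followed, R' = -(stopRate + ρ + H) D P. This is also the derivative of D P when
stopping occurs at hazard `stopRate`, so that R = D P is preserved. -/
theorem stopRate_add_eq (s : ℝ) : (E.stopRate s + (E.ρ + E.haz s)) * (E.μ - E.β) =
    E.μ * (1 - E.β) * E.haz s - E.ρ * E.β := by
  rw [stopRate, add_mul, div_mul_cancel₀ _ (sub_pos.2 E.β_lt_μ).ne']
  ring

/-- The agent's rent never falls short of the discounted probability that search goes on. -/
theorem IsEquilibrium.dsurv_mul_noStop_le (h : E.IsEquilibrium σ p) (hA2 : E.A2) (hσ : 0 ≤ σ)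
    (hσ1 : σ < 1) (hR : E.IsRent p R) {t : ℝ} (ht : 0 ≤ t) :
    E.dsurv t * noStop p t ≤ R (ENNReal.ofReal t) := by
  by_contra! hlt
  have hP0 : 0 < noStop p t := by
    rcases (noStop_nonneg (p := p) t).eq_or_lt with h0 | h0
    · rw [← h0, mul_zero] at hlt
      exact absurd (hR.nonneg _) hlt.not_ge
    · exact h0
  -- The gap R < D P persists until H falls below φ_P. Otherwise let `t₂` be the first time at which
  -- it has closed; right-continuity of P puts the closed inequality at `t₂` itself.
  have key : ∀ s, t ≤ s → R (ENNReal.ofReal s) < E.dsurv s * noStop p s ∨ E.haz s < E.phiP := by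
    by_contra! hex
    obtain ⟨t₃, ht₃, hR₃, hH₃⟩ := hex
    set C : Set ℝ := {s | s ∈ Icc t t₃ ∧ E.dsurv s * noStop p s ≤ R (ENNReal.ofReal s)} with hC
    have hne : C.Nonempty := ⟨t₃, ⟨ht₃, le_rfl⟩, hR₃⟩
    have hbdd : BddBelow C := ⟨t, fun s hs => hs.1.1⟩
    set t₂ := sInf C with ht₂
    have h12 : t ≤ t₂ := le_csInf hne fun s hs => hs.1.1
    have h23 : t₂ ≤ t₃ := csInf_le hbdd ⟨⟨ht₃, le_rfl⟩, hR₃⟩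
    have hCsub : C ⊆ Ici t₂ := fun s hs => csInf_le hbdd hs
    have hRt₂ : E.dsurv t₂ * noStop p t₂ ≤ R (ENNReal.ofReal t₂) :=
      ContinuousWithinAt.closure_le (csInf_mem_closure hne hbdd)
        ((E.continuous_dsurv.continuousWithinAt.mul (continuousWithinAt_noStop t₂)).mono hCsub)
        hR.continuous.continuousWithinAt fun s hs => hs.2
    have hlt12 : t < t₂ := lt_of_le_of_ne h12 fun he => (he ▸ hRt₂).not_gt hlt
    have hbelow : ∀ s, t ≤ s → s < t₂ → R (ENNReal.ofReal s) < E.dsurv s * noStop p s :=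
      fun s hs hs2 => not_le.1 fun h' =>
        hs2.not_ge (csInf_le hbdd ⟨⟨hs, hs2.le.trans h23⟩, h'⟩)
    -- In the gap the response is below one and waiting loses, so no stopping time is charged there.
    have hconst : ∀ s, t ≤ s → s ≤ t₂ → noStop p s = noStop p t := by
      intro s hs hs2
      refine le_antisymm (noStop_antitone hs) (not_lt.1 fun h' => ?_)
      obtain ⟨u, hu1, hu2, hu⟩ := p.stopping.exists_charges_of_cdf_lt (noStop_lt_iff.1 h')
      refine h.not_charges_of_marginalP_neg hσ hσ1 hu1 (fun x hx0 hx1 hx2 => ?_) hu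
      have hx1' := (ENNReal.ofReal_lt_ofReal_iff_of_nonneg ht).1 hx1
      have hx2' := (ENNReal.ofReal_lt_ofReal_iff_of_nonneg hx0).1 (hx2.trans_le hu2)
      exact h.marginalP_neg hσ hσ1 hx0
        (hR.response_lt_one hx0 (hbelow x hx1'.le (hx2'.trans_le hs2)))
    set c := noStop p t with hc
    have ht₂0 : 0 ≤ t₂ := ht.trans h12
    have hH₂ : E.phiA < E.haz t₂ := hA2.trans_le (hH₃.trans (E.haz_le_haz ht₂0 h23))
    set X : ℝ → ℝ := fun s => c * E.dsurv s - R (ENNReal.ofReal s) with hX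
    have hXc : Continuous X := (continuous_const.mul E.continuous_dsurv).sub hR.continuous
    have hX2 : X t₂ ≤ 0 := by
      have := hconst t₂ h12 le_rfl
      rw [this] at hRt₂
      simp only [hX]; linarith
    have hXpos : ∀ s, t ≤ s → s < t₂ → 0 < X s := fun s hs hs2 => by
      have := hbelow s hs hs2
      rw [hconst s hs hs2.le] at this
      simp only [hX]; linarith
    have hb : 0 < E.μ - E.β := sub_pos.2 E.β_lt_μ
    have hβ1 : 0 < 1 - E.β := by linarith [E.β_lt_μ, E.μ_lt_one]
    -- With P = c and X = cD - R, indifference (R = cDa) gives (μ - β)X' = cD stopRate (μ - β) - μ(1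
    -- - β)HX. At `t₂` one has X ≤ 0 and stopRate > 0, so the right side is positive at `t₂` and, by
    -- continuity, just before it.
    have hev : ∀ᶠ s in 𝓝 t₂, E.μ * (1 - E.β) * E.haz s * X s <
        c * E.dsurv s * (E.stopRate s * (E.μ - E.β)) := by
      refine ContinuousAt.eventually_lt ?_ ?_ ?_
      · exact ((continuous_const.mul E.continuous_haz).mul hXc).continuousAt
      · exact ((continuous_const.mul E.continuous_dsurv).mul
          (continuous_stopRate.mul continuous_const)).continuousAt
      · have h1 : E.μ * (1 - E.β) * E.haz t₂ * X t₂ ≤ 0 :=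
          mul_nonpos_of_nonneg_of_nonpos (mul_pos (mul_pos E.μ_pos hβ1) (E.haz_pos _)).le hX2
        exact h1.trans_lt (mul_pos (mul_pos hP0 (E.dsurv_pos _)) (mul_pos (stopRate_pos hH₂) hb))
    obtain ⟨s, ⟨hs1, hs2⟩, hs⟩ : ∃ s, (t ≤ s ∧ s < t₂) ∧ ∀ x ∈ Ioo s t₂,
        E.μ * (1 - E.β) * E.haz x * X x < c * E.dsurv x * (E.stopRate x * (E.μ - E.β)) := by
      obtain ⟨l, hl, hl'⟩ := exists_Ioc_subset_of_mem_nhds hev ⟨t, hlt12⟩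
      exact ⟨max l t, ⟨le_max_right _ _, max_lt hl hlt12⟩, fun x hx =>
        hl' ⟨(le_max_left _ _).trans_lt hx.1, hx.2.le⟩⟩
    have hs0 : 0 ≤ s := ht.trans hs1
    have hdiff := hR.sub_eq hs0 ht₂0
    have hDd := E.integral_deriv_dsurv_interval s t₂
    have hmono : ∫ x in s..t₂, c * (E.μ - E.β) * (E.dsurv x * (E.ρ + E.haz x)) ≤
        ∫ x in s..t₂, E.marginalA p x := by
      refine intervalIntegral.integral_mono_on_of_le_Ioo hs2.le
        ((continuous_const.mul (E.continuous_dsurv.mul (continuous_const.add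
          E.continuous_haz))).intervalIntegrable _ _)
        (intervalIntegrable_of_integrableOn_Ici E.integrableOn_marginalA hs0 ht₂0) fun x hx => ?_
      have hx0 : 0 ≤ x := hs0.trans hx.1.le
      have hxt := hs1.trans hx.1.le
      have hxr := hR.response_lt_one hx0 (hbelow x hxt hx.2)
      have heq := hR.eq_real hx0 (h.faking_of_response_lt_one hσ hσ1 hx0 hxr).1
      have hxX := hs x hx
      rw [hconst x hxt hx.2.le] at heq
      rw [marginalA, hconst x hxt hx.2.le]
      simp only [hX] at hxX
      rw [← heq] at hxX
      have := congrArg (fun z => c * E.dsurv x * z) (stopRate_add_eq (E := E) x)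
      linarith
    rw [intervalIntegral.integral_const_mul, hDd] at hmono
    -- X does not decrease on [s, t₂], although it is positive at `s` and not at `t₂`.
    have hfin : X s ≤ X t₂ := by
      have : c * (E.dsurv s - E.dsurv t₂) ≤ R (ENNReal.ofReal s) - R (ENNReal.ofReal t₂) := by
        rw [hdiff, le_div_iff₀ hb]; linarith
      simp only [hX]; linarith
    exact ((hXpos s hs1 hs2).trans_le hfin).not_ge hX2
  -- Some stopping time after `t` is charged, yet the marginal value is negative from `t` on:
  -- through the gap, or through H < φ_P.
  have hlt1 : p.stopping.cdf (ENNReal.ofReal t) < p.stopping.cdf ∞ := by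
    rw [MixedTime.cdf_top]; rw [noStop] at hP0; linarith
  obtain ⟨u, hu1, -, hu⟩ := p.stopping.exists_charges_of_cdf_lt hlt1
  refine h.not_charges_of_marginalP_neg hσ hσ1 hu1 (fun x hx0 hx1 _ => ?_) hu
  have hx1' := (ENNReal.ofReal_lt_ofReal_iff_of_nonneg ht).1 hx1
  rcases key x hx1'.le with h' | h'
  · exact h.marginalP_neg hσ hσ1 hx0 (hR.response_lt_one hx0 h')
  · exact h.optimalResponse.marginalP_neg_of_haz_lt hσ hσ1 hx0 h'

/-- A response a < 1 entails faking at `t`, hence R = D P a < D P, against the lower bound on the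
rent. -/
theorem IsEquilibrium.response_eq_one (h : E.IsEquilibrium σ p) (hA2 : E.A2) (hσ : 0 ≤ σ)
    (hσ1 : σ < 1) {t : ℝ} (ht : 0 ≤ t) (hP : 0 < noStop p t) : p.response t = 1 := by
  obtain ⟨R, hR⟩ := h.exists_isRent
  refine le_antisymm (p.response_le_one t) (not_lt.1 fun ha => ?_)
  have h1 := hR.eq_real ht (h.faking_of_response_lt_one hσ hσ1 ht ha).1
  have h2 := h.dsurv_mul_noStop_le hA2 hσ hσ1 hR ht
  rw [← h1] at h2
  have := mul_lt_of_lt_one_right (mul_pos (E.dsurv_pos t) hP) ha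
  linarith

end Environment

/-! ### Persistence of the agent's willingness to fake -/

namespace Environment

variable {E : Environment} {σ : ℝ} {p : Profile} {R : ℝ≥0∞ → ℝ} {T : ℝ}

theorem IsRent.not_charges (hR : E.IsRent p R) {t : ℝ} (ht : 0 ≤ t)
    (h : E.dsurv t * noStop p t < R (ENNReal.ofReal t)) :
    ¬ p.faking.Charges (ENNReal.ofReal t) := fun hc => by
  have h1 := hR.eq_real ht hc
  have := mul_le_of_le_one_right (mul_nonneg (E.dsurv_pos t).le (noStop_nonneg (p := p) t))
    (p.response_le_one t)
  linarith

theorem phiP_lt_haz (hT : E.haz T = E.phiP) {s : ℝ} (hs : 0 ≤ s) (hsT : s < T) :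
    E.phiP < E.haz s := hT ▸ E.haz_lt_haz hs hsT

theorem IsEquilibrium.marginalP_pos (h : E.IsEquilibrium σ p) (hσ : 0 ≤ σ) (hσ1 : σ < 1)
    (hT : E.haz T = E.phiP) {s : ℝ} (hs : 0 ≤ s) (hsT : s < T)
    (hc : ¬ p.faking.Charges (ENNReal.ofReal s)) : 0 < E.marginalP σ p s := by
  rw [h.optimalResponse.marginalP_of_not_charges hσ hσ1 hs hc]
  exact mul_pos (noFake_pos hσ hσ1 s) (marginal_pos (phiP_lt_haz hT hs hsT))

/-- Past T even undisturbed search has negative marginal value, so a later stopping time is never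
optimal. -/
theorem IsEquilibrium.noStop_eq_zero (h : E.IsEquilibrium σ p) (hσ : 0 ≤ σ) (hσ1 : σ < 1)
    (hT0 : 0 ≤ T) (hT : E.haz T = E.phiP) : noStop p T = 0 := by
  refine le_antisymm (not_lt.1 fun hP => ?_) (noStop_nonneg T)
  have hlt1 : p.stopping.cdf (ENNReal.ofReal T) < p.stopping.cdf ∞ := by
    rw [MixedTime.cdf_top]; rw [noStop] at hP; linarith
  obtain ⟨u, hu1, -, hu⟩ := p.stopping.exists_charges_of_cdf_lt hlt1
  refine h.not_charges_of_marginalP_neg hσ hσ1 hu1 (fun x hx0 hx1 _ => ?_) hu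
  have hx1' := (ENNReal.ofReal_lt_ofReal_iff_of_nonneg hT0).1 hx1
  exact h.optimalResponse.marginalP_neg_of_haz_lt hσ hσ1 hx0 (hT ▸ E.haz_lt_haz hT0 hx1')

theorem IsEquilibrium.marginalA_eq (h : E.IsEquilibrium σ p) (hA2 : E.A2) (hσ : 0 ≤ σ)
    (hσ1 : σ < 1) {s : ℝ} (hs : 0 ≤ s) : E.marginalA p s =
      E.dsurv s * noStop p s * (E.stopRate s + (E.ρ + E.haz s)) * (E.μ - E.β) := by
  rw [mul_assoc _ _ (E.μ - E.β), stopRate_add_eq, marginalA]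
  rcases (noStop_nonneg (p := p) s).eq_or_lt with h0 | h0
  · rw [← h0]; ring
  · rw [h.response_eq_one hA2 hσ hσ1 hs h0]; ring

theorem IsEquilibrium.rent_sub (h : E.IsEquilibrium σ p) (hA2 : E.A2) (hσ : 0 ≤ σ)
    (hσ1 : σ < 1) (hR : E.IsRent p R) {s t : ℝ} (hs : 0 ≤ s) (hst : s ≤ t) :
    R (ENNReal.ofReal s) - R (ENNReal.ofReal t) =
      ∫ x in s..t, (E.stopRate x + (E.ρ + E.haz x)) * (E.dsurv x * noStop p x) := by
  rw [hR.sub_eq hs (hs.trans hst), div_eq_iff (sub_pos.2 E.β_lt_μ).ne',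
    ← intervalIntegral.integral_mul_const]
  refine intervalIntegral.integral_congr fun x hx => ?_
  rw [uIcc_of_le hst] at hx
  simp only [h.marginalA_eq hA2 hσ hσ1 (hs.trans hx.1)]
  ring

/-- Once the agent is willing to fake, he stays willing until the principal has stopped. -/
theorem IsEquilibrium.rent_le_of_rent_le (h : E.IsEquilibrium σ p) (hA2 : E.A2) (hσ : 0 ≤ σ)
    (hσ1 : σ < 1) (hT : E.haz T = E.phiP) (hR : E.IsRent p R) {s d : ℝ} (hs : 0 ≤ s)
    (hsd : s ≤ d) (hdT : d < T) (hP : 0 < noStop p d)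
    (hRs : R (ENNReal.ofReal s) ≤ E.dsurv s * noStop p s) :
    R (ENNReal.ofReal d) ≤ E.dsurv d * noStop p d := by
  by_contra! hlt₀
  -- Right-continuity extends the gap R > D P slightly beyond `d`. This leaves room to the right of
  -- the last contact time `e` even if `e = d`.
  obtain ⟨d', hdd', hd'⟩ : ∃ d', d < d' ∧ ∀ x ∈ Ico d d',
      E.dsurv x * noStop p x < R (ENNReal.ofReal x) ∧ 0 < noStop p x ∧ x < T := by
    have hc := continuousWithinAt_noStop (p := p) d
    have hev := (((E.continuous_dsurv.continuousWithinAt.mul hc).eventually_lt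
      hR.continuous.continuousWithinAt hlt₀).and (hc.eventually (lt_mem_nhds hP))).and
      (nhdsWithin_le_nhds (Iio_mem_nhds hdT))
    obtain ⟨d', hdd', hd'⟩ := mem_nhdsGE_iff_exists_Ico_subset.1 hev
    exact ⟨d', hdd', fun x hx => ⟨(hd' hx).1.1, (hd' hx).1.2, (hd' hx).2⟩⟩
  obtain ⟨d₁, hd₁, hd₁'⟩ := exists_between hdd'
  have hgap : ∀ x, d ≤ x → x ≤ d₁ → E.dsurv x * noStop p x < R (ENNReal.ofReal x) :=
    fun x h1 h2 => (hd' x ⟨h1, h2.trans_lt hd₁'⟩).1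
  obtain ⟨hlt, hP', hdT'⟩ := hd' d₁ ⟨hd₁.le, hd₁'⟩
  clear hd' hd₁' hdd' d'
  set Z : Set ℝ := {x | x ∈ Icc s d₁ ∧ R (ENNReal.ofReal x) ≤ E.dsurv x * noStop p x} with hZ
  have hne : Z.Nonempty := ⟨s, ⟨le_rfl, hsd.trans hd₁.le⟩, hRs⟩
  have hbdd : BddAbove Z := ⟨d₁, fun x hx => hx.1.2⟩
  set e := sSup Z with he
  have hse : s ≤ e := le_csSup hbdd ⟨⟨le_rfl, hsd.trans hd₁.le⟩, hRs⟩
  have hed : e ≤ d := csSup_le hne fun x hx =>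
    not_lt.1 fun h' => (hgap x h'.le hx.1.2).not_ge hx.2
  have hed' : e < d₁ := hed.trans_lt hd₁
  have he0 : 0 ≤ e := hs.trans hse
  have habove : ∀ x, e < x → x ≤ d₁ → E.dsurv x * noStop p x < R (ENNReal.ofReal x) :=
    fun x hx hxd => not_le.1 fun h' => hx.not_ge (le_csSup hbdd ⟨⟨hse.trans hx.le, hxd⟩, h'⟩)
  -- Between `e` and `d₁` there are no fakes and H > φ_P, so waiting until `d₁` is strictly better
  -- than stopping.
  have hnc : ∀ u, e ≤ u → u < d₁ → ¬ p.stopping.Charges (ENNReal.ofReal u) := by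
    intro u hu hud
    have hu0 := he0.trans hu
    refine h.not_charges_of_marginalP_pos hσ hσ1 (u := ENNReal.ofReal d₁)
      ((ENNReal.ofReal_lt_ofReal_iff_of_nonneg hu0).2 hud) fun x hx0 hx1 hx2 => ?_
    have hx1' := (ENNReal.ofReal_lt_ofReal_iff_of_nonneg hu0).1 hx1
    have hx2' := (ENNReal.ofReal_lt_ofReal_iff_of_nonneg hx0).1 hx2
    exact h.marginalP_pos hσ hσ1 hT hx0 (hx2'.trans hdT')
      (hR.not_charges hx0 (habove x (hu.trans_lt hx1') hx2'.le))
  -- Since `e` is not charged by the stopping law, P is left-continuous there and the inequality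
  -- passes to the supremum.
  have hRe : R (ENNReal.ofReal e) ≤ E.dsurv e * noStop p e := by
    have hcont : ContinuousWithinAt (noStop p) (Iic e) e :=
      continuousWithinAt_Iio_iff_Iic.1
        ((p.stopping.tendsto_cdf_left (hnc e le_rfl hed')).const_sub 1)
    exact ContinuousWithinAt.closure_le (csSup_mem_closure hne hbdd)
      hR.continuous.continuousWithinAt
      ((E.continuous_dsurv.continuousWithinAt.mul hcont).mono fun x hx => le_csSup hbdd hx)
      fun x hx => hx.2
  obtain ⟨x, hex, hxd⟩ := exists_between hed'
  have hconst : ∀ y ∈ Icc e x, noStop p y = noStop p e := fun y hy => by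
    refine le_antisymm (noStop_antitone hy.1) (not_lt.1 fun h' => ?_)
    obtain ⟨u, hu1, hu2, hu⟩ := p.stopping.exists_charges_of_cdf_lt (noStop_lt_iff.1 h')
    have hut : u ≠ ∞ := (hu2.trans_lt ENNReal.ofReal_lt_top).ne
    rw [← ENNReal.ofReal_toReal hut] at hu hu1 hu2
    exact hnc _ ((ENNReal.ofReal_lt_ofReal_iff_of_nonneg he0).1 hu1).le
      (((ENNReal.ofReal_le_ofReal_iff (he0.trans hy.1)).1 hu2).trans_lt (hy.2.trans_lt hxd)) hu
  have hc : 0 < noStop p e := hP'.trans_le (noStop_antitone hed'.le)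
  have hsub := h.rent_sub hA2 hσ hσ1 hR he0 hex.le
  -- With P constant, R loses the loss of P D plus a positive integral of `stopRate`; having started
  -- at or below P D, it ends below it.
  have h1 : ∫ y in e..x, (E.stopRate y + (E.ρ + E.haz y)) * (E.dsurv y * noStop p y) =
      (∫ y in e..x, noStop p e * (E.stopRate y * E.dsurv y)) +
      ∫ y in e..x, noStop p e * (E.dsurv y * (E.ρ + E.haz y)) := by
    rw [← intervalIntegral.integral_add]
    · refine intervalIntegral.integral_congr fun y hy => ?_
      rw [uIcc_of_le hex.le] at hy
      simp only [hconst y hy]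
      ring
    · exact (continuous_const.mul (continuous_stopRate.mul E.continuous_dsurv)).intervalIntegrable _ _
    · exact (continuous_const.mul (E.continuous_dsurv.mul
        (continuous_const.add E.continuous_haz))).intervalIntegrable _ _
  have h2 : 0 < ∫ y in e..x, noStop p e * (E.stopRate y * E.dsurv y) := by
    refine intervalIntegral.intervalIntegral_pos_of_pos_on
      ((continuous_const.mul (continuous_stopRate.mul E.continuous_dsurv)).intervalIntegrable _ _)
      (fun y hy => mul_pos hc (mul_pos (stopRate_pos ?_) (E.dsurv_pos y))) hex
    exact hA2.trans (phiP_lt_haz hT (he0.trans hy.1.le) (hy.2.trans (hxd.trans hdT')))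
  rw [h1, intervalIntegral.integral_const_mul (noStop p e) fun y => E.dsurv y * (E.ρ + E.haz y),
    integral_deriv_dsurv_interval] at hsub
  have h3 := habove x hex hxd.le
  rw [hconst x ⟨hex.le, le_rfl⟩] at h3
  nlinarith

end Environment

/-! ### The phases of search: waiting, then simultaneous faking and stopping -/

namespace Environment

variable {E : Environment} {σ : ℝ} {p : Profile} {R : ℝ≥0∞ → ℝ} {T : ℝ}

theorem cdf_eq_one {s : ℝ} (h : noStop p s = 0) {u : ℝ≥0∞} (hu : ENNReal.ofReal s ≤ u) :
    p.stopping.cdf u = 1 := by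
  refine le_antisymm (p.stopping.cdf_le_one u) ?_
  have := p.stopping.cdf_mono hu
  rw [noStop] at h
  linarith

theorem IsRent.eq_of_noStop_eq_zero (hR : E.IsRent p R) {s : ℝ} (h : noStop p s = 0) {u : ℝ≥0∞}
    (hu : ENNReal.ofReal s ≤ u) : R u = R (ENNReal.ofReal s) := by
  obtain ⟨c, hc⟩ := hR.eq_sub
  have hsub : upTo (ENNReal.ofReal s) ⊆ upTo u := fun x hx => ⟨hx.1, hx.2.trans hu⟩
  have : ∫ x in upTo u, E.marginalA p x = ∫ x in upTo (ENNReal.ofReal s), E.marginalA p x := by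
    refine (setIntegral_eq_of_subset_of_forall_sdiff_eq_zero (measurableSet_upTo u) hsub
      fun x hx => ?_)
    have hx' : ENNReal.ofReal s ≤ ENNReal.ofReal x := le_of_not_ge fun h' => hx.2 ⟨hx.1.1, h'⟩
    have hP : noStop p x = 0 := by rw [noStop, cdf_eq_one h hx', sub_self]
    rw [marginalA, hP]; ring
  rw [hc, hc, this]

/-- The agent does not fake once the principal has stopped, if his rent is positive. -/
theorem IsRent.not_charges_of_noStop_eq_zero (hR : E.IsRent p R) {s : ℝ} (h : noStop p s = 0)
    (hpos : 0 < R (ENNReal.ofReal s)) {u : ℝ≥0∞} (hu : ENNReal.ofReal s ≤ u) :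
    ¬ p.faking.Charges u := fun hc => by
  have := hR.eq_of_charges u hc
  rw [hR.eq_of_noStop_eq_zero h hu, cdf_eq_one h hu, sub_self, mul_zero, zero_mul] at this
  exact hpos.ne this

/-- The first time at which the principal has stopped for sure. -/
theorem exists_last_time (h0 : noStop p 0 = 1) (hT0 : 0 ≤ T) (hPT : noStop p T = 0) :
    ∃ T', 0 < T' ∧ T' ≤ T ∧ noStop p T' = 0 ∧ ∀ t, t < T' → 0 ≤ t → 0 < noStop p t := by
  set Z : Set ℝ := {t | 0 ≤ t ∧ noStop p t ≤ 0}
  have hne : Z.Nonempty := ⟨T, hT0, hPT.le⟩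
  have hbdd : BddBelow Z := ⟨0, fun t ht => ht.1⟩
  have hz : noStop p (sInf Z) ≤ 0 := ContinuousWithinAt.closure_le (csInf_mem_closure hne hbdd)
    ((continuousWithinAt_noStop _).mono fun t ht => csInf_le hbdd ht)
    (continuousWithinAt_const (b := (0 : ℝ))) fun t ht => ht.2
  have hz' := le_antisymm hz (noStop_nonneg _)
  refine ⟨sInf Z, lt_of_le_of_ne (le_csInf hne fun t ht => ht.1) fun h' => ?_,
    csInf_le hbdd ⟨hT0, hPT.le⟩, hz', fun t ht ht0 => not_le.1 fun h' =>
      ht.not_ge (csInf_le hbdd ⟨ht0, h'⟩)⟩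
  rw [← h', h0] at hz'
  exact one_ne_zero hz'

/-- If the agent strictly prefers not to fake before `d`, then the principal does not stop
before `d`. -/
theorem IsEquilibrium.noStop_eq_of_lt (h : E.IsEquilibrium σ p) (hσ : 0 ≤ σ) (hσ1 : σ < 1)
    (hT : E.haz T = E.phiP) (hR : E.IsRent p R) (h0 : noStop p 0 = 1) {d : ℝ} (hdT : d ≤ T)
    (hlt : ∀ x, 0 ≤ x → x < d → E.dsurv x * noStop p x < R (ENNReal.ofReal x)) {t : ℝ}
    (ht : 0 ≤ t) (htd : t < d) : noStop p t = 1 := by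
  rw [← h0]
  refine le_antisymm (noStop_antitone ht) (not_lt.1 fun h' => ?_)
  obtain ⟨u, hu1, hu2, hu⟩ := p.stopping.exists_charges_of_cdf_lt (noStop_lt_iff.1 h')
  have hud : u < ENNReal.ofReal d :=
    hu2.trans_lt ((ENNReal.ofReal_lt_ofReal_iff_of_nonneg ht).2 htd)
  refine h.not_charges_of_marginalP_pos hσ hσ1 hud (fun x hx0 hx1 hx2 => ?_) hu
  have hxd := (ENNReal.ofReal_lt_ofReal_iff_of_nonneg hx0).1 hx2
  exact h.marginalP_pos hσ hσ1 hT hx0 (hxd.trans_le hdT) (hR.not_charges hx0 (hlt x hx0 hxd))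

/-- If the principal does not stop before `d`, the rent at `d` is at least the discount factor. -/
theorem IsRent.dsurv_le_of_noStop_eq_one (hR : E.IsRent p R) {d : ℝ} (hd : 0 < d)
    (h1 : ∀ t, 0 ≤ t → t < d → noStop p t = 1)
    (hle : ∀ t, 0 ≤ t → t < d → E.dsurv t * noStop p t ≤ R (ENNReal.ofReal t)) :
    E.dsurv d ≤ R (ENNReal.ofReal d) := by
  have hmem : d ∈ closure (Ico 0 d) := by
    rw [closure_Ico hd.ne]; exact ⟨hd.le, le_rfl⟩
  refine ContinuousWithinAt.closure_le hmem E.continuous_dsurv.continuousWithinAt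
    hR.continuous.continuousWithinAt fun t ht => ?_
  have := hle t ht.1 ht.2
  rwa [h1 t ht.1 ht.2, mul_one] at this

/-- The first time at which the agent is willing to fake. -/
theorem IsEquilibrium.exists_first_time (h : E.IsEquilibrium σ p) (hA2 : E.A2) (hσ : 0 ≤ σ)
    (hσ1 : σ < 1) (hT : E.haz T = E.phiP) (hR : E.IsRent p R) (h0 : noStop p 0 = 1) {T' : ℝ}
    (hT'0 : 0 < T') (hT'T : T' ≤ T) (hPT' : noStop p T' = 0) :
    ∃ t₀, 0 ≤ t₀ ∧ t₀ < T' ∧ noStop p t₀ = 1 ∧ R (ENNReal.ofReal t₀) = E.dsurv t₀ ∧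
      ∀ x, 0 ≤ x → x < t₀ → E.dsurv x * noStop p x < R (ENNReal.ofReal x) := by
  have hle := fun t (ht : 0 ≤ t) => h.dsurv_mul_noStop_le hA2 hσ hσ1 hR ht
  set Z : Set ℝ := {t | (0 ≤ t ∧ t < T') ∧ R (ENNReal.ofReal t) ≤ E.dsurv t * noStop p t} with hZ
  -- Otherwise faking is optimal nowhere: before T' since R > D P, afterwards since a fake earns
  -- nothing while the rent is still positive. But the faking law charges some time.
  have hne : Z.Nonempty := by
    by_contra hem
    have hlt : ∀ x, 0 ≤ x → x < T' → E.dsurv x * noStop p x < R (ENNReal.ofReal x) :=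
      fun x hx0 hx => not_le.1 fun h' => hem ⟨x, ⟨hx0, hx⟩, h'⟩
    have h1 := fun t ht htd => h.noStop_eq_of_lt (t := t) hσ hσ1 hT hR h0 hT'T hlt ht htd
    have hpos : 0 < R (ENNReal.ofReal T') := (E.dsurv_pos T').trans_le
      (hR.dsurv_le_of_noStop_eq_one hT'0 h1 fun t ht _ => hle t ht)
    obtain ⟨u, hu⟩ := p.faking.exists_charges
    rcases le_or_gt (ENNReal.ofReal T') u with hu' | hu'
    · exact hR.not_charges_of_noStop_eq_zero hPT' hpos hu' hu
    · rw [← ENNReal.ofReal_toReal (hu'.trans_le le_top).ne] at hu hu'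
      exact hR.not_charges ENNReal.toReal_nonneg (hlt _ ENNReal.toReal_nonneg
        ((ENNReal.ofReal_lt_ofReal_iff_of_nonneg ENNReal.toReal_nonneg).1 hu')) hu
  have hbdd : BddBelow Z := ⟨0, fun t ht => ht.1.1⟩
  set t₀ := sInf Z with ht₀
  have h00 : 0 ≤ t₀ := le_csInf hne fun t ht => ht.1.1
  have h0T : t₀ < T' := by
    obtain ⟨t, ht⟩ := hne
    exact (csInf_le hbdd ht).trans_lt ht.1.2
  have hRt : R (ENNReal.ofReal t₀) ≤ E.dsurv t₀ * noStop p t₀ :=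
    ContinuousWithinAt.closure_le (csInf_mem_closure hne hbdd) hR.continuous.continuousWithinAt
      ((E.continuous_dsurv.continuousWithinAt.mul (continuousWithinAt_noStop t₀)).mono
        fun t ht => csInf_le hbdd ht) fun s hs => hs.2
  have hlt : ∀ x, 0 ≤ x → x < t₀ → E.dsurv x * noStop p x < R (ENNReal.ofReal x) :=
    fun x hx0 hx => not_le.1 fun h' => hx.not_ge (csInf_le hbdd ⟨⟨hx0, hx.trans h0T⟩, h'⟩)
  -- P = 1 just before `t₀` gives D ≤ R ≤ D P at `t₀`, which excludes a stopping atom there.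
  have hP1 : noStop p t₀ = 1 := by
    rcases h00.eq_or_lt with h' | h'
    · rw [← h', h0]
    · have h1 := fun t ht htd =>
        h.noStop_eq_of_lt (t := t) hσ hσ1 hT hR h0 (h0T.le.trans hT'T) hlt ht htd
      have h2 := (hR.dsurv_le_of_noStop_eq_one h' h1 fun t ht _ => hle t ht).trans hRt
      refine le_antisymm (noStop_le_one _) ?_
      exact (le_mul_iff_one_le_right (E.dsurv_pos t₀)).1 h2
  refine ⟨t₀, h00, h0T, hP1, le_antisymm ?_ ?_, hlt⟩
  · rwa [hP1, mul_one] at hRt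
  · have := hle t₀ h00
    rwa [hP1, mul_one] at this

theorem dsurv_eq_mul_exp {a t : ℝ} (hat : a ≤ t) :
    E.dsurv t = E.dsurv a * Real.exp (-∫ s in a..t, (E.ρ + E.haz s)) := by
  refine eq_mul_exp_of_integral_eq (k := fun s => E.ρ + E.haz s) (b := t) (continuous_const.add E.continuous_haz)
    E.continuous_dsurv.continuousOn (fun x _ => ?_) t ⟨hat, le_rfl⟩
  have := E.integral_deriv_dsurv_interval a x
  rw [intervalIntegral.integral_congr fun s _ => mul_comm (E.ρ + E.haz s) (E.dsurv s), this]
  ring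

/-- While the agent is willing to fake, the principal stops at the rate `stopRate`. -/
theorem IsEquilibrium.rent_eq (h : E.IsEquilibrium σ p) (hA2 : E.A2) (hσ : 0 ≤ σ)
    (hσ1 : σ < 1) (hT : E.haz T = E.phiP) (hR : E.IsRent p R) {t₀ T' : ℝ} (h00 : 0 ≤ t₀)
    (hT'T : T' ≤ T) (hP : ∀ t, t < T' → 0 ≤ t → 0 < noStop p t)
    (hRt₀ : R (ENNReal.ofReal t₀) = E.dsurv t₀ * noStop p t₀) :
    (∀ t ∈ Icc t₀ T', R (ENNReal.ofReal t) = R (ENNReal.ofReal t₀) *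
      Real.exp (-∫ s in t₀..t, (E.stopRate s + (E.ρ + E.haz s)))) ∧
    ∀ t ∈ Ico t₀ T', noStop p t = noStop p t₀ * Real.exp (-∫ s in t₀..t, E.stopRate s) := by
  have heq : ∀ t ∈ Ico t₀ T', R (ENNReal.ofReal t) = E.dsurv t * noStop p t := fun t ht =>
    le_antisymm (h.rent_le_of_rent_le hA2 hσ hσ1 hT hR h00 ht.1 (ht.2.trans_le hT'T)
      (hP t ht.2 (h00.trans ht.1)) hRt₀.le)
      (h.dsurv_mul_noStop_le hA2 hσ hσ1 hR (h00.trans ht.1))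
  have hode : ∀ t ∈ Icc t₀ T', R (ENNReal.ofReal t) = R (ENNReal.ofReal t₀) *
      Real.exp (-∫ s in t₀..t, (E.stopRate s + (E.ρ + E.haz s))) := by
    refine eq_mul_exp_of_integral_eq (y := fun t => R (ENNReal.ofReal t))
      (continuous_stopRate.add (continuous_const.add E.continuous_haz))
      hR.continuous.continuousOn fun t ht => ?_
    have := h.rent_sub hA2 hσ hσ1 hR h00 ht.1
    -- R = D P is known only before T', where P may jump to zero; half-open intervals avoid that
    -- endpoint.
    have h2 : ∫ x in t₀..t, (E.stopRate x + (E.ρ + E.haz x)) * (E.dsurv x * noStop p x) =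
        ∫ x in t₀..t, (E.stopRate x + (E.ρ + E.haz x)) * R (ENNReal.ofReal x) := by
      rw [intervalIntegral.integral_of_le ht.1, intervalIntegral.integral_of_le ht.1,
        ← integral_Ico_eq_integral_Ioc, ← integral_Ico_eq_integral_Ioc]
      refine setIntegral_congr_fun measurableSet_Ico fun x hx => ?_
      simp only [heq x ⟨hx.1, hx.2.trans_le ht.2⟩]
    rw [h2] at this
    linarith
  refine ⟨hode, fun t ht => ?_⟩
  have h1 := hode t ⟨ht.1, ht.2.le⟩
  have hadd : ∫ s in t₀..t, (E.stopRate s + (E.ρ + E.haz s)) =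
      (∫ s in t₀..t, E.stopRate s) + ∫ s in t₀..t, (E.ρ + E.haz s) :=
    intervalIntegral.integral_add (continuous_stopRate.intervalIntegrable _ _)
      ((continuous_const.add E.continuous_haz).intervalIntegrable _ _)
  rw [heq t ht, hRt₀, dsurv_eq_mul_exp ht.1, hadd, neg_add, Real.exp_add] at h1
  have h3 : (E.dsurv t₀ * Real.exp (-∫ s in t₀..t, (E.ρ + E.haz s))) ≠ 0 :=
    (mul_pos (E.dsurv_pos t₀) (Real.exp_pos _)).ne'
  refine mul_left_cancel₀ h3 ?_
  rw [h1]; ring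

/-- The faking hazard that keeps the principal indifferent about the time of stopping. -/
def fakeRate (E : Environment) (s : ℝ) : ℝ :=
  (E.μ * (1 - E.θ) * E.haz s - E.ρ * E.θ) / (E.θ - E.μ)

theorem continuous_fakeRate : Continuous E.fakeRate :=
  ((continuous_const.mul E.continuous_haz).sub continuous_const).div_const _

theorem fakeRate_pos {s : ℝ} (h : E.phiP < E.haz s) : 0 < E.fakeRate s :=
  div_pos (sub_pos.2 (phiP_lt_iff.1 h)) (sub_pos.2 E.μ_lt_θ)

/-- The profile in which nothing happens before `t₀`, the agent fakes and the principal stops at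
the rates `fakeRate` and `stopRate` between `t₀` and `T`, and the principal stops for sure at `T`;
type-1 news is always believed. -/
structure IsSearchFrom (E : Environment) (σ : ℝ) (p : Profile) (T t₀ : ℝ) : Prop where
  pos : 0 < t₀
  lt : t₀ < T
  noStop_before : ∀ t ∈ Icc 0 t₀, noStop p t = 1
  noStop_between : ∀ t ∈ Ico t₀ T, noStop p t = Real.exp (-∫ s in t₀..t, E.stopRate s)
  noStop_after : ∀ t, T ≤ t → noStop p t = 0
  noFake_before : ∀ t ∈ Icc 0 t₀, noFake σ p t = 1
  noFake_between : ∀ t ∈ Icc t₀ T, noFake σ p t = Real.exp (-∫ s in t₀..t, E.fakeRate s)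
  noFake_after : ∀ t, T ≤ t → noFake σ p t = 1 - σ
  response : ∀ t, 0 ≤ t → p.response t = 1

end Environment

/-! ### Every beneficial equilibrium is a two-phase search profile -/

namespace Environment

variable {E : Environment} {σ : ℝ} {p : Profile} {R : ℝ≥0∞ → ℝ} {T : ℝ}

theorem IsEquilibrium.payoffP_eq (h : E.IsEquilibrium σ p) (hσ : 0 ≤ σ) (hσ1 : σ < 1) {u : ℝ≥0∞}
    (hu : p.stopping.Charges u) : E.payoffP σ p = E.θ + E.gainP σ p u := by
  refine p.stopping.expect_eq fun t ht => ?_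
  rw [h.optimalResponse.uP_eq hσ hσ1]
  exact congrArg _ (le_antisymm (h.gainP_le hσ hσ1 hu t) (h.gainP_le hσ hσ1 ht u))

theorem gainP_zero : E.gainP σ p (ENNReal.ofReal 0) = 0 := by
  rw [gainP, integral_upTo_ofReal _ le_rfl, intervalIntegral.integral_same]

theorem IsEquilibrium.continuous_gainP (h : E.IsEquilibrium σ p) (hσ : 0 ≤ σ) (hσ1 : σ < 1) :
    Continuous fun t : ℝ => E.gainP σ p (ENNReal.ofReal t) :=
  continuous_integral_upTo (h.optimalResponse.integrableOn_marginalP hσ hσ1)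

/-- A stopping atom at 0 would make immediate stopping optimal, and the payoff would be θ. -/
theorem IsEquilibrium.noStop_zero (h : E.IsEquilibrium σ p) (hσ : 0 ≤ σ) (hσ1 : σ < 1)
    (hben : E.Beneficial σ p) : noStop p 0 = 1 := by
  rcases (p.stopping.cdf_nonneg (ENNReal.ofReal 0)).eq_or_lt with h0 | h0
  · rw [noStop, ← h0, sub_zero]
  · obtain ⟨u, hu, huc⟩ := p.stopping.exists_charges_of_cdf_pos h0
    have hu0 : u = ENNReal.ofReal 0 := by
      rw [ENNReal.ofReal_zero] at hu ⊢
      exact le_antisymm hu bot_le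
    have := h.payoffP_eq hσ hσ1 huc
    rw [hu0, gainP_zero, add_zero] at this
    exact absurd this (ne_of_gt hben)

/-- Wherever the survival function of the stopping time strictly decreases, the principal is
indifferent. -/
theorem IsEquilibrium.gainP_eq_of_strictAnti (h : E.IsEquilibrium σ p) (hσ : 0 ≤ σ) (hσ1 : σ < 1)
    {a b : ℝ} (ha : 0 ≤ a) (hab : a < b) (hanti : StrictAntiOn (noStop p) (Ico a b)) {u : ℝ≥0∞}
    (hu : p.stopping.Charges u) :
    ∀ t ∈ Icc a b, E.gainP σ p (ENNReal.ofReal t) = E.gainP σ p u := by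
  have hcl : IsClosed {t : ℝ | E.gainP σ p (ENNReal.ofReal t) = E.gainP σ p u} :=
    isClosed_eq (h.continuous_gainP hσ hσ1) continuous_const
  have hIco : Ico a b ⊆ {t : ℝ | E.gainP σ p (ENNReal.ofReal t) = E.gainP σ p u} := by
    intro x hx
    -- Charged times accumulate at every point where P strictly decreases; all yield the same
    -- optimal gain, and the gain is continuous.
    refine hcl.closure_subset (Metric.mem_closure_iff.2 fun ε hε => ?_)
    obtain ⟨y, hxy, hy⟩ := exists_between (lt_min hx.2 (lt_add_of_pos_right x hε))
    have hyb := hy.trans_le (min_le_left _ _)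
    have hyε := hy.trans_le (min_le_right _ _)
    have hx0 : 0 ≤ x := ha.trans hx.1
    obtain ⟨v, hv1, hv2, hv⟩ := p.stopping.exists_charges_of_cdf_lt
      (noStop_lt_iff.1 (hanti hx ⟨hx.1.trans hxy.le, hyb⟩ hxy))
    have hvt : v ≠ ∞ := (hv2.trans_lt ENNReal.ofReal_lt_top).ne
    have hve := ENNReal.ofReal_toReal hvt
    rw [← hve] at hv1 hv2
    have h1 := (ENNReal.ofReal_lt_ofReal_iff_of_nonneg hx0).1 hv1
    have h2 := (ENNReal.ofReal_le_ofReal_iff (hx0.trans hxy.le)).1 hv2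
    refine ⟨v.toReal, ?_, ?_⟩
    · change E.gainP σ p (ENNReal.ofReal v.toReal) = _
      rw [hve]
      exact le_antisymm (h.gainP_le hσ hσ1 hu v) (h.gainP_le hσ hσ1 hv u)
    · rw [dist_comm, Real.dist_eq, abs_of_pos (sub_pos.2 h1)]
      linarith
  have := hcl.closure_subset_iff.2 hIco
  rwa [closure_Ico hab.ne] at this

/-- Where the principal is indifferent, the agent fakes at the rate `fakeRate`. -/
theorem IsEquilibrium.density_eq (h : E.IsEquilibrium σ p) (hσ : 0 ≤ σ) (hσ1 : σ < 1)
    {a b : ℝ} (ha : 0 ≤ a) (hab : a < b)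
    (hc : ∀ t ∈ Icc a b, E.gainP σ p (ENNReal.ofReal t) = E.gainP σ p (ENNReal.ofReal a)) :
    ∀ᵐ x, x ∈ Ioo a b → σ * p.faking.density x = E.fakeRate x * noFake σ p x := by
  have hint := h.optimalResponse.integrableOn_marginalP hσ hσ1
  -- Lebesgue differentiation: a constant cumulative gain forces the marginal value to vanish almost
  -- everywhere.
  have hae := (intervalIntegrable_of_integrableOn_Ici hint ha
    (ha.trans hab.le)).ae_hasDerivAt_integral
  filter_upwards [hae] with x hx hxab
  rw [uIcc_of_le hab.le] at hx
  have hd := hx ⟨hxab.1.le, hxab.2.le⟩ a ⟨le_rfl, hab.le⟩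
  have hzero : (fun y => ∫ t in a..y, E.marginalP σ p t) =ᶠ[𝓝 x] fun _ => 0 := by
    filter_upwards [Ioo_mem_nhds hxab.1 hxab.2] with y hy
    rw [← integral_upTo_sub hint ha (ha.trans hy.1.le), sub_eq_zero]
    exact hc y ⟨hy.1.le, hy.2.le⟩
  have hm : E.marginalP σ p x = 0 := hd.unique ((hasDerivAt_const x (0 : ℝ)).congr_of_eventuallyEq hzero)
  have hx0 : 0 ≤ x := ha.trans hxab.1.le
  have hN := noFake_pos (p := p) hσ hσ1 x
  have hρ := mul_pos (mul_pos E.ρ_pos E.θ_pos) hN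
  rw [marginalP, h.optimalResponse.newsValue_eq hx0] at hm
  have hm' := (mul_eq_zero.1 hm).resolve_left (E.dsurv_pos x).ne'
  -- A belief of at most θ would leave the marginal value negative. So news has positive surplus,
  -- and zero marginal value is a linear equation for the faking density.
  rcases le_or_gt (E.belief σ p x) E.θ with hb | hb
  · rw [max_eq_left hb, sub_self, mul_zero] at hm'
    linarith
  · have hat : ¬ 0 < p.faking.atom (ENNReal.ofReal x) := fun h' => by
      rw [E.belief_of_atom h'] at hb
      exact hb.not_gt E.μ_lt_θ
    rw [max_eq_right hb.le, weight_mul_belief_sub hσ hσ1 hx0 hat] at hm'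
    rw [fakeRate, div_mul_eq_mul_div, eq_div_iff (sub_pos.2 E.μ_lt_θ).ne']
    linarith

theorem IsEquilibrium.exists_isSearchFrom (h : E.IsEquilibrium σ p) (hA2 : E.A2) (hσ : 0 < σ)
    (hσ1 : σ < 1) (hT0 : 0 ≤ T) (hT : E.haz T = E.phiP) (hben : E.Beneficial σ p) :
    ∃ t₀, E.IsSearchFrom σ p T t₀ ∧ E.payoffP σ p = E.θ + ∫ s in (0 : ℝ)..t₀, E.marginal s := by
  have h0 := h.noStop_zero hσ.le hσ1 hben
  obtain ⟨R, hR⟩ := h.exists_isRent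
  obtain ⟨T', hT'0, hT'T, hPT', hPpos⟩ :=
    exists_last_time h0 hT0 (h.noStop_eq_zero hσ.le hσ1 hT0 hT)
  obtain ⟨t₀, h00, h0T', hP₀, hR₀, hlt⟩ :=
    h.exists_first_time hA2 hσ.le hσ1 hT hR h0 hT'0 hT'T hPT'
  have h0T : t₀ < T := h0T'.trans_le hT'T
  obtain ⟨hRt, hPt⟩ := h.rent_eq hA2 hσ.le hσ1 hT hR h00 hT'T hPpos (by rw [hR₀, hP₀, mul_one])
  have hRT' : 0 < R (ENNReal.ofReal T') := by
    rw [hRt T' ⟨h0T'.le, le_rfl⟩, hR₀]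
    exact mul_pos (E.dsurv_pos _) (Real.exp_pos _)
  have hPb : ∀ t ∈ Icc 0 t₀, noStop p t = 1 := fun t ht => by
    rcases ht.2.eq_or_lt with h' | h'
    · rw [h', hP₀]
    · exact h.noStop_eq_of_lt hσ.le hσ1 hT hR h0 h0T.le hlt ht.1 h'
  have hanti : StrictAntiOn (noStop p) (Ico t₀ T') := by
    intro x hx y hy hxy
    rw [hPt x hx, hPt y hy, hP₀, one_mul, one_mul, Real.exp_lt_exp, neg_lt_neg_iff,
      ← sub_pos, intervalIntegral.integral_interval_sub_left
        (continuous_stopRate.intervalIntegrable _ _) (continuous_stopRate.intervalIntegrable _ _)]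
    exact intervalIntegral.intervalIntegral_pos_of_pos_on
      (continuous_stopRate.intervalIntegrable _ _) (fun z hz => stopRate_pos (hA2.trans
        (phiP_lt_haz hT (h00.trans (hx.1.trans hz.1.le)) (hz.2.trans (hy.2.trans_le hT'T))))) hxy
  obtain ⟨u, hu⟩ := p.stopping.exists_charges
  have hgain := h.gainP_eq_of_strictAnti hσ.le hσ1 h00 h0T' hanti hu
  have hpay := h.payoffP_eq hσ.le hσ1 hu
  -- If `t₀ = 0`, indifference on the second phase includes stopping at once, and the payoff would
  -- be θ.
  have hpos : 0 < t₀ := by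
    refine lt_of_le_of_ne h00 fun h' => ?_
    have := hgain t₀ ⟨le_rfl, h0T'.le⟩
    rw [← h', gainP_zero] at this
    rw [← this, add_zero] at hpay
    exact (ne_of_gt hben) hpay
  have hnc : ∀ v, ENNReal.ofReal T' ≤ v → ¬ p.faking.Charges v := fun v hv =>
    hR.not_charges_of_noStop_eq_zero hPT' hRT' hv
  -- Were T' < T, the absence of fakes after T' would make waiting on until T strictly profitable.
  obtain rfl : T' = T := by
    by_contra hne
    have hlt' := lt_of_le_of_ne hT'T hne
    have h1 := integral_upTo_gt (h.optimalResponse.integrableOn_marginalP hσ.le hσ1)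
      ((ENNReal.ofReal_lt_ofReal_iff_of_nonneg hT'0.le).2 hlt') fun x hx0 hx1 hx2 =>
        h.marginalP_pos hσ.le hσ1 hT hx0 ((ENNReal.ofReal_lt_ofReal_iff_of_nonneg hx0).1 hx2)
          (hnc _ hx1.le)
    have h2 := h.gainP_le hσ.le hσ1 hu (ENNReal.ofReal T)
    rw [← hgain T' ⟨h0T'.le, le_rfl⟩] at h2
    exact h2.not_gt h1
  have hresp : ∀ t, 0 ≤ t → p.response t = 1 := fun t ht => by
    rcases lt_or_ge t T' with h' | h'
    · exact h.response_eq_one hA2 hσ.le hσ1 ht (hPpos t h' ht)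
    · refine h.response_one t ht ?_
      rw [E.belief_of_not_charges hσ.le hσ1 ht (hnc _ (ENNReal.ofReal_le_ofReal h'))]
      exact E.θ_lt_one
  -- An atom lowers the belief to μ < θ, so the response would be zero, although it is one at all
  -- times.
  have hatom : ∀ v, v ≠ ∞ → p.faking.atom v = 0 := fun v hv => by
    refine le_antisymm (not_lt.1 fun h' => ?_) (p.faking.atom_nonneg v)
    have hb : E.belief σ p v.toReal = E.μ :=
      E.belief_of_atom (by rwa [ENNReal.ofReal_toReal hv])
    have := h.response_zero v.toReal ENNReal.toReal_nonneg (hb ▸ E.μ_lt_θ)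
    rw [hresp _ ENNReal.toReal_nonneg] at this
    exact one_ne_zero this
  have hcdf : ∀ t, 0 ≤ t → p.faking.cdf (ENNReal.ofReal t) =
      ∫ s in (0 : ℝ)..t, p.faking.density s := fun t ht => by
    have h1 : ∀ m, (Iic (ENNReal.ofReal t)).indicator p.faking.atom m = 0 := fun m => by
      by_cases hm : m ≤ ENNReal.ofReal t
      · simp [indicator, hm, hatom m (hm.trans_lt ENNReal.ofReal_lt_top).ne]
      · simp [indicator, hm]
    rw [MixedTime.cdf, integral_upTo_ofReal _ ht, tsum_congr h1, tsum_zero, add_zero]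
  have hdens : ∀ t, 0 ≤ t → t < t₀ → p.faking.density t = 0 := fun t ht htt =>
    le_antisymm (not_lt.1 fun h' => hR.not_charges ht (hlt t ht htt)
      (Or.inr ⟨ENNReal.ofReal_ne_top, by rwa [ENNReal.toReal_ofReal ht]⟩)) (p.faking.density_nonneg t)
  have hNb : ∀ t ∈ Icc 0 t₀, noFake σ p t = 1 := fun t ht => by
    have : ∫ s in (0 : ℝ)..t, p.faking.density s = ∫ s in (0 : ℝ)..t, (0 : ℝ) := by
      rw [intervalIntegral.integral_of_le ht.1, intervalIntegral.integral_of_le ht.1,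
        ← integral_Ico_eq_integral_Ioc, ← integral_Ico_eq_integral_Ioc]
      exact setIntegral_congr_fun measurableSet_Ico fun s hs => hdens s hs.1 (hs.2.trans_le ht.2)
    rw [noFake, hcdf t ht.1, this, intervalIntegral.integral_zero, mul_zero, sub_zero]
  have hdint : ∀ a b : ℝ, 0 ≤ a → 0 ≤ b → IntervalIntegrable p.faking.density volume a b :=
    fun a b => intervalIntegrable_of_integrableOn_Ici p.faking.density_integrable
  have hae := h.density_eq hσ.le hσ1 h00 h0T' fun t ht =>
    (hgain t ht).trans (hgain t₀ ⟨le_rfl, h0T'.le⟩).symm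
  -- The density formula is an integral equation for N with rate `fakeRate`; its solution is the
  -- exponential.
  have hNode : ∀ t ∈ Icc t₀ T', noFake σ p t =
      noFake σ p t₀ - ∫ s in t₀..t, E.fakeRate s * noFake σ p s := fun t ht => by
    have h1 : ∫ s in t₀..t, E.fakeRate s * noFake σ p s =
        ∫ s in t₀..t, σ * p.faking.density s := by
      rw [intervalIntegral.integral_of_le ht.1, intervalIntegral.integral_of_le ht.1,
        integral_Ioc_eq_integral_Ioo, integral_Ioc_eq_integral_Ioo]
      refine setIntegral_congr_ae measurableSet_Ioo ?_
      filter_upwards [hae] with x hx hxt using (hx ⟨hxt.1, hxt.2.trans_le ht.2⟩).symm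
    rw [h1, intervalIntegral.integral_const_mul, noFake, noFake, hcdf t (h00.trans ht.1),
      hcdf t₀ h00, ← intervalIntegral.integral_interval_sub_left
        (hdint 0 t le_rfl (h00.trans ht.1)) (hdint 0 t₀ le_rfl h00)]
    ring
  have hNcont : ContinuousOn (noFake σ p) (Icc t₀ T') := by
    have hc := continuous_integral_upTo p.faking.density_integrable
    refine ((continuous_const (y := (1 : ℝ))).sub
      ((continuous_const (y := σ)).mul hc)).continuousOn.congr fun t ht => ?_
    simp only [noFake, Pi.sub_apply, Pi.mul_apply]
    rw [hcdf t (h00.trans ht.1), integral_upTo_ofReal _ (h00.trans ht.1)]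
  refine ⟨t₀, ⟨hpos, h0T', hPb, fun t ht => ?_, fun t ht => ?_, hNb, fun t ht => ?_,
    fun t ht => ?_, hresp⟩, ?_⟩
  · rw [hPt t ht, hP₀, one_mul]
  · rw [noStop, cdf_eq_one hPT' (ENNReal.ofReal_le_ofReal ht), sub_self]
  · have := eq_mul_exp_of_integral_eq continuous_fakeRate hNcont hNode t ht
    rwa [hNb t₀ ⟨h00, le_rfl⟩, one_mul] at this
  · have hc1 : p.faking.cdf (ENNReal.ofReal t) = 1 := by
      refine le_antisymm (p.faking.cdf_le_one _) (not_lt.1 fun h' => ?_)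
      rw [← p.faking.cdf_top] at h'
      obtain ⟨v, hv1, -, hv⟩ := p.faking.exists_charges_of_cdf_lt h'
      exact hnc v ((ENNReal.ofReal_le_ofReal ht).trans hv1.le) hv
    rw [noFake, hc1, mul_one]
  · rw [hpay, ← hgain t₀ ⟨le_rfl, h0T'.le⟩, gainP, integral_upTo_ofReal _ h00]
    congr 1
    rw [intervalIntegral.integral_of_le h00, intervalIntegral.integral_of_le h00,
      ← integral_Ico_eq_integral_Ioc, ← integral_Ico_eq_integral_Ioc]
    refine setIntegral_congr_fun measurableSet_Ico fun s hs => ?_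
    rw [h.optimalResponse.marginalP_of_not_charges hσ.le hσ1 hs.1
      (hR.not_charges hs.1 (hlt s hs.1 hs.2)), hNb s ⟨hs.1, hs.2.le⟩, one_mul]

end Environment

/-! ### Random times with a prescribed hazard rate -/

theorem integral_mul_exp_neg {k : ℝ → ℝ} (hk : Continuous k) (a t : ℝ) :
    ∫ s in a..t, k s * Real.exp (-∫ x in a..s, k x) = 1 - Real.exp (-∫ x in a..t, k x) := by
  have hd : ∀ x, HasDerivAt (fun s => -Real.exp (-∫ x in a..s, k x))
      (k x * Real.exp (-∫ y in a..x, k y)) x := fun x => by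
    convert! (hk.integral_hasStrictDerivAt a x).hasDerivAt.neg.exp.neg using 1
    simp only [Pi.neg_apply]
    ring
  have hc : Continuous fun s => k s * Real.exp (-∫ x in a..s, k x) :=
    hk.mul (Real.continuous_exp.comp
      (intervalIntegral.continuous_primitive (fun _ _ => hk.intervalIntegrable _ _) a).neg)
  rw [intervalIntegral.integral_eq_sub_of_hasDerivAt (fun x _ => hd x) (hc.intervalIntegrable _ _)]
  simp
  ring

/-- The time with density `c⁻¹ k s exp (- ∫ k)` between `t₀` and `T`, and the remaining mass
at `T`. -/
def MixedTime.ofRate {k : ℝ → ℝ} (hk : Continuous k) {t₀ T c : ℝ} (h0 : 0 ≤ t₀) (hT : t₀ ≤ T)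
    (hk0 : ∀ s ∈ Ico t₀ T, 0 ≤ k s) (hc : 0 < c)
    (hc1 : 1 - Real.exp (-∫ x in t₀..T, k x) ≤ c) : MixedTime where
  density := (Ico t₀ T).indicator fun s => c⁻¹ * (k s * Real.exp (-∫ x in t₀..s, k x))
  atom := Pi.single (ENNReal.ofReal T) (1 - c⁻¹ * (1 - Real.exp (-∫ x in t₀..T, k x)))
  density_meas := Measurable.indicator (Continuous.measurable (continuous_const.mul
    (hk.mul (Real.continuous_exp.comp (intervalIntegral.continuous_primitive
      (fun _ _ => hk.intervalIntegrable _ _) t₀).neg)))) measurableSet_Ico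
  density_nonneg := indicator_nonneg fun s hs =>
    mul_nonneg (inv_nonneg.2 hc.le) (mul_nonneg (hk0 s hs) (Real.exp_pos _).le)
  density_integrable := by
    have : Continuous fun s => c⁻¹ * (k s * Real.exp (-∫ x in t₀..s, k x)) :=
      continuous_const.mul (hk.mul (Real.continuous_exp.comp (intervalIntegral.continuous_primitive
        (fun _ _ => hk.intervalIntegrable _ _) t₀).neg))
    exact ((this.integrableOn_Icc.mono_set Ico_subset_Icc_self).integrable_indicator
      measurableSet_Ico).integrableOn
  atom_nonneg := by
    have : 0 ≤ 1 - c⁻¹ * (1 - Real.exp (-∫ x in t₀..T, k x)) := by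
      rw [sub_nonneg, inv_mul_le_one₀ hc]; exact hc1
    intro t
    by_cases ht : t = ENNReal.ofReal T
    · rw [ht, Pi.single_eq_same]; exact this
    · rw [Pi.single_eq_of_ne ht]
  atom_summable := summable_of_ne_finset_zero (s := {ENNReal.ofReal T}) fun t ht =>
    Pi.single_eq_of_ne (by simpa using ht) _
  total := by
    have h1 : Ici (0 : ℝ) ∩ Ico t₀ T = Ico t₀ T :=
      inter_eq_right.2 fun x hx => h0.trans hx.1
    rw [setIntegral_indicator measurableSet_Ico, h1, integral_Ico_eq_integral_Ioc,
      ← intervalIntegral.integral_of_le hT, intervalIntegral.integral_const_mul,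
      integral_mul_exp_neg hk, tsum_pi_single]
    ring

namespace MixedTime

section ofRate

variable {k : ℝ → ℝ} (hk : Continuous k) {t₀ T c : ℝ} (h0 : 0 ≤ t₀) (hT : t₀ ≤ T)
  (hk0 : ∀ s ∈ Ico t₀ T, 0 ≤ k s) (hc : 0 < c) (hc1 : 1 - Real.exp (-∫ x in t₀..T, k x) ≤ c)

theorem density_ofRate : (ofRate hk h0 hT hk0 hc hc1).density =
    (Ico t₀ T).indicator fun s => c⁻¹ * (k s * Real.exp (-∫ x in t₀..s, k x)) := rfl

theorem cdf_ofRate {t : ℝ} (ht : t ∈ Ico t₀ T) :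
    (ofRate hk h0 hT hk0 hc hc1).cdf (ENNReal.ofReal t) =
      c⁻¹ * (1 - Real.exp (-∫ x in t₀..t, k x)) := by
  have h1 : upTo (ENNReal.ofReal t) ∩ Ico t₀ T = Icc t₀ t := by
    rw [upTo_ofReal (h0.trans ht.1)]
    ext x
    exact ⟨fun hx => ⟨hx.2.1, hx.1.2⟩, fun hx => ⟨⟨h0.trans hx.1, hx.2⟩, hx.1, hx.2.trans_lt ht.2⟩⟩
  have h2 : ∀ m, (Iic (ENNReal.ofReal t)).indicator (ofRate hk h0 hT hk0 hc hc1).atom m = 0 := by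
    intro m
    by_cases hm : m ≤ ENNReal.ofReal t
    · have hne : m ≠ ENNReal.ofReal T := (hm.trans_lt
        ((ENNReal.ofReal_lt_ofReal_iff_of_nonneg (h0.trans ht.1)).2 ht.2)).ne
      rw [indicator_of_mem (mem_Iic.2 hm)]
      exact Pi.single_eq_of_ne hne _
    · rw [indicator_of_notMem (by simpa using hm)]
  rw [cdf, tsum_congr h2, tsum_zero, add_zero, ofRate]
  simp only
  rw [setIntegral_indicator measurableSet_Ico, h1, integral_Icc_eq_integral_Ioc,
    ← intervalIntegral.integral_of_le ht.1, intervalIntegral.integral_const_mul,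
    integral_mul_exp_neg hk]

theorem cdf_ofRate_before (hT' : t₀ < T) {t : ℝ} (ht : t ≤ t₀) :
    (ofRate hk h0 hT hk0 hc hc1).cdf (ENNReal.ofReal t) = 0 := by
  refine le_antisymm ?_ (cdf_nonneg _ _)
  refine ((ofRate hk h0 hT hk0 hc hc1).cdf_mono (ENNReal.ofReal_le_ofReal ht)).trans ?_
  rw [cdf_ofRate hk h0 hT hk0 hc hc1 ⟨le_rfl, hT'⟩]
  simp

theorem charges_ofRate {u : ℝ≥0∞} (hu : (ofRate hk h0 hT hk0 hc hc1).Charges u) :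
    ENNReal.ofReal t₀ ≤ u ∧ u ≤ ENNReal.ofReal T := by
  rcases hu with hu | ⟨hut, hu⟩
  · have : u = ENNReal.ofReal T := by
      by_contra h'
      rw [ofRate] at hu
      simp only at hu
      rw [Pi.single_eq_of_ne h'] at hu
      exact lt_irrefl _ hu
    rw [this]
    exact ⟨ENNReal.ofReal_le_ofReal hT, le_rfl⟩
  · have hmem : u.toReal ∈ Ico t₀ T := by
      by_contra hm
      have : (ofRate hk h0 hT hk0 hc hc1).density u.toReal = 0 := by
        rw [density_ofRate, indicator_of_notMem hm]
      exact lt_irrefl _ (this ▸ hu)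
    rw [← ENNReal.ofReal_toReal hut]
    exact ⟨ENNReal.ofReal_le_ofReal hmem.1, ENNReal.ofReal_le_ofReal hmem.2.le⟩

theorem cdf_ofRate_after {u : ℝ≥0∞} (hu : ENNReal.ofReal T ≤ u) :
    (ofRate hk h0 hT hk0 hc hc1).cdf u = 1 := by
  refine le_antisymm (cdf_le_one _ _) (not_lt.1 fun h' => ?_)
  rw [← cdf_top (ofRate hk h0 hT hk0 hc hc1)] at h'
  obtain ⟨v, hv1, -, hv⟩ := exists_charges_of_cdf_lt _ h'
  exact (hu.trans_lt hv1).not_ge (charges_ofRate hk h0 hT hk0 hc hc1 hv).2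

end ofRate

end MixedTime

/-! ### Uniqueness of the starting time and of the profile -/

namespace Environment

variable {E : Environment} {σ : ℝ} {T : ℝ}

/-- `fakeRate` is positive before T. This monotonicity makes t₀ a strictly decreasing function of σ.
-/
theorem integral_fakeRate_lt (hT : E.haz T = E.phiP) {s t : ℝ} (hs : 0 ≤ s) (hst : s < t)
    (htT : t ≤ T) : ∫ x in t..T, E.fakeRate x < ∫ x in s..T, E.fakeRate x := by
  rw [← intervalIntegral.integral_add_adjacent_intervals
    (continuous_fakeRate.intervalIntegrable s t) (continuous_fakeRate.intervalIntegrable t T)]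
  have : 0 < ∫ x in s..t, E.fakeRate x :=
    intervalIntegral.intervalIntegral_pos_of_pos_on (continuous_fakeRate.intervalIntegrable _ _)
      (fun x hx => fakeRate_pos (phiP_lt_haz hT (hs.trans hx.1.le) (hx.2.trans_le htT))) hst
  linarith

theorem IsSearchFrom.exp_eq {p : Profile} {t₀ : ℝ} (h : E.IsSearchFrom σ p T t₀) :
    Real.exp (-∫ s in t₀..T, E.fakeRate s) = 1 - σ := by
  rw [← h.noFake_between T ⟨h.lt.le, le_rfl⟩, h.noFake_after T le_rfl]

/-- The whole faking mass is spent between the starting time and T, so σ fixes the starting time. -/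
theorem IsSearchFrom.eq {p q : Profile} {t₀ t₁ : ℝ} (hT : E.haz T = E.phiP)
    (hp : E.IsSearchFrom σ p T t₀) (hq : E.IsSearchFrom σ q T t₁) : t₀ = t₁ := by
  have h := hp.exp_eq.trans hq.exp_eq.symm
  rw [Real.exp_eq_exp, neg_inj] at h
  rcases lt_trichotomy t₀ t₁ with h' | h' | h'
  · exact absurd h (integral_fakeRate_lt hT hp.pos.le h' hq.lt.le).ne'
  · exact h'
  · exact absurd h (integral_fakeRate_lt hT hq.pos.le h' hp.lt.le).ne

theorem IsSearchFrom.same {p q : Profile} {t₀ : ℝ} (hσ : 0 < σ)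
    (hp : E.IsSearchFrom σ p T t₀) (hq : E.IsSearchFrom σ q T t₀) : p.Same q := by
  have hS : ∀ t, 0 ≤ t → noStop p t = noStop q t := fun t ht => by
    rcases le_total t t₀ with h | h
    · rw [hp.noStop_before t ⟨ht, h⟩, hq.noStop_before t ⟨ht, h⟩]
    · rcases lt_or_ge t T with h' | h'
      · rw [hp.noStop_between t ⟨h, h'⟩, hq.noStop_between t ⟨h, h'⟩]
      · rw [hp.noStop_after t h', hq.noStop_after t h']
  have hF : ∀ t, 0 ≤ t → noFake σ p t = noFake σ q t := fun t ht => by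
    rcases le_total t t₀ with h | h
    · rw [hp.noFake_before t ⟨ht, h⟩, hq.noFake_before t ⟨ht, h⟩]
    · rcases lt_or_ge t T with h' | h'
      · rw [hp.noFake_between t ⟨h, h'.le⟩, hq.noFake_between t ⟨h, h'.le⟩]
      · rw [hp.noFake_after t h', hq.noFake_after t h']
  refine ⟨funext fun u => ?_, funext fun u => ?_, fun t ht => by
    rw [hp.response t ht, hq.response t ht]⟩
  · by_cases hu : u = ∞
    · rw [hu, MixedTime.cdf_top, MixedTime.cdf_top]
    · have := hS u.toReal ENNReal.toReal_nonneg
      rw [noStop, noStop, ENNReal.ofReal_toReal hu] at this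
      linarith
  · by_cases hu : u = ∞
    · rw [hu, MixedTime.cdf_top, MixedTime.cdf_top]
    · have := hF u.toReal ENNReal.toReal_nonneg
      rw [noFake, noFake, ENNReal.ofReal_toReal hu] at this
      exact mul_left_cancel₀ hσ.ne' (by linarith)

end Environment

/-! ### Verification that the two-phase profile is an equilibrium -/

namespace Environment

variable {E : Environment} {σ : ℝ} {p : Profile} {T t₀ : ℝ}

/-- The densities and atoms of a profile as in `IsSearchFrom`, at every time. -/
structure HasSearchDensity (E : Environment) (σ : ℝ) (p : Profile) (T t₀ : ℝ) : Prop where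
  atom : ∀ u, p.faking.atom u = 0
  density : ∀ s ∈ Ico t₀ T, σ * p.faking.density s = E.fakeRate s * noFake σ p s
  density_zero : ∀ s, s ∉ Ico t₀ T → p.faking.density s = 0
  charges : ∀ u, p.stopping.Charges u → ENNReal.ofReal t₀ ≤ u ∧ u ≤ ENNReal.ofReal T

/-- During the faking phase the surplus from news is exactly ρθN > 0, the cost of delay; outside it
there are no fakes. -/
theorem HasSearchDensity.lt_belief (h : E.HasSearchDensity σ p T t₀) (hσ : 0 ≤ σ) (hσ1 : σ < 1)
    {s : ℝ} (hs : 0 ≤ s) : E.θ < E.belief σ p s := by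
  have hN := noFake_pos (p := p) hσ hσ1 s
  have hμH := mul_pos (mul_pos E.μ_pos (E.haz_pos s)) hN
  have hw := weight_mul_belief_sub (E := E) (p := p) hσ hσ1 hs (by rw [h.atom]; exact lt_irrefl _)
  have hfn := mul_nonneg hσ (p.faking.density_nonneg s)
  refine sub_pos.1 (pos_of_mul_pos_right (a := E.μ * E.haz s * noFake σ p s +
    σ * p.faking.density s) ?_ (by linarith))
  rw [hw]
  by_cases hm : s ∈ Ico t₀ T
  · rw [h.density s hm, fakeRate, ← mul_assoc, mul_div_cancel₀ _ (sub_pos.2 E.μ_lt_θ).ne']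
    have := mul_pos (mul_pos E.ρ_pos E.θ_pos) hN
    linarith
  · rw [h.density_zero s hm, mul_zero, mul_zero, sub_zero]
    have := mul_pos hμH (sub_pos.2 E.θ_lt_one)
    linarith

theorem HasSearchDensity.optimalResponse (h : E.HasSearchDensity σ p T t₀)
    (hs : E.IsSearchFrom σ p T t₀) (hσ : 0 ≤ σ) (hσ1 : σ < 1) : E.OptimalResponse σ p :=
  fun t ht => ⟨fun _ => hs.response t ht, fun hb =>
    absurd hb (h.lt_belief hσ hσ1 ht).le.not_gt⟩

theorem HasSearchDensity.marginalP_eq_zero (h : E.HasSearchDensity σ p T t₀)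
    (hs : E.IsSearchFrom σ p T t₀) (hσ : 0 ≤ σ) (hσ1 : σ < 1) {s : ℝ} (hm : s ∈ Ico t₀ T) :
    E.marginalP σ p s = 0 := by
  have hs0 := hs.pos.le.trans hm.1
  rw [marginalP, (h.optimalResponse hs hσ hσ1).newsValue_eq hs0,
    max_eq_right (h.lt_belief hσ hσ1 hs0).le,
    weight_mul_belief_sub hσ hσ1 hs0 (by rw [h.atom]; exact lt_irrefl _), h.density s hm, fakeRate,
    ← mul_assoc (E.θ - E.μ), mul_div_cancel₀ _ (sub_pos.2 E.μ_lt_θ).ne']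
  ring

theorem HasSearchDensity.not_charges (h : E.HasSearchDensity σ p T t₀) {u : ℝ≥0∞}
    (hm : u.toReal ∉ Ico t₀ T) : ¬ p.faking.Charges u := by
  rintro (h' | ⟨-, h'⟩)
  · exact lt_irrefl _ (h.atom u ▸ h')
  · exact lt_irrefl _ (h.density_zero _ hm ▸ h')

theorem HasSearchDensity.marginalP_eq (h : E.HasSearchDensity σ p T t₀)
    (hs : E.IsSearchFrom σ p T t₀) (hσ : 0 ≤ σ) (hσ1 : σ < 1) {s : ℝ} (hs0 : 0 ≤ s)
    (hm : s ∉ Ico t₀ T) : E.marginalP σ p s = noFake σ p s * E.marginal s :=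
  (h.optimalResponse hs hσ hσ1).marginalP_of_not_charges hσ hσ1 hs0
    (h.not_charges (by rwa [ENNReal.toReal_ofReal hs0]))

theorem HasSearchDensity.gainP_eq (h : E.HasSearchDensity σ p T t₀)
    (hs : E.IsSearchFrom σ p T t₀) (hσ : 0 ≤ σ) (hσ1 : σ < 1) (hT : E.haz T = E.phiP) {u : ℝ≥0∞}
    (hu0 : ENNReal.ofReal t₀ ≤ u) (huT : u ≤ ENNReal.ofReal T) :
    E.gainP σ p u = E.gainP σ p (ENNReal.ofReal t₀) := by
  have hsub : upTo (ENNReal.ofReal t₀) ⊆ upTo u := fun x hx => ⟨hx.1, hx.2.trans hu0⟩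
  refine setIntegral_eq_of_subset_of_forall_sdiff_eq_zero (measurableSet_upTo u) hsub
    fun x hx => ?_
  have hx1 : t₀ ≤ x := le_of_not_ge fun h' => hx.2 ⟨hx.1.1, ENNReal.ofReal_le_ofReal h'⟩
  have hx2 : x ≤ T :=
    (ENNReal.ofReal_le_ofReal_iff (hs.pos.trans hs.lt).le).1 (hx.1.2.trans huT)
  rcases hx2.eq_or_lt with h' | h'
  -- At T the faking density is set to zero, but first-best marginal value also vanishes there
  -- because H = φ_P.
  · rw [h'] at hx ⊢
    rw [h.marginalP_eq hs hσ hσ1 hx.1.1 fun hm => lt_irrefl _ hm.2, marginal, hT, phiP,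
      mul_div_cancel₀ _ (mul_pos E.μ_pos (sub_pos.2 E.θ_lt_one)).ne']
    ring
  · exact h.marginalP_eq_zero hs hσ hσ1 ⟨hx1, h'⟩

theorem HasSearchDensity.gainP_lt (h : E.HasSearchDensity σ p T t₀)
    (hs : E.IsSearchFrom σ p T t₀) (hσ : 0 ≤ σ) (hσ1 : σ < 1) (hT : E.haz T = E.phiP) {u : ℝ≥0∞}
    (hu0 : u < ENNReal.ofReal t₀) : E.gainP σ p u < E.gainP σ p (ENNReal.ofReal t₀) := by
  refine integral_upTo_gt ((h.optimalResponse hs hσ hσ1).integrableOn_marginalP hσ hσ1) hu0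
    fun x hx0 hx1 hx2 => ?_
  have hxt := (ENNReal.ofReal_lt_ofReal_iff_of_nonneg hx0).1 hx2
  rw [h.marginalP_eq hs hσ hσ1 hx0 fun hm => hm.1.not_gt hxt]
  exact mul_pos (noFake_pos hσ hσ1 x) (marginal_pos (phiP_lt_haz hT hx0 (hxt.trans hs.lt)))

theorem HasSearchDensity.gainP_le (h : E.HasSearchDensity σ p T t₀)
    (hs : E.IsSearchFrom σ p T t₀) (hσ : 0 ≤ σ) (hσ1 : σ < 1) (hT : E.haz T = E.phiP) (u : ℝ≥0∞) :
    E.gainP σ p u ≤ E.gainP σ p (ENNReal.ofReal t₀) := by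
  rcases lt_or_ge u (ENNReal.ofReal t₀) with h0 | h0
  · exact (h.gainP_lt hs hσ hσ1 hT h0).le
  · rcases le_or_gt u (ENNReal.ofReal T) with h1 | h1
    · exact (h.gainP_eq hs hσ hσ1 hT h0 h1).le
    · rw [← h.gainP_eq hs hσ hσ1 hT (ENNReal.ofReal_le_ofReal hs.lt.le) le_rfl]
      have hT0 : 0 ≤ T := (hs.pos.trans hs.lt).le
      refine (integral_upTo_lt ((h.optimalResponse hs hσ hσ1).integrableOn_marginalP hσ hσ1) h1
        fun x hx0 hx1 hx2 => ?_).le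
      have hxt := (ENNReal.ofReal_lt_ofReal_iff_of_nonneg hT0).1 hx1
      exact (h.optimalResponse hs hσ hσ1).marginalP_neg_of_haz_lt hσ hσ1 hx0
        (hT ▸ E.haz_lt_haz hT0 hxt)

theorem IsSearchFrom.marginalA_eq (hs : E.IsSearchFrom σ p T t₀) {s : ℝ} (h0 : 0 ≤ s) :
    E.marginalA p s = (E.μ - E.β) * ((E.stopRate s + (E.ρ + E.haz s)) *
      (E.dsurv s * noStop p s)) := by
  have := congrArg (fun z => E.dsurv s * noStop p s * z) (stopRate_add_eq (E := E) s)
  rw [marginalA, hs.response s h0, mul_one, ← this]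
  ring

/-- The agent's value of waiting during the phase of faking. -/
theorem IsSearchFrom.integral_marginalA (hs : E.IsSearchFrom σ p T t₀) {t : ℝ}
    (ht : t ∈ Icc t₀ T) : ∫ x in t₀..t, E.marginalA p x = (E.μ - E.β) * (E.dsurv t₀ *
      (1 - Real.exp (-∫ x in t₀..t, (E.stopRate x + (E.ρ + E.haz x))))) := by
  have hk : Continuous fun s => E.stopRate s + (E.ρ + E.haz s) :=
    continuous_stopRate.add (continuous_const.add E.continuous_haz)
  rw [← integral_mul_exp_neg hk, ← intervalIntegral.integral_const_mul,
    ← intervalIntegral.integral_const_mul, intervalIntegral.integral_of_le ht.1,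
    intervalIntegral.integral_of_le ht.1, ← integral_Ico_eq_integral_Ioc,
    ← integral_Ico_eq_integral_Ioc]
  refine setIntegral_congr_fun measurableSet_Ico fun x hx => ?_
  have hadd : ∫ s in t₀..x, (E.stopRate s + (E.ρ + E.haz s)) =
      (∫ s in t₀..x, E.stopRate s) + ∫ s in t₀..x, (E.ρ + E.haz s) :=
    intervalIntegral.integral_add (continuous_stopRate.intervalIntegrable _ _)
      ((continuous_const.add E.continuous_haz).intervalIntegrable _ _)
  simp only [hs.marginalA_eq (hs.pos.le.trans hx.1)]
  rw [hs.noStop_between x ⟨hx.1, hx.2.trans_le ht.2⟩, dsurv_eq_mul_exp hx.1, hadd, neg_add,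
    Real.exp_add]
  ring

theorem IsSearchFrom.uA_real (hs : E.IsSearchFrom σ p T t₀) {t : ℝ} (ht : 0 ≤ t) :
    E.uA p (ENNReal.ofReal t) = E.β + (∫ x in (0 : ℝ)..t, E.marginalA p x) +
      (E.μ - E.β) * (E.dsurv t * noStop p t) := by
  rw [E.uA_eq, E.dsurvTop_ofReal ht, ENNReal.toReal_ofReal ht, hs.response t ht,
    integral_upTo_ofReal _ ht, noStop]
  ring

theorem IsSearchFrom.uA_eq_of_mem (hs : E.IsSearchFrom σ p T t₀) {t : ℝ} (ht : t ∈ Ico t₀ T) :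
    E.uA p (ENNReal.ofReal t) = E.uA p (ENNReal.ofReal t₀) := by
  have ht0 := hs.pos.le.trans ht.1
  have hadd : ∫ s in t₀..t, (E.stopRate s + (E.ρ + E.haz s)) =
      (∫ s in t₀..t, E.stopRate s) + ∫ s in t₀..t, (E.ρ + E.haz s) :=
    intervalIntegral.integral_add (continuous_stopRate.intervalIntegrable _ _)
      ((continuous_const.add E.continuous_haz).intervalIntegrable _ _)
  have hint := E.integrableOn_marginalA (p := p)
  rw [hs.uA_real ht0, hs.uA_real hs.pos.le, ← intervalIntegral.integral_add_adjacent_intervals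
    (intervalIntegrable_of_integrableOn_Ici hint le_rfl hs.pos.le)
    (intervalIntegrable_of_integrableOn_Ici hint hs.pos.le ht0),
    hs.integral_marginalA ⟨ht.1, ht.2.le⟩, hs.noStop_between t ht,
    hs.noStop_before t₀ ⟨hs.pos.le, le_rfl⟩, dsurv_eq_mul_exp ht.1, hadd, neg_add, Real.exp_add]
  ring

/-- Before t₀ delaying the fake gains, at a rate proportional to `stopRate`; during the phase the
agent is indifferent; from T on the fake comes too late and its value is lost. -/
theorem IsSearchFrom.uA_le (hs : E.IsSearchFrom σ p T t₀) (hA2 : E.A2) (hT : E.haz T = E.phiP)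
    (u : ℝ≥0∞) : E.uA p u ≤ E.uA p (ENNReal.ofReal t₀) := by
  have hb : 0 < E.μ - E.β := sub_pos.2 E.β_lt_μ
  have hint := E.integrableOn_marginalA (p := p)
  have hT0 : 0 ≤ T := (hs.pos.trans hs.lt).le
  rcases lt_or_ge u (ENNReal.ofReal T) with hu | hu
  · obtain ⟨t, ht0, rfl⟩ : ∃ t : ℝ, 0 ≤ t ∧ ENNReal.ofReal t = u :=
      ⟨u.toReal, ENNReal.toReal_nonneg, ENNReal.ofReal_toReal (hu.trans_le le_top).ne⟩
    rw [ENNReal.ofReal_lt_ofReal_iff_of_nonneg ht0] at hu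
    rcases le_or_gt t₀ t with h' | h'
    · exact (hs.uA_eq_of_mem ⟨h', hu⟩).le
    · have h1 : ∫ x in t..t₀, E.marginalA p x =
          (E.μ - E.β) * ((∫ x in t..t₀, E.stopRate x * E.dsurv x) + (E.dsurv t - E.dsurv t₀)) := by
        have hadd : ∫ x in t..t₀, (E.stopRate x * E.dsurv x + E.dsurv x * (E.ρ + E.haz x)) =
            (∫ x in t..t₀, E.stopRate x * E.dsurv x) +
              ∫ x in t..t₀, E.dsurv x * (E.ρ + E.haz x) :=
          intervalIntegral.integral_add
            ((continuous_stopRate.mul E.continuous_dsurv).intervalIntegrable _ _)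
            ((E.continuous_dsurv.mul (continuous_const.add E.continuous_haz)).intervalIntegrable _ _)
        rw [← integral_deriv_dsurv_interval, ← hadd, ← intervalIntegral.integral_const_mul]
        refine intervalIntegral.integral_congr fun x hx => ?_
        rw [uIcc_of_le h'.le] at hx
        simp only [hs.marginalA_eq (ht0.trans hx.1),
          hs.noStop_before x ⟨ht0.trans hx.1, hx.2⟩]
        ring
      have h2 : 0 ≤ ∫ x in t..t₀, E.stopRate x * E.dsurv x :=
        intervalIntegral.integral_nonneg h'.le fun x hx => (mul_pos (stopRate_pos (hA2.trans
          (phiP_lt_haz hT (ht0.trans hx.1) (hx.2.trans_lt hs.lt)))) (E.dsurv_pos x)).le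
      rw [hs.uA_real ht0, hs.uA_real hs.pos.le, ← intervalIntegral.integral_add_adjacent_intervals
        (intervalIntegrable_of_integrableOn_Ici hint le_rfl ht0)
        (intervalIntegrable_of_integrableOn_Ici hint ht0 hs.pos.le), h1,
        hs.noStop_before t ⟨ht0, h'.le⟩, hs.noStop_before t₀ ⟨hs.pos.le, le_rfl⟩]
      have := mul_nonneg hb.le h2
      linarith
  · have hPT := hs.noStop_after T le_rfl
    have h1 : ∫ x in upTo u, E.marginalA p x =
        ∫ x in upTo (ENNReal.ofReal T), E.marginalA p x := by
      have hsub : upTo (ENNReal.ofReal T) ⊆ upTo u := fun x hx => ⟨hx.1, hx.2.trans hu⟩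
      refine setIntegral_eq_of_subset_of_forall_sdiff_eq_zero (measurableSet_upTo u) hsub
        fun x hx => ?_
      have hx' : T ≤ x := le_of_not_ge fun h' => hx.2 ⟨hx.1.1, ENNReal.ofReal_le_ofReal h'⟩
      rw [marginalA, hs.noStop_after x hx']; ring
    rw [E.uA_eq, cdf_eq_one hPT hu, h1, integral_upTo_ofReal _ hT0, hs.uA_real hs.pos.le,
      ← intervalIntegral.integral_add_adjacent_intervals
        (intervalIntegrable_of_integrableOn_Ici hint le_rfl hs.pos.le)
        (intervalIntegrable_of_integrableOn_Ici hint hs.pos.le hT0),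
      hs.integral_marginalA ⟨hs.lt.le, le_rfl⟩, hs.noStop_before t₀ ⟨hs.pos.le, le_rfl⟩]
    have := mul_pos hb (mul_pos (E.dsurv_pos t₀)
      (Real.exp_pos (-∫ x in t₀..T, (E.stopRate x + (E.ρ + E.haz x)))))
    linarith

theorem IsSearchFrom.isEquilibrium (hs : E.IsSearchFrom σ p T t₀)
    (h : E.HasSearchDensity σ p T t₀) (hA2 : E.A2) (hσ : 0 ≤ σ) (hσ1 : σ < 1)
    (hT : E.haz T = E.phiP) : E.IsEquilibrium σ p where
  faking_opt t t' ht := by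
    by_cases hm : t.toReal ∈ Ico t₀ T
    · have htop : t ≠ ∞ := fun h' => by
        rw [h', ENNReal.toReal_top] at hm
        exact hm.1.not_gt hs.pos
      rw [← ENNReal.ofReal_toReal htop, hs.uA_eq_of_mem hm]
      exact hs.uA_le hA2 hT t'
    · exact absurd ht (h.not_charges hm)
  response_one t ht _ := hs.response t ht
  response_zero t ht hb := absurd hb (h.lt_belief hσ hσ1 ht).le.not_gt
  stopping_opt t t' ht := by
    have ho := h.optimalResponse hs hσ hσ1
    rw [ho.uP_eq hσ hσ1, ho.uP_eq hσ hσ1]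
    have h1 := h.charges t ht
    have h2 := h.gainP_eq hs hσ hσ1 hT h1.1 h1.2
    have h3 := h.gainP_le hs hσ hσ1 hT t'
    rw [← h2] at h3
    exact (add_le_add_iff_left _).2 h3

theorem HasSearchDensity.beneficial (h : E.HasSearchDensity σ p T t₀)
    (hs : E.IsSearchFrom σ p T t₀) (hA2 : E.A2) (hσ : 0 ≤ σ) (hσ1 : σ < 1)
    (hT : E.haz T = E.phiP) : E.Beneficial σ p := by
  obtain ⟨u, hu⟩ := p.stopping.exists_charges
  have h1 := h.charges u hu
  rw [Beneficial, (hs.isEquilibrium h hA2 hσ hσ1 hT).payoffP_eq hσ hσ1 hu,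
    h.gainP_eq hs hσ hσ1 hT h1.1 h1.2]
  have := h.gainP_lt hs hσ hσ1 hT (u := ENNReal.ofReal 0)
    ((ENNReal.ofReal_lt_ofReal_iff_of_nonneg le_rfl).2 hs.pos)
  rw [gainP_zero] at this
  linarith

theorem exists_isSearchFrom (hA2 : E.A2) (hσ : 0 < σ) (hT : E.haz T = E.phiP)
    (h0 : 0 < t₀) (h0T : t₀ < T)
    (hexp : Real.exp (-∫ s in t₀..T, E.fakeRate s) = 1 - σ) :
    ∃ p, E.IsSearchFrom σ p T t₀ ∧ E.HasSearchDensity σ p T t₀ := by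
  have hk1 : ∀ s ∈ Ico t₀ T, 0 ≤ E.stopRate s := fun s hs =>
    (stopRate_pos (hA2.trans (phiP_lt_haz hT (h0.le.trans hs.1) hs.2))).le
  have hk2 : ∀ s ∈ Ico t₀ T, 0 ≤ E.fakeRate s := fun s hs =>
    (fakeRate_pos (phiP_lt_haz hT (h0.le.trans hs.1) hs.2)).le
  have hc1 : 1 - Real.exp (-∫ s in t₀..T, E.stopRate s) ≤ 1 := by
    linarith [Real.exp_pos (-∫ s in t₀..T, E.stopRate s)]
  have hc2 : 1 - Real.exp (-∫ s in t₀..T, E.fakeRate s) ≤ σ := by rw [hexp]; linarith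
  -- Normalization 1 leaves a stopping atom at T of mass exp(-∫ stopRate). Normalization σ leaves no
  -- faking atom, by the choice of `t₀` in `hexp`.
  set F₁ := MixedTime.ofRate continuous_stopRate h0.le h0T.le hk1 one_pos hc1 with hF₁
  set F₂ := MixedTime.ofRate continuous_fakeRate h0.le h0T.le hk2 hσ hc2 with hF₂
  set p : Profile := ⟨fun _ => 1, F₁, F₂, measurable_const, fun _ => zero_le_one,
    fun _ => le_rfl⟩ with hp
  have hN : ∀ t ∈ Ico t₀ T, noFake σ p t = Real.exp (-∫ s in t₀..t, E.fakeRate s) :=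
    fun t ht => by
      rw [noFake, MixedTime.cdf_ofRate continuous_fakeRate h0.le h0T.le hk2 hσ hc2 ht,
        mul_inv_cancel_left₀ hσ.ne', sub_sub_cancel]
  have hNa : ∀ t, T ≤ t → noFake σ p t = 1 - σ := fun t ht => by
    rw [noFake, MixedTime.cdf_ofRate_after continuous_fakeRate h0.le h0T.le hk2 hσ hc2
      (ENNReal.ofReal_le_ofReal ht), mul_one]
  refine ⟨p, ⟨h0, h0T, fun t ht => ?_, fun t ht => ?_, fun t ht => ?_, fun t ht => ?_,
    fun t ht => ?_, hNa, fun _ _ => rfl⟩, ⟨fun u => ?_, fun s hs => ?_, fun s hs => ?_,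
    fun u hu => MixedTime.charges_ofRate continuous_stopRate h0.le h0T.le hk1 one_pos hc1 hu⟩⟩
  · rw [noStop, MixedTime.cdf_ofRate_before continuous_stopRate h0.le h0T.le hk1 one_pos hc1 h0T
      ht.2, sub_zero]
  · rw [noStop, MixedTime.cdf_ofRate continuous_stopRate h0.le h0T.le hk1 one_pos hc1 ht,
      inv_one, one_mul, sub_sub_cancel]
  · rw [noStop, MixedTime.cdf_ofRate_after continuous_stopRate h0.le h0T.le hk1 one_pos hc1
      (ENNReal.ofReal_le_ofReal ht), sub_self]
  · rw [noFake, MixedTime.cdf_ofRate_before continuous_fakeRate h0.le h0T.le hk2 hσ hc2 h0T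
      ht.2, mul_zero, sub_zero]
  · rcases ht.2.eq_or_lt with h' | h'
    · rw [hNa t h'.ge, h', hexp]
    · exact hN t ⟨ht.1, h'⟩
  · change (Pi.single (ENNReal.ofReal T)
      (1 - σ⁻¹ * (1 - Real.exp (-∫ s in t₀..T, E.fakeRate s))) : ℝ≥0∞ → ℝ) u = 0
    rw [hexp, sub_sub_cancel, inv_mul_cancel₀ hσ.ne', sub_self, Pi.single_zero, Pi.zero_apply]
  · rw [hN s hs]
    change σ * (Ico t₀ T).indicator
      (fun s => σ⁻¹ * (E.fakeRate s * Real.exp (-∫ x in t₀..s, E.fakeRate x))) s = _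
    rw [indicator_of_mem hs, mul_inv_cancel_left₀ hσ.ne']
  · change (Ico t₀ T).indicator
      (fun s => σ⁻¹ * (E.fakeRate s * Real.exp (-∫ x in t₀..s, E.fakeRate x))) s = 0
    exact indicator_of_notMem hs _

end Environment

/-! ### The threshold σ̄ and the proposition -/

namespace Environment

variable {E : Environment} {σ T : ℝ}

theorem A1.exists_haz_eq (hA1 : E.A1) : ∃ T, 0 < T ∧ E.haz T = E.phiP := by
  obtain ⟨h0, L, hL, hLP⟩ := hA1
  obtain ⟨b, hb0, hb⟩ := ((eventually_ge_atTop 0).and (hL.eventually (gt_mem_nhds hLP))).exists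
  rw [← E.haz_eq hb0] at hb
  rw [← E.haz_eq le_rfl] at h0
  obtain ⟨T, hT, hTP⟩ := intermediate_value_Icc' hb0 E.continuous_haz.continuousOn
    ⟨hb.le, h0.le⟩
  refine ⟨T, lt_of_le_of_ne hT.1 fun h' => ?_, hTP⟩
  rw [← h'] at hTP
  exact h0.ne' hTP

/-- First-best marginal value changes sign from positive to negative exactly at T, so the maximizer
is unique. -/
theorem IsOptimalP.eq_ofReal {τP : ℝ≥0∞} (hτ : E.IsOptimalP τP) (hT0 : 0 ≤ T)
    (hT : E.haz T = E.phiP) : τP = ENNReal.ofReal T := by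
  have h := hτ (ENNReal.ofReal T)
  rw [uFBP_eq, uFBP_eq] at h
  have h' := (add_le_add_iff_left _).1 h
  rcases lt_trichotomy τP (ENNReal.ofReal T) with hlt | heq | hgt
  · refine absurd h' (not_le.2 (integral_upTo_gt E.integrableOn_marginal hlt fun x hx0 _ hx => ?_))
    exact marginal_pos (phiP_lt_haz hT hx0 ((ENNReal.ofReal_lt_ofReal_iff_of_nonneg hx0).1 hx))
  · exact heq
  · refine absurd h' (not_le.2 (integral_upTo_lt E.integrableOn_marginal hgt fun x _ hx _ => ?_))
    exact marginal_neg (hT ▸ E.haz_lt_haz hT0 ((ENNReal.ofReal_lt_ofReal_iff_of_nonneg hT0).1 hx))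

theorem sigmaBar_eq (hT0 : 0 ≤ T) : E.sigmaBar (ENNReal.ofReal T) =
    1 - Real.exp (-∫ s in (0 : ℝ)..T, E.fakeRate s) := by
  rw [sigmaBar, integral_upTo_ofReal _ hT0]
  have : ∫ s in (0 : ℝ)..T, (E.μ * (1 - E.θ) * E.hazard s - E.ρ * E.θ) / (E.θ - E.μ) =
      ∫ s in (0 : ℝ)..T, E.fakeRate s := by
    refine intervalIntegral.integral_congr fun s hs => ?_
    rw [uIcc_of_le hT0] at hs
    simp only [fakeRate, E.haz_eq hs.1]
  rw [this]

/-- σ̄ is the faking mass that a phase starting at 0 would absorb; a later start absorbs strictly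
less. -/
theorem IsSearchFrom.lt_sigmaBar {p : Profile} {t₀ : ℝ} (hT : E.haz T = E.phiP)
    (hs : E.IsSearchFrom σ p T t₀) : σ < E.sigmaBar (ENNReal.ofReal T) := by
  have h1 := hs.exp_eq
  have h2 := integral_fakeRate_lt hT le_rfl hs.pos hs.lt.le
  rw [← neg_lt_neg_iff, ← Real.exp_lt_exp] at h2
  rw [sigmaBar_eq (hs.pos.trans hs.lt).le]
  linarith

end Environment

end FakeNews

end

theorem proposition5 (E : FakeNews.Environment) (hA1 : E.A1) (hA2 : E.A2)
    (τP τA : ENNReal) (hτP : E.IsOptimalP τP) (hτA : E.IsOptimalA τA)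
    (hmild : E.MildConflict τA) :
    (∀ σ : ℝ, E.sigmaBar τP < σ → σ < 1 → ∀ p : FakeNews.Profile,
      E.IsEquilibrium σ p → E.payoffP σ p ≤ E.uD τA) ∧
    (E.θ < E.uD τA →
      (∃ σ₀ : ℝ, 0 < σ₀ ∧ σ₀ < 1 ∧ ∀ σ : ℝ, σ₀ < σ → σ < 1 → ∀ p : FakeNews.Profile,
        E.IsEquilibrium σ p → E.payoffP σ p < E.uD τA) ∧
      (∀ σ : ℝ, E.sigmaBar τP < σ → σ < 1 → ∀ p : FakeNews.Profile,
        E.IsEquilibrium σ p → E.payoffP σ p < E.uD τA) ∧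
      (∃ σD : ℝ, 0 < σD ∧ σD < E.sigmaBar τP ∧
        ∀ σ : ℝ, σD < σ → σ < E.sigmaBar τP →
          (∃ p : FakeNews.Profile, E.IsEquilibrium σ p ∧ E.Beneficial σ p ∧
            ∀ q : FakeNews.Profile, E.IsEquilibrium σ q → E.Beneficial σ q → q.Same p) ∧
          (∀ q : FakeNews.Profile, E.IsEquilibrium σ q → E.payoffP σ q < E.uD τA))) := by
  open FakeNews Environment in
  obtain ⟨T, hT0, hT⟩ := hA1.exists_haz_eq
  obtain rfl := hτP.eq_ofReal hT0.le hT
  have hbar := E.sigmaBar_eq hT0.le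
  have hbar0 : 0 < E.sigmaBar (ENNReal.ofReal T) := by
    have := integral_fakeRate_lt hT le_rfl hT0 le_rfl
    rw [intervalIntegral.integral_same] at this
    rw [hbar, sub_pos, Real.exp_lt_one_iff]
    linarith
  have hbar1 : E.sigmaBar (ENNReal.ofReal T) < 1 := by
    rw [hbar]; linarith [Real.exp_pos (-∫ s in (0 : ℝ)..T, E.fakeRate s)]
  -- A beneficial equilibrium would force σ < σ̄.
  have hhigh : ∀ σ : ℝ, E.sigmaBar (ENNReal.ofReal T) < σ → σ < 1 → ∀ p : Profile,
      E.IsEquilibrium σ p → E.payoffP σ p ≤ E.θ := fun σ hσ hσ1 p hp =>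
    not_lt.1 fun hben => by
      obtain ⟨t₀, hs, -⟩ := hp.exists_isSearchFrom hA2 (hbar0.trans hσ) hσ1 hT0.le hT hben
      exact (hs.lt_sigmaBar hT).not_gt hσ
  refine ⟨fun σ hσ hσ1 p hp => (hhigh σ hσ hσ1 p hp).trans hmild, fun hD =>
    ⟨⟨_, hbar0, hbar1, fun σ hσ hσ1 p hp => (hhigh σ hσ hσ1 p hp).trans_lt hD⟩,
      fun σ hσ hσ1 p hp => (hhigh σ hσ hσ1 p hp).trans_lt hD, ?_⟩⟩
  have hcont : Continuous fun t => ∫ s in (0 : ℝ)..t, E.marginal s :=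
    intervalIntegral.continuous_primitive (fun _ _ => E.continuous_marginal.intervalIntegrable _ _) 0
  -- The payoff as a function of the starting time is continuous with value θ at 0, hence stays
  -- below the delegation payoff for early starts.
  have hev : ∀ᶠ t in 𝓝 (0 : ℝ), E.θ + ∫ s in (0 : ℝ)..t, E.marginal s < E.uD τA := by
    refine ((continuous_const.add hcont).tendsto' 0 E.θ ?_).eventually (gt_mem_nhds hD)
    simp
  obtain ⟨d, hd0, hd⟩ := exists_Ico_subset_of_mem_nhds hev ⟨T, hT0⟩
  obtain ⟨t₁, ht₁, ht₁d⟩ := exists_between (lt_min hd0 hT0)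
  have ht₁T := ht₁d.trans_le (min_le_right _ _)
  have ht₁d' := ht₁d.trans_le (min_le_left _ _)
  have hΦ : Continuous fun t => Real.exp (-∫ s in t..T, E.fakeRate s) := by
    simp only [fun t => intervalIntegral.integral_symm (f := E.fakeRate) (μ := volume) T t, neg_neg]
    exact Real.continuous_exp.comp (intervalIntegral.continuous_primitive
      (fun _ _ => continuous_fakeRate.intervalIntegrable _ _) T)
  -- The witness is the σ whose faking phase starts at `t₁`; a larger σ means an earlier start.
  refine ⟨1 - Real.exp (-∫ s in t₁..T, E.fakeRate s), ?_, ?_, fun σ hσD hσ => ?_⟩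
  · have := integral_fakeRate_lt hT ht₁.le ht₁T le_rfl
    rw [intervalIntegral.integral_same] at this
    rw [sub_pos, Real.exp_lt_one_iff]
    linarith
  · rw [hbar, sub_lt_sub_iff_left, Real.exp_lt_exp, neg_lt_neg_iff]
    exact integral_fakeRate_lt hT le_rfl ht₁ ht₁T.le
  have hσ0 : 0 < σ := by
    have := integral_fakeRate_lt hT ht₁.le ht₁T le_rfl
    rw [intervalIntegral.integral_same] at this
    have h2 : Real.exp (-∫ s in t₁..T, E.fakeRate s) ≤ 1 := Real.exp_le_one_iff.2 (by linarith)
    linarith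
  have hσ1 : σ < 1 := hσ.trans hbar1
  rw [hbar] at hσ
  constructor
  -- The exponential takes the values 1 - σ̄ at 0 and 1 minus the witness at `t₁`, and 1 - σ lies
  -- strictly between.
  · obtain ⟨t₀, ht₀, hexp⟩ := intermediate_value_Icc ht₁.le hΦ.continuousOn
      (show 1 - σ ∈ _ from ⟨by linarith, by linarith⟩)
    have h0 : 0 < t₀ := lt_of_le_of_ne ht₀.1 fun h' => by
      rw [← h'] at hexp
      simp only at hexp
      linarith
    obtain ⟨p, hs, hp⟩ := exists_isSearchFrom hA2 hσ0 hT h0 (ht₀.2.trans_lt ht₁T) hexp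
    refine ⟨p, hs.isEquilibrium hp hA2 hσ0.le hσ1 hT, hp.beneficial hs hA2 hσ0.le hσ1 hT,
      fun q hq hqb => ?_⟩
    obtain ⟨t₂, hs₂, -⟩ := hq.exists_isSearchFrom hA2 hσ0 hσ1 hT0.le hT hqb
    obtain rfl := hs₂.eq hT hs
    exact hs₂.same hσ0 hs
  · intro q hq
    rcases le_or_gt (E.payoffP σ q) E.θ with hle | hben
    · exact hle.trans_lt hD
    · obtain ⟨t₂, hs₂, hpay⟩ := hq.exists_isSearchFrom hA2 hσ0 hσ1 hT0.le hT hben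
      rw [hpay]
      -- A start after `t₁` would leave less faking mass than the witness, contradicting the lower
      -- bound on σ.
      refine hd ⟨hs₂.pos.le, lt_of_le_of_lt (not_lt.1 fun hlt => ?_) ht₁d'⟩
      have h1 := integral_fakeRate_lt hT ht₁.le hlt hs₂.lt.le
      rw [← neg_lt_neg_iff, ← Real.exp_lt_exp, hs₂.exp_eq] at h1
      linarith
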